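/- **Model.** There are $L$ propagation paths. Path $l$ has a departure azimuth and elevation $\phi^l_{\rm az},\phi^l_{\rm el}$, an arrival azimuth and elevation $\theta^l_{\rm az},\theta^l_{\rm el}$, a delay $\tau_l$ and a complex gain $\gamma_l\neq 0$. Let $\Delta f>0$ be the subcarrier spacing and $c>0$ the speed of light. The angular frequencies are $$\omega_{l,1}=\pi\sin\phi^l_{\rm az}\sin\phi^l_{\rm el},\quad \omega_{l,2}=\pi\cos\phi^l_{\rm el},\quad \omega_{l,3}=\pi\sin\theta^l_{\rm az}\sin\theta^l_{\rm el},\quad \omega_{l,4}=\pi\cos\theta^l_{\rm el},\quad \omega_{l,5}=-2\pi\Delta f\,\tau_l ,$$ and $\Phi_{l,n}=e^{j\omega_{l,n}}$. Write $a^{(M)}(\omega)=[1,e^{j\omega},\dots,e^{j(M-1)\omega}]^T$ and $A_n^{(M)}=[a^{(M)}(\omega_{1,n}),\dots,a^{(M)}(\omega_{L,n})]$. For $n\le 4$ let $T_n\in\mathbb C^{M_n\times N_n}$, $T_n^H=[t_{n,1},\dots,t_{n,M_n}]$, $B_n=T_n^HA_n^{(M_n)}$. With the Khatri–Rao product $\odot$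 the noiseless beamspace channel is $$h=(B_1\odot B_2\odot B_3\odot B_4\odot A_5^{(M_5)})\,\gamma\in\mathbb C^{N_1N_2N_3N_4M_5},$$ with entries $h_{n_1,n_2,n_3,n_4,m}$. Let $L_5+K_5=M_5+1$, and let $\mathcal S(h)\in\mathbb C^{N_1N_2N_3N_4K_5\times L_5}$ be the matrix with entry $h_{n_1,n_2,n_3,n_4,k+\ell-1}$ in row $(n_1,n_2,n_3,n_4,k)$ and column $\ell$. Put $P=B_1\odot\cdots\odot B_4\odot A_5^{(K_5)}$ and $G=A_5^{(L_5)}$. **Selection matrices.** Assume for $n\le4$ that $[I_{M_n-1},0]\,T_n=[0,I_{M_n-1}]\,T_nF_n$ with $F_n$ nonsingular, and that $Q_n\in\mathbb C^{N_n\times N_n}$ satisfies $Q_nt_{n,M_n}=0$ and $Q_nF_n^Ht_{n,1}=0$. For $n\le4$ let $\breve J_{n,1}$, $\breve J_{n,2}$ be the Kronecker products of identity matrices of sizes $N_1,\dots,N_4,K_5$ in which the $n$-th factor is replaced by $Q_n$, respectively $Q_nF_n^H$; let $\breve J_{5,1}=I_{N_1N_2N_3N_4}\otimes[I_{K_5-1},0]$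 and $\breve J_{5,2}=I_{N_1N_2N_3N_4}\otimes[0,I_{K_5-1}]$. Assume that $G$ and $\breve J_{n,1}P$ ($n=1,\dots,5$) have full column rank, and that $\beta\in\mathbb C^5$ is such that the $L$ numbers $\sum_n\beta_n\Phi_{l,n}$ are distinct. **Estimator.** For an observation $\tilde h$, let the columns of $\tilde U$ be $L$ leading left singular vectors of $\mathcal S(\tilde h)$, $\tilde\Gamma_n=(\breve J_{n,1}\tilde U)^\dagger\breve J_{n,2}\tilde U$ ($\dagger$ is the Moore–Penrose pseudoinverse), let $\tilde E$ be invertible with $\tilde E^{-1}\big(\sum_n\beta_n\tilde\Gamma_n\big)\tilde E$ diagonal, $\tilde\Phi_{l,n}=(\tilde E^{-1}\tilde\Gamma_n\tilde E)_{l,l}$ and $\hat\omega_{l,n}=\Im\ln\tilde\Phi_{l,n}$. Channel parameter estimates are parameters $(\hat\phi^l_{\rm az},\hat\phi^l_{\rm el},\hat\theta^l_{\rm az},\hat\theta^l_{\rm el},\hat\tau_l)_{l\le L}$ whose angular frequencies are $\hat\omega_{l,n}$. The order of the paths, the branch of the logarithm and the angles are not unique; this is resolved by taking the estimates in a fixed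 sufficiently small neighbourhood $V$ of the true parameters. With base station position $p_T\in\mathbb R^3$ and weights $\iota_l\ge0$, the user position estimate is $$\hat p_R=\Big(\sum_lC_l\Big)^{-1}\sum_lC_l\delta_l,\quad C_l=\iota_l\Big(I-\frac{\mu_l\mu_l^T}{\|\mu_l\|^2}\Big),\quad \mu_l=c\tau_l(f_{T,l}+f_{R,l}),\quad \delta_l=p_T-c\tau_lf_{R,l},$$ evaluated at the channel parameter estimates, where $f_{T,l}=f(\phi^l_{\rm az},\phi^l_{\rm el})$, $f_{R,l}=f(\theta^l_{\rm az},\theta^l_{\rm el})$, $f(\alpha,\epsilon)=[\cos\alpha\sin\epsilon,\sin\alpha\sin\epsilon,\cos\epsilon]^T$ (and $C_l=0$ if $\iota_l=0$). From here on $C_l,\mu_l,\delta_l,f_{T,l},f_{R,l}$ are taken at the true parameters. Assume that $\cos\phi^l_{\rm az},\sin\phi^l_{\rm el},\cos\theta^l_{\rm az},\sin\theta^l_{\rm el}$ are nonzero for all $l$, that $\mu_l\ne0$ whenever $\iota_l\neq0$, that $\sum_lC_l$ is invertible, and that the true parameters are those of paths between $p_T$ and the user position $p_R$ with at most one interaction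 point: for each $l$ there are $s_l\in\mathbb R^3$ and $d_l,d_l'\ge0$ with $s_l-p_T=d_lf_{T,l}$, $s_l-p_R=d_l'f_{R,l}$, $c\tau_l=d_l+d_l'$. **First-order coefficients.** With $b_l$ the $l$-th unit vector, let $\lambda_{l,n}^H=b_l^T(\breve J_{n,1}P)^\dagger(\breve J_{n,2}-\Phi_{l,n}\breve J_{n,1})$ and $\chi_l^*=(G^T)^\dagger b_l$. Let $\xi_{l,n}\in\mathbb C^{N_1N_2N_3N_4M_5}$ consist, for every $(n_1,n_2,n_3,n_4)$, of the convolution of the corresponding length-$K_5$ block of $\lambda_{l,n}$ with $\chi_l$; let $\upsilon_{l,n}=\Phi_{l,n}\xi_{l,n}/\gamma_l^*$ and $$\kappa_{l,1}=\frac{\upsilon_{l,1}}{\pi\cos\phi^l_{\rm az}\sin\phi^l_{\rm el}}+\frac{\sin\phi^l_{\rm az}\cos\phi^l_{\rm el}\,\upsilon_{l,2}}{\pi\cos\phi^l_{\rm az}\sin^2\phi^l_{\rm el}},\qquad \kappa_{l,2}=-\frac{\upsilon_{l,2}}{\pi\sin\phi^l_{\rm el}},$$ $$\kappa_{l,3}=\frac{\upsilon_{l,3}}{\pi\cos\theta^l_{\rm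 az}\sin\theta^l_{\rm el}}+\frac{\sin\theta^l_{\rm az}\cos\theta^l_{\rm el}\,\upsilon_{l,4}}{\pi\cos\theta^l_{\rm az}\sin^2\theta^l_{\rm el}},\qquad \kappa_{l,4}=-\frac{\upsilon_{l,4}}{\pi\sin\theta^l_{\rm el}},\qquad \kappa_{l,5}=-\frac{\upsilon_{l,5}}{2\pi\Delta f}.$$ Let $\Omega_{T,l},\Omega_{R,l}\in\mathbb R^{3\times2}$ be the Jacobian matrices of $f$ at $(\phi^l_{\rm az},\phi^l_{\rm el})$ and $(\theta^l_{\rm az},\theta^l_{\rm el})$, and $$\breve C_l=\iota_l\Big(\frac{2\mu_l^T(\delta_l-p_R)\,\mu_l\mu_l^T}{\|\mu_l\|^4}-\frac{\mu_l^T(\delta_l-p_R)\,I+\mu_l(\delta_l-p_R)^T}{\|\mu_l\|^2}\Big)$$ (zero if $\iota_l=0$), $$\breve D_l=-c\Big(\sum_\ell C_\ell\Big)^{-1}C_l\,[\tau_l\Omega_{R,l},\ f_{R,l}]\in\mathbb R^{3\times3},\qquad \breve E_l=c\Big(\sum_\ell C_\ell\Big)^{-1}\breve C_l\,[\tau_l\Omega_{T,l},\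 \tau_l\Omega_{R,l},\ f_{T,l}+f_{R,l}]\in\mathbb R^{3\times5},$$ $$\Psi=\sum_{l=1}^L\Big(\breve D_l[\kappa_{l,3},\kappa_{l,4},\kappa_{l,5}]^H+\breve E_l[\kappa_{l,1},\kappa_{l,2},\kappa_{l,3},\kappa_{l,4},\kappa_{l,5}]^H\Big)\in\mathbb C^{3\times N_1N_2N_3N_4M_5}.$$ **Claim.** The first-order perturbation of the position estimate under a beamspace channel estimation error $\Delta h$ is $\Delta p_R=\Im\{\Psi\Delta h\}$. Precisely: there is a neighbourhood $V$ of the true parameters such that for all sufficiently small $\Delta h$ the observation $\tilde h=h+\Delta h$ has channel parameter estimates in $V$, and such that every position estimate $\hat p_R$ computed from estimates in $V$ for $\tilde h=h+\Delta h$ satisfies $$\hat p_R-p_R=\Im\{\Psi\Delta h\}+o(\|\Delta h\|)\qquad(\Delta h\to0),$$ uniformly over all choices in the estimator. -/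

import Mathlib

open Matrix Topology Filter
open scoped Kronecker

noncomputable section

/-! ### Moore-Penrose pseudoinverse -/

/-- `X` satisfies the four Penrose equations for `A`. -/
structure IsMoorePenrose {m n : Type*} [Fintype m] [Fintype n]
    (A : Matrix m n ℂ) (X : Matrix n m ℂ) : Prop where
  mul_mul_left : A * X * A = A
  mul_mul_right : X * A * X = X
  herm_left : (A * X)ᴴ = A * X
  herm_right : (X * A)ᴴ = X * A

theorem IsMoorePenrose.unique {m n : Type*} [Fintype m] [Fintype n]
    {A : Matrix m n ℂ} {X Y : Matrix n m ℂ}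
    (hX : IsMoorePenrose A X) (hY : IsMoorePenrose A Y) : X = Y := by
  have h1 : A * X = A * Y := by
    calc A * X = (A * Y * A) * X := by rw [hY.mul_mul_left]
      _ = (A * Y) * (A * X) := by simp only [Matrix.mul_assoc]
      _ = (A * Y)ᴴ * (A * X)ᴴ := by rw [hY.herm_left, hX.herm_left]
      _ = ((A * X) * (A * Y))ᴴ := by rw [Matrix.conjTranspose_mul (A * X)]
      _ = ((A * X * A) * Y)ᴴ := by simp only [Matrix.mul_assoc]
      _ = A * Y := by rw [hX.mul_mul_left, hY.herm_left]
  have h2 : X * A = Y * A := by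
    calc X * A = X * (A * Y * A) := by rw [hY.mul_mul_left]
      _ = (X * A) * (Y * A) := by simp only [Matrix.mul_assoc]
      _ = (X * A)ᴴ * (Y * A)ᴴ := by rw [hY.herm_right, hX.herm_right]
      _ = ((Y * A) * (X * A))ᴴ := by rw [Matrix.conjTranspose_mul (Y * A)]
      _ = (Y * (A * X * A))ᴴ := by simp only [Matrix.mul_assoc]
      _ = Y * A := by rw [hX.mul_mul_left, hY.herm_right]
  calc X = X * A * X := hX.mul_mul_right.symm
    _ = Y * (A * X) := by rw [h2, Matrix.mul_assoc]
    _ = Y * A * Y := by rw [h1, Matrix.mul_assoc]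
    _ = Y := hY.mul_mul_right

open scoped ComplexOrder in
theorem exists_isMoorePenrose {m n : Type*} [Fintype m] [Fintype n]
    (A : Matrix m n ℂ) : ∃ X, IsMoorePenrose A X := by
  classical
  have hA := Matrix.isHermitian_conjTranspose_mul_self A
  obtain ⟨W, d, hW, hW', hG⟩ : ∃ (W : Matrix n n ℂ) (d : n → ℝ), Wᴴ * W = 1 ∧ W * Wᴴ = 1 ∧
      Aᴴ * A = W * diagonal (fun i => (d i : ℂ)) * Wᴴ := by
    refine ⟨hA.eigenvectorUnitary, hA.eigenvalues, ?_, ?_, ?_⟩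
    · exact Unitary.coe_star_mul_self _
    · exact Unitary.coe_mul_star_self _
    · have h := hA.spectral_theorem
      rw [Unitary.conjStarAlgAut_apply] at h
      exact h
  set D : Matrix n n ℂ := diagonal (fun i => (d i : ℂ)) with hD
  set D' : Matrix n n ℂ := diagonal (fun i => ((d i)⁻¹ : ℂ)) with hD'
  set Y : Matrix n n ℂ := W * D' * Wᴴ with hY
  have hYh : Yᴴ = Y := by
    have : D'ᴴ = D' := by
      rw [hD', diagonal_conjTranspose]; congr 1; ext i; simp
    rw [hY, conjTranspose_mul, conjTranspose_mul, this, conjTranspose_conjTranspose,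
      Matrix.mul_assoc]
  have key : ∀ P R : Matrix n n ℂ, W * P * Wᴴ * (W * R * Wᴴ) = W * (P * R) * Wᴴ := by
    intro P R
    calc W * P * Wᴴ * (W * R * Wᴴ) = W * P * (Wᴴ * W) * R * Wᴴ := by
          simp only [Matrix.mul_assoc]
      _ = W * (P * R) * Wᴴ := by rw [hW, Matrix.mul_one]; simp only [Matrix.mul_assoc]
  have hYG : Y * (Aᴴ * A) = W * (D' * D) * Wᴴ := by rw [hG, hY, key]
  have hYGh : (Y * (Aᴴ * A))ᴴ = Y * (Aᴴ * A) := by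
    have : (D' * D)ᴴ = D' * D := by
      rw [hD', hD, diagonal_mul_diagonal, diagonal_conjTranspose]; congr 1; ext i; simp
    rw [hYG, conjTranspose_mul, conjTranspose_mul, this, conjTranspose_conjTranspose,
      Matrix.mul_assoc, Matrix.mul_assoc, Matrix.mul_assoc]
  have hYGY : Y * (Aᴴ * A) * Y = Y := by
    rw [hYG, hY, key]; congr 2
    rw [hD', hD, diagonal_mul_diagonal, diagonal_mul_diagonal]; congr 1; ext i
    by_cases h : (d i : ℂ) = 0 <;> simp [h]
  have hGYG : (Aᴴ * A) * (Y * (Aᴴ * A)) = Aᴴ * A := by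
    rw [hYG, hG, key]; congr 2
    rw [hD', hD, diagonal_mul_diagonal, diagonal_mul_diagonal]; congr 1; ext i
    by_cases h : (d i : ℂ) = 0 <;> simp [h]
  refine ⟨Y * Aᴴ, ?_, ?_, ?_, ?_⟩
  · have h0 : Aᴴ * A * (1 - Y * (Aᴴ * A)) = 0 := by
      rw [Matrix.mul_sub, hGYG, Matrix.mul_one, sub_self]
    rw [conjTranspose_mul_self_mul_eq_zero, Matrix.mul_sub, Matrix.mul_one, sub_eq_zero] at h0
    calc A * (Y * Aᴴ) * A = A * (Y * (Aᴴ * A)) := by simp only [Matrix.mul_assoc]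
      _ = A := h0.symm
  · calc Y * Aᴴ * A * (Y * Aᴴ) = (Y * (Aᴴ * A) * Y) * Aᴴ := by simp only [Matrix.mul_assoc]
      _ = Y * Aᴴ := by rw [hYGY]
  · rw [conjTranspose_mul, conjTranspose_mul, conjTranspose_conjTranspose, hYh, Matrix.mul_assoc]
  · rw [Matrix.mul_assoc, hYGh]

/-- The Moore-Penrose pseudoinverse of a complex matrix. -/
def pinv {m n : Type*} [Fintype m] [Fintype n] (A : Matrix m n ℂ) : Matrix n m ℂ :=
  (exists_isMoorePenrose A).choose

theorem isMoorePenrose_pinv {m n : Type*} [Fintype m] [Fintype n] (A : Matrix m n ℂ) :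
    IsMoorePenrose A (pinv A) := (exists_isMoorePenrose A).choose_spec

/-! ### Leading left singular vectors -/

/-- The columns of `U` are `L` leading left singular vectors of `H`: there is a singular value
decomposition `H = U diag(σ) Vᴴ + U' diag(σ') V'ᴴ`, with orthonormal columns in `[U, U']` and in
`[V, V']`, nonnegative singular values, and every entry of `σ'` at most every entry of `σ`. -/
def IsLeadingLeftSingular {m n : Type*} [Fintype m] [Fintype n] {L : ℕ}
    (H : Matrix m n ℂ) (U : Matrix m (Fin L) ℂ) : Prop :=
  ∃ (k : ℕ) (U' : Matrix m (Fin k) ℂ) (V : Matrix n (Fin L) ℂ) (V' : Matrix n (Fin k) ℂ)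
    (σ : Fin L → ℝ) (σ' : Fin k → ℝ),
    Uᴴ * U = 1 ∧ U'ᴴ * U' = 1 ∧ Uᴴ * U' = 0 ∧
    Vᴴ * V = 1 ∧ V'ᴴ * V' = 1 ∧ Vᴴ * V' = 0 ∧
    (∀ i, 0 ≤ σ i) ∧ (∀ j, 0 ≤ σ' j) ∧ (∀ i j, σ' j ≤ σ i) ∧
    H = U * diagonal (fun i => (σ i : ℂ)) * Vᴴ + U' * diagonal (fun j => (σ' j : ℂ)) * V'ᴴ

/-! ### Selection matrices -/

/-- The `(K - 1) × K` matrix `[I, 0]`. -/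
def selFirst (K : ℕ) : Matrix (Fin (K - 1)) (Fin K) ℂ :=
  Matrix.of fun i j => if (j : ℕ) = i then 1 else 0

/-- The `(K - 1) × K` matrix `[0, I]`. -/
def selLast (K : ℕ) : Matrix (Fin (K - 1)) (Fin K) ℂ :=
  Matrix.of fun i j => if (j : ℕ) = i + 1 then 1 else 0

/-- The beamspace transformation `T` (of size `M × N`) has the shift invariance structure
`J₁ T = J₂ T F` with `F` nonsingular. -/
def HasShiftInvariance {M N : ℕ} (T : Matrix (Fin M) (Fin N) ℂ) (F : Matrix (Fin N) (Fin N) ℂ) :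
    Prop :=
  IsUnit F ∧ selFirst M * T = selLast M * T * F

/-- With `Tᴴ = [t_1, …, t_M]`: `Q t_M = 0` and `Q Fᴴ t_1 = 0`. -/
def RestoresShiftInvariance {M N : ℕ} (T : Matrix (Fin M) (Fin N) ℂ)
    (F Q : Matrix (Fin N) (Fin N) ℂ) : Prop :=
  (∀ m : Fin M, (m : ℕ) + 1 = M → Q *ᵥ (fun i => Tᴴ i m) = 0) ∧
  (∀ m : Fin M, (m : ℕ) = 0 → (Q * Fᴴ) *ᵥ (fun i => Tᴴ i m) = 0)

/-- The Vandermonde vector `[1, e^{jω}, …, e^{j(M-1)ω}]`. -/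
def vandermondeVec (M : ℕ) (ω : ℝ) : Fin M → ℂ :=
  fun m => Complex.exp (Complex.I * ((m : ℕ) : ℂ) * (ω : ℂ))

/-! ### Geometry: angles, delays, and the position estimator -/

/-- The five parameters of one path are listed as
`x 0 = φ_az`, `x 1 = φ_el` (departure), `x 2 = θ_az`, `x 3 = θ_el` (arrival), `x 4 = τ` (delay).
This is the vector of the five angular frequencies of the path. -/
def angFreq (Δf : ℝ) (x : Fin 5 → ℝ) : Fin 5 → ℝ :=
  ![Real.pi * Real.sin (x 0) * Real.sin (x 1),
    Real.pi * Real.cos (x 1),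
    Real.pi * Real.sin (x 2) * Real.sin (x 3),
    Real.pi * Real.cos (x 3),
    -(2 * Real.pi * Δf * x 4)]

/-- Unit vector with azimuth `az` and elevation `el`. -/
def dirVec (az el : ℝ) : Fin 3 → ℝ :=
  ![Real.cos az * Real.sin el, Real.sin az * Real.sin el, Real.cos el]

/-- Departure direction `f_T`. -/
def fT (x : Fin 5 → ℝ) : Fin 3 → ℝ := dirVec (x 0) (x 1)

/-- Arrival direction `f_R`. -/
def fR (x : Fin 5 → ℝ) : Fin 3 → ℝ := dirVec (x 2) (x 3)

/-- `μ = c τ (f_T + f_R)`. -/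
def muVec (c : ℝ) (x : Fin 5 → ℝ) : Fin 3 → ℝ := (c * x 4) • (fT x + fR x)

/-- `δ = p_T - c τ f_R`. -/
def deltaVec (c : ℝ) (pT : Fin 3 → ℝ) (x : Fin 5 → ℝ) : Fin 3 → ℝ := pT - (c * x 4) • fR x

/-- `C = ι (I - μ μᵀ / ‖μ‖²)`. -/
def projMat (c ι : ℝ) (x : Fin 5 → ℝ) : Matrix (Fin 3) (Fin 3) ℝ :=
  ι • (1 - (muVec c x ⬝ᵥ muVec c x)⁻¹ • vecMulVec (muVec c x) (muVec c x))

/-- The weighted least-squares position estimate `(∑ C_l)⁻¹ ∑ C_l δ_l`. -/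
def posEst {L : ℕ} (c : ℝ) (pT : Fin 3 → ℝ) (ι : Fin L → ℝ) (x : Fin L → Fin 5 → ℝ) :
    Fin 3 → ℝ :=
  (∑ l, projMat c (ι l) (x l))⁻¹ *ᵥ ∑ l, projMat c (ι l) (x l) *ᵥ deltaVec c pT (x l)

/-- A path from `pT` to `pR` with at most one interaction point `s`, with the angles and the delay
in `x` (the line of sight is the case of a point `s` on the segment from `pT` to `pR`). -/
def IsSingleBounce (c : ℝ) (pT pR : Fin 3 → ℝ) (x : Fin 5 → ℝ) : Prop :=
  ∃ (s : Fin 3 → ℝ) (dT dR : ℝ), 0 ≤ dT ∧ 0 ≤ dR ∧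
    s - pT = dT • fT x ∧ s - pR = dR • fR x ∧ c * x 4 = dT + dR

/-- Jacobian of `dirVec`. -/
def omegaMat (az el : ℝ) : Matrix (Fin 3) (Fin 2) ℝ :=
  !![-(Real.sin az * Real.sin el), Real.cos az * Real.cos el;
     Real.cos az * Real.sin el, Real.sin az * Real.cos el;
     0, -Real.sin el]

/-- `[τ Ω_R, f_R]`. -/
def blockD (x : Fin 5 → ℝ) : Matrix (Fin 3) (Fin 3) ℝ :=
  Matrix.of fun i => ![x 4 * omegaMat (x 2) (x 3) i 0, x 4 * omegaMat (x 2) (x 3) i 1, fR x i]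

/-- `[τ Ω_T, τ Ω_R, f_T + f_R]`. -/
def blockE (x : Fin 5 → ℝ) : Matrix (Fin 3) (Fin 5) ℝ :=
  Matrix.of fun i =>
    ![x 4 * omegaMat (x 0) (x 1) i 0, x 4 * omegaMat (x 0) (x 1) i 1,
      x 4 * omegaMat (x 2) (x 3) i 0, x 4 * omegaMat (x 2) (x 3) i 1, fT x i + fR x i]

/-- `C̆ = ι (2 μᵀ(δ - p_R) μ μᵀ / ‖μ‖⁴ - (μᵀ(δ - p_R) I + μ (δ - p_R)ᵀ) / ‖μ‖²)`. -/
def breveC (c ι : ℝ) (pT pR : Fin 3 → ℝ) (x : Fin 5 → ℝ) : Matrix (Fin 3) (Fin 3) ℝ :=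
  let μ := muVec c x
  let r := deltaVec c pT x - pR
  ι • ((2 * (μ ⬝ᵥ r) / (μ ⬝ᵥ μ) ^ 2) • vecMulVec μ μ
    - (μ ⬝ᵥ μ)⁻¹ • ((μ ⬝ᵥ r) • (1 : Matrix (Fin 3) (Fin 3) ℝ) + vecMulVec μ r))

namespace Beamspace

/-- The data of a beamspace multipath model with `L` paths, and of the estimator. Modes 1 to 4 are
the array dimensions, mode 5 is the frequency dimension. -/
structure Model (L : ℕ) where
  /-- array sizes `M_1, …, M_4` -/
  M : Fin 4 → ℕ
  /-- beamspace sizes `N_1, …, N_4` -/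
  N : Fin 4 → ℕ
  /-- number of subcarriers -/
  M5 : ℕ
  /-- smoothing window -/
  K5 : ℕ
  /-- number of smoothed snapshots -/
  L5 : ℕ
  smoothing : L5 + K5 = M5 + 1
  /-- beamspace transformations `T_n` -/
  T : ∀ n, Matrix (Fin (M n)) (Fin (N n)) ℂ
  /-- shift matrices `F_n` -/
  F : ∀ n, Matrix (Fin (N n)) (Fin (N n)) ℂ
  /-- restoring matrices `Q_n` -/
  Q : ∀ n, Matrix (Fin (N n)) (Fin (N n)) ℂ
  /-- true parameters `(φ_az, φ_el, θ_az, θ_el, τ)` of every path -/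
  x : Fin L → Fin 5 → ℝ
  /-- complex gains -/
  γ : Fin L → ℂ
  /-- subcarrier spacing -/
  Δf : ℝ
  /-- speed of light -/
  c : ℝ
  /-- position of the base station -/
  pT : Fin 3 → ℝ
  /-- position of the user -/
  pR : Fin 3 → ℝ
  /-- weights of the least-squares position estimate -/
  ι : Fin L → ℝ
  /-- coefficients of the combination of the five modes that is diagonalized -/
  β : Fin 5 → ℂ

variable {L : ℕ}

/-- Beam indices `(n_1, n_2, n_3, n_4)`. -/
abbrev Beam (S : Model L) : Type := ∀ i : Fin 4, Fin (S.N i)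

/-- Indices of the vectorized beamspace channel. -/
abbrev Idx (S : Model L) : Type := Beam S × Fin S.M5

/-- Row indices of the smoothed channel matrix. -/
abbrev SIdx (S : Model L) : Type := Beam S × Fin S.K5

/-- True angular frequencies `ω_{l,n}`. -/
def omega (S : Model L) (l : Fin L) (n : Fin 5) : ℝ := angFreq S.Δf (S.x l) n

/-- `Φ_{l,n} = exp(j ω_{l,n})`. -/
def Phi (S : Model L) (l : Fin L) (n : Fin 5) : ℂ := Complex.exp (Complex.I * (omega S l n : ℂ))

/-- `B_n = T_nᴴ A_n`, for the array modes. -/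
def B (S : Model L) (n : Fin 4) : Matrix (Fin (S.N n)) (Fin L) ℂ :=
  (S.T n)ᴴ * Matrix.of fun m l => vandermondeVec (S.M n) (omega S l n.castSucc) m

/-- The noiseless vectorized beamspace channel `(B_1 ⊙ ⋯ ⊙ B_4 ⊙ A_5) γ`. -/
def channel (S : Model L) : Idx S → ℂ :=
  fun p => ∑ l, S.γ l * (∏ i, B S i (p.1 i) l) * vandermondeVec S.M5 (omega S l 4) p.2

/-- The smoothing operation over the frequency domain. -/
def smooth (S : Model L) (h : Idx S → ℂ) : Matrix (SIdx S) (Fin S.L5) ℂ :=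
  Matrix.of fun p ℓ =>
    h (p.1, ⟨(p.2 : ℕ) + (ℓ : ℕ), by have := p.2.2; have := ℓ.2; have := S.smoothing; omega⟩)

/-- `P = B_1 ⊙ ⋯ ⊙ B_4 ⊙ A_5^{(K_5)}`. -/
def P (S : Model L) : Matrix (SIdx S) (Fin L) ℂ :=
  Matrix.of fun p l => (∏ i, B S i (p.1 i) l) * vandermondeVec S.K5 (omega S l 4) p.2

/-- `G = A_5^{(L_5)}`. -/
def G (S : Model L) : Matrix (Fin S.L5) (Fin L) ℂ :=
  Matrix.of fun ℓ l => vandermondeVec S.L5 (omega S l 4) ℓ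

/-- `I ⊗ ⋯ ⊗ A ⊗ ⋯ ⊗ I ⊗ I_{K_5}` with `A` in the array mode `n`. -/
def inMode (S : Model L) (n : Fin 4) (A : Matrix (Fin (S.N n)) (Fin (S.N n)) ℂ) :
    Matrix (SIdx S) (SIdx S) ℂ :=
  (Matrix.of fun a b : Beam S => if ∀ i, i ≠ n → a i = b i then A (a n) (b n) else 0)
    ⊗ₖ (1 : Matrix (Fin S.K5) (Fin S.K5) ℂ)

/-- `J̆_{n,1}` for the array modes. -/
def J1 (S : Model L) (n : Fin 4) : Matrix (SIdx S) (SIdx S) ℂ := inMode S n (S.Q n)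

/-- `J̆_{n,2}` for the array modes. -/
def J2 (S : Model L) (n : Fin 4) : Matrix (SIdx S) (SIdx S) ℂ := inMode S n (S.Q n * (S.F n)ᴴ)

/-- `J̆_{5,1}`. -/
def J1freq (S : Model L) : Matrix (Beam S × Fin (S.K5 - 1)) (SIdx S) ℂ :=
  (1 : Matrix (Beam S) (Beam S) ℂ) ⊗ₖ selFirst S.K5

/-- `J̆_{5,2}`. -/
def J2freq (S : Model L) : Matrix (Beam S × Fin (S.K5 - 1)) (SIdx S) ℂ :=
  (1 : Matrix (Beam S) (Beam S) ℂ) ⊗ₖ selLast S.K5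

/-! #### The estimator -/

/-- `Γ_n = (J̆_{n,1} U)^† J̆_{n,2} U`, `n = 1, …, 5`. -/
def Gam (S : Model L) (U : Matrix (SIdx S) (Fin L) ℂ) : Fin 5 → Matrix (Fin L) (Fin L) ℂ :=
  Fin.snoc (α := fun _ => Matrix (Fin L) (Fin L) ℂ)
    (fun n : Fin 4 => pinv (J1 S n * U) * (J2 S n * U))
    (pinv (J1freq S * U) * (J2freq S * U))

/-- `y` is an output of the channel parameter estimation for the observation `h`: with `U` formed
by `L` leading left singular vectors of the smoothed observation, `Γ_n` as above and
`E⁻¹ (∑ β_n Γ_n) E` diagonal, the angular frequencies of path `l` are the imaginary parts of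
logarithms of the diagonal entries `(E⁻¹ Γ_n E)_{l,l}`, and `y l` are parameters that have these
angular frequencies. (The order of the paths, the branch of the logarithm and the angles are
not unique.) -/
def IsParamEstimate (S : Model L) (h : Idx S → ℂ) (y : Fin L → Fin 5 → ℝ) : Prop :=
  ∃ (U : Matrix (SIdx S) (Fin L) ℂ) (E : Matrix (Fin L) (Fin L) ℂ) (d : Fin L → ℂ),
    IsLeadingLeftSingular (smooth S h) U ∧
    IsUnit E ∧ E⁻¹ * (∑ n, S.β n • Gam S U n) * E = diagonal d ∧
    ∀ l n, ∃ z : ℂ, Complex.exp z = (E⁻¹ * Gam S U n * E) l l ∧ angFreq S.Δf (y l) n = z.im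

/-! #### The first-order coefficients -/

/-- `λ_{l,n}ᴴ = b_lᵀ (J₁ P)^† (J₂ - Φ J₁)` for a pair `J₁, J₂` of selection matrices. -/
def lambdaH (S : Model L) {r : Type} [Fintype r] (A1 A2 : Matrix r (SIdx S) ℂ) (φ : ℂ)
    (l : Fin L) : SIdx S → ℂ :=
  (pinv (A1 * P S) * (A2 - φ • A1)) l

/-- `λ_{l,n}`, `n = 1, …, 5`. -/
def lambda (S : Model L) (l : Fin L) (n : Fin 5) : SIdx S → ℂ :=
  star (Fin.snoc (α := fun _ => SIdx S → ℂ)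
    (fun i : Fin 4 => lambdaH S (J1 S i) (J2 S i) (Phi S l i.castSucc) l)
    (lambdaH S (J1freq S) (J2freq S) (Phi S l 4) l) n)

/-- `χ_l`, the conjugate of `(Gᵀ)^† b_l`. -/
def chi (S : Model L) (l : Fin L) : Fin S.L5 → ℂ := fun ℓ => star (pinv (G S)ᵀ ℓ l)

/-- `ξ_{l,n}`: for each beam the convolution of the block of `λ_{l,n}` with `χ_l`. -/
def xi (S : Model L) (l : Fin L) (n : Fin 5) : Idx S → ℂ :=
  fun p => ∑ k : Fin S.K5, ∑ ℓ : Fin S.L5,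
    if (k : ℕ) + (ℓ : ℕ) = p.2 then lambda S l n (p.1, k) * chi S l ℓ else 0

/-- `υ_{l,n} = Φ_{l,n} ξ_{l,n} / γ_l^*`. -/
def upsilon (S : Model L) (l : Fin L) (n : Fin 5) : Idx S → ℂ :=
  (Phi S l n / star (S.γ l)) • xi S l n

/-- `κ_{l,1}, …, κ_{l,5}`. -/
def kappa (S : Model L) (l : Fin L) : Fin 5 → Idx S → ℂ :=
  let az := S.x l 0
  let el := S.x l 1
  let az' := S.x l 2
  let el' := S.x l 3
  ![((1 / (Real.pi * Real.cos az * Real.sin el) : ℝ) : ℂ) • upsilon S l 0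
      + ((Real.sin az * Real.cos el / (Real.pi * Real.cos az * Real.sin el ^ 2) : ℝ) : ℂ)
        • upsilon S l 1,
    -(((1 / (Real.pi * Real.sin el) : ℝ) : ℂ) • upsilon S l 1),
    ((1 / (Real.pi * Real.cos az' * Real.sin el') : ℝ) : ℂ) • upsilon S l 2
      + ((Real.sin az' * Real.cos el' / (Real.pi * Real.cos az' * Real.sin el' ^ 2) : ℝ) : ℂ)
        • upsilon S l 3,
    -(((1 / (Real.pi * Real.sin el') : ℝ) : ℂ) • upsilon S l 3),
    -(((1 / (2 * Real.pi * S.Δf) : ℝ) : ℂ) • upsilon S l 4)]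

/-- `[κ_{l,3}, κ_{l,4}, κ_{l,5}]ᴴ`. -/
def kappaH3 (S : Model L) (l : Fin L) : Matrix (Fin 3) (Idx S) ℂ :=
  Matrix.of fun i p => star (![kappa S l 2, kappa S l 3, kappa S l 4] i p)

/-- `[κ_{l,1}, …, κ_{l,5}]ᴴ`. -/
def kappaH5 (S : Model L) (l : Fin L) : Matrix (Fin 5) (Idx S) ℂ :=
  Matrix.of fun i p => star (kappa S l i p)

/-- `∑ C_l` at the true parameters. -/
def sumC (S : Model L) : Matrix (Fin 3) (Fin 3) ℝ := ∑ l, projMat S.c (S.ι l) (S.x l)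

/-- `D̆_l = -c (∑ C)⁻¹ C_l [τ Ω_R, f_R]`. -/
def breveD (S : Model L) (l : Fin L) : Matrix (Fin 3) (Fin 3) ℝ :=
  (-S.c) • ((sumC S)⁻¹ * projMat S.c (S.ι l) (S.x l) * blockD (S.x l))

/-- `Ĕ_l = c (∑ C)⁻¹ C̆_l [τ Ω_T, τ Ω_R, f_T + f_R]`. -/
def breveE (S : Model L) (l : Fin L) : Matrix (Fin 3) (Fin 5) ℝ :=
  S.c • ((sumC S)⁻¹ * breveC S.c (S.ι l) S.pT S.pR (S.x l) * blockE (S.x l))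

/-- `Ψ = ∑_l D̆_l [κ_{l,3}, κ_{l,4}, κ_{l,5}]ᴴ + Ĕ_l [κ_{l,1}, …, κ_{l,5}]ᴴ`. -/
def Psi (S : Model L) : Matrix (Fin 3) (Idx S) ℂ :=
  ∑ l, ((breveD S l).map Complex.ofReal * kappaH3 S l
    + (breveE S l).map Complex.ofReal * kappaH5 S l)

end Beamspace

end

/-! The smoothed noiseless channel factors as `P * (diagonal γ * Gᵀ)`. It has rank `L`, and `P`
obeys the shift relations `J₂ P = J₁ P diag(Φ)` in all five modes. Everything is perturbed around
this factorization.

Singular vectors are not unique and need not depend continuously on the data, so no expansion of `U`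
itself is attempted. The decomposition gives `H = U R₀ + Z` with `Z R₀ᴴ = 0`, where `Z` is of the
size of the perturbation, since the noiseless matrix has rank at most `L`. Let `X` be a matrix with
`P B X = P` whose columns lie in the range of `(P B)ᴴ`. Then `Z X` is of second order, so `W = U R₀
X = H X - Z X` equals `P + (H - P B) X` to first order. Hence `U` is `W` up to an invertible change
of basis (`leading_subspace_expansion`). That basis change is the same for all modes, and
`gam_expansion` gives `Γ_n = R (diag Φ_n + Λ_n) R⁻¹` with explicit first-order diagonal entries of
`Λ_n`.

Any diagonalizing `E` becomes `F = R⁻¹ E`, which diagonalizes a small perturbation of a diagonal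
matrix with distinct entries. The columns of `F` are nearly scaled coordinate vectors, so the
diagonal entries of `F⁻¹ (diag Φ_n + Λ_n) F` are `Φ_{j,n} + (Λ_n)_{jj}` up to second order, with one
index `j` for all modes (`exists_diagonalization_estimate`). The neighbourhood `V` forces `j = l`
and fixes the branch of the logarithm. The invertible Jacobian of the angular frequencies turns
phases into parameters.

For the position, the residual `∑ C_l (δ_l - p_R)` vanishes at the true parameters, because `δ_l -
p_R` is parallel to `μ_l`. Therefore the variation of `(∑ C_l)⁻¹` does not enter at first order
(`posEst_expansion`).

Uniformity over the estimator's choices comes from working on the type of all pairs (error,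
estimate), filtered by the error alone: a little-o there is a uniform bound. Existence combines
lower semicontinuity of rank, diagonalizability near a diagonal matrix with distinct entries, and
openness of the frequency map at the true parameters. -/

noncomputable section

/-! ### Pseudoinverses at full column rank -/

section Pseudoinverse

variable {m n : Type*} [Fintype m] [Fintype n] [DecidableEq n]

open scoped ComplexOrder in
theorem isUnit_conjTranspose_mul_self {A : Matrix m n ℂ} (h : LinearIndependent ℂ A.col) :
    IsUnit (Aᴴ * A) :=
  (Matrix.PosDef.conjTranspose_mul_self A (Matrix.mulVec_injective_iff.2 h)).isUnit

theorem pinv_eq_of_isUnit {A : Matrix m n ℂ} (h : IsUnit (Aᴴ * A)) :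
    pinv A = (Aᴴ * A)⁻¹ * Aᴴ := by
  have hd : IsUnit (Aᴴ * A).det := (Matrix.isUnit_iff_isUnit_det _).1 h
  have h1 : (Aᴴ * A)⁻¹ * Aᴴ * A = 1 := by
    rw [Matrix.mul_assoc, Matrix.nonsing_inv_mul _ hd]
  refine (isMoorePenrose_pinv A).unique ⟨?_, ?_, ?_, ?_⟩
  · rw [Matrix.mul_assoc, h1, Matrix.mul_one]
  · rw [h1, Matrix.one_mul]
  · simp only [conjTranspose_mul, conjTranspose_conjTranspose, conjTranspose_nonsing_inv,
      Matrix.mul_assoc]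
  · rw [h1, conjTranspose_one]

theorem pinv_mul_self_of_isUnit {A : Matrix m n ℂ} (h : IsUnit (Aᴴ * A)) : pinv A * A = 1 := by
  rw [pinv_eq_of_isUnit h, Matrix.mul_assoc,
    Matrix.nonsing_inv_mul _ ((Matrix.isUnit_iff_isUnit_det _).1 h)]

/-- The reverse-order law fails for general pseudoinverses. It holds here because `pinv A * A = 1`,
so the candidate satisfies the Penrose equations. -/
theorem pinv_mul_of_isUnit {A : Matrix m n ℂ} {R : Matrix n n ℂ} (h : IsUnit (Aᴴ * A))
    (hR : IsUnit R) : pinv (A * R) = R⁻¹ * pinv A := by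
  have hd : IsUnit R.det := (Matrix.isUnit_iff_isUnit_det _).1 hR
  have hp := isMoorePenrose_pinv A
  have h1 : A * R * (R⁻¹ * pinv A) = A * pinv A := by
    rw [Matrix.mul_assoc, ← Matrix.mul_assoc R, Matrix.mul_nonsing_inv _ hd, Matrix.one_mul]
  have h2 : R⁻¹ * pinv A * (A * R) = 1 := by
    rw [Matrix.mul_assoc, ← Matrix.mul_assoc (pinv A), pinv_mul_self_of_isUnit h, Matrix.one_mul,
      Matrix.nonsing_inv_mul _ hd]
  refine (isMoorePenrose_pinv (A * R)).unique ⟨?_, ?_, ?_, ?_⟩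
  · rw [h1, ← Matrix.mul_assoc, hp.mul_mul_left]
  · rw [h2, Matrix.one_mul]
  · rw [h1, hp.herm_left]
  · rw [h2, conjTranspose_one]

theorem tendsto_matrix_inv {𝕜 α : Type*} [NormedField 𝕜] {l : Filter α} {A : α → Matrix n n 𝕜} {A₀ : Matrix n n 𝕜}
    (h : Tendsto A l (𝓝 A₀)) (h₀ : IsUnit A₀) : Tendsto (fun a => (A a)⁻¹) l (𝓝 A₀⁻¹) := by
  have hd : A₀.det ≠ 0 := ((Matrix.isUnit_iff_isUnit_det _).1 h₀).ne_zero
  simp only [Matrix.inv_def, Ring.inverse_eq_inv']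
  have h1 : Tendsto (fun a => (A a).det) l (𝓝 A₀.det) :=
    ((continuous_id.matrix_det).tendsto A₀).comp h
  have h2 : Tendsto (fun a => (A a).adjugate) l (𝓝 A₀.adjugate) :=
    ((continuous_id.matrix_adjugate).tendsto A₀).comp h
  exact (h1.inv₀ hd).smul h2

theorem eventually_isUnit_of_tendsto {𝕜 α : Type*} [NormedField 𝕜] {l : Filter α} {A : α → Matrix n n 𝕜}
    {A₀ : Matrix n n 𝕜} (h : Tendsto A l (𝓝 A₀)) (h₀ : IsUnit A₀) : ∀ᶠ a in l, IsUnit (A a) := by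
  have hd : A₀.det ≠ 0 := ((Matrix.isUnit_iff_isUnit_det _).1 h₀).ne_zero
  have h1 : Tendsto (fun a => (A a).det) l (𝓝 A₀.det) :=
    ((continuous_id.matrix_det).tendsto A₀).comp h
  filter_upwards [h1.eventually_ne hd] with a ha
  exact (Matrix.isUnit_iff_isUnit_det _).2 (isUnit_iff_ne_zero.2 ha)

theorem tendsto_conjTranspose_mul_self {m n α : Type*} [Fintype m] {l : Filter α} {A : α → Matrix m n ℂ}
    {A₀ : Matrix m n ℂ} (h : Tendsto A l (𝓝 A₀)) :
    Tendsto (fun a => (A a)ᴴ * A a) l (𝓝 (A₀ᴴ * A₀)) := by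
  have hc : Continuous fun B : Matrix m n ℂ => Bᴴ * B :=
    (continuous_id.matrix_conjTranspose).matrix_mul continuous_id
  exact (hc.tendsto A₀).comp h

/-- The pseudoinverse is discontinuous where the rank drops. Full column rank is an open condition,
and there the explicit formula `(Aᴴ A)⁻¹ Aᴴ` is continuous. -/
theorem tendsto_pinv {α : Type*} {l : Filter α} {A : α → Matrix m n ℂ} {A₀ : Matrix m n ℂ}
    (h : Tendsto A l (𝓝 A₀)) (h₀ : IsUnit (A₀ᴴ * A₀)) :
    Tendsto (fun a => pinv (A a)) l (𝓝 (pinv A₀)) := by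
  have h1 := tendsto_conjTranspose_mul_self h
  have h2 := tendsto_matrix_inv h1 h₀
  have h3 : Tendsto (fun a => (A a)ᴴ) l (𝓝 A₀ᴴ) :=
    ((continuous_id.matrix_conjTranspose).tendsto A₀).comp h
  have hc : Continuous fun B : Matrix n n ℂ × Matrix n m ℂ => B.1 * B.2 :=
    continuous_fst.matrix_mul continuous_snd
  have h4 := (hc.tendsto (_, _)).comp (h2.prodMk_nhds h3)
  rw [pinv_eq_of_isUnit h₀]
  refine h4.congr' ?_
  filter_upwards [eventually_isUnit_of_tendsto h1 h₀] with a ha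
  rw [pinv_eq_of_isUnit ha]; rfl

end Pseudoinverse

/-! ### Bounds on trailing singular values -/

section SingularValues

variable {m n : Type*} [Fintype m] [Fintype n]

theorem star_dotProduct_self_eq (v : n → ℂ) :
    star v ⬝ᵥ v = ((∑ i, ‖v i‖ ^ 2 : ℝ) : ℂ) := by
  rw [dotProduct, Complex.ofReal_sum]
  refine Finset.sum_congr rfl fun i _ => ?_
  rw [Pi.star_apply, Complex.star_def, Complex.conj_mul']
  push_cast; rfl

theorem sum_norm_sq_mulVec_of_isometry [DecidableEq n] {A : Matrix m n ℂ} (h : Aᴴ * A = 1)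
    (v : n → ℂ) :
    ∑ i, ‖(A *ᵥ v) i‖ ^ 2 = ∑ i, ‖v i‖ ^ 2 := by
  have : star (A *ᵥ v) ⬝ᵥ (A *ᵥ v) = star v ⬝ᵥ v := by
    rw [star_mulVec, dotProduct_mulVec, vecMul_vecMul, ← dotProduct_mulVec, h, one_mulVec]
  rw [star_dotProduct_self_eq, star_dotProduct_self_eq] at this
  exact_mod_cast this

theorem norm_le_one_of_isometry [DecidableEq n] {A : Matrix m n ℂ} (h : Aᴴ * A = 1) (i : m)
    (j : n) : ‖A i j‖ ≤ 1 := by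
  have h1 := sum_norm_sq_mulVec_of_isometry h (Pi.single j 1)
  have h2 : ∑ i, ‖(Pi.single j (1 : ℂ) : n → ℂ) i‖ ^ 2 = 1 := by
    rw [Finset.sum_eq_single j]
    · simp
    · intro b _ hb; simp [hb]
    · simp
  rw [h2] at h1
  have h3 : ‖A i j‖ ^ 2 ≤ 1 := by
    rw [← h1]
    have := Finset.single_le_sum (f := fun i => ‖(A *ᵥ Pi.single j (1 : ℂ)) i‖ ^ 2)
      (fun i _ => by positivity) (Finset.mem_univ i)
    simpa using this
  exact (sq_le_one_iff₀ (norm_nonneg _)).1 h3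

theorem sum_norm_sq_mulVec_le (A : Matrix m n ℂ) (v : n → ℂ) :
    ∑ i, ‖(A *ᵥ v) i‖ ^ 2 ≤ (∑ i, ∑ j, ‖A i j‖) ^ 2 * ∑ i, ‖v i‖ ^ 2 := by
  set s := Real.sqrt (∑ i, ‖v i‖ ^ 2)
  have hs : s ^ 2 = ∑ i, ‖v i‖ ^ 2 := Real.sq_sqrt (Finset.sum_nonneg fun i _ => by positivity)
  have hv : ∀ j, ‖v j‖ ≤ s := fun j => Real.le_sqrt_of_sq_le
    (Finset.single_le_sum (f := fun i => ‖v i‖ ^ 2) (fun i _ => by positivity) (Finset.mem_univ j))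
  have h1 : ∀ i, ‖(A *ᵥ v) i‖ ≤ (∑ j, ‖A i j‖) * s := fun i => by
    rw [mulVec, dotProduct, Finset.sum_mul]
    refine (norm_sum_le _ _).trans (Finset.sum_le_sum fun j _ => ?_)
    rw [norm_mul]
    exact mul_le_mul_of_nonneg_left (hv j) (norm_nonneg _)
  calc ∑ i, ‖(A *ᵥ v) i‖ ^ 2 ≤ (∑ i, ‖(A *ᵥ v) i‖) ^ 2 :=
        Finset.sum_sq_le_sq_sum_of_nonneg fun i _ => norm_nonneg _
    _ ≤ ((∑ i, ∑ j, ‖A i j‖) * s) ^ 2 := by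
        rw [Finset.sum_mul]
        gcongr with i
        exact h1 i
    _ = _ := by rw [mul_pow, hs]

theorem card_le_of_isometry [DecidableEq n] {A : Matrix m n ℂ} (h : Aᴴ * A = 1) :
    Fintype.card n ≤ Fintype.card m := by
  have h1 : (Aᴴ * A).rank = Fintype.card n := by rw [h, rank_one]
  rw [← h1]
  exact (rank_mul_le_right _ _).trans (rank_le_card_height A)

theorem fromCols_isometry {m p q : Type*} [Fintype m] [DecidableEq p] [DecidableEq q]
    {X : Matrix m p ℂ} {Y : Matrix m q ℂ} (h1 : Xᴴ * X = 1) (h2 : Yᴴ * Y = 1) (h3 : Xᴴ * Y = 0)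
    (j : q) :
    (fromCols X (Y.submatrix id fun _ : Unit => j))ᴴ *
      fromCols X (Y.submatrix id fun _ : Unit => j) = 1 := by
  have h3' : Yᴴ * X = 0 := by
    rw [← conjTranspose_conjTranspose X, ← conjTranspose_mul, h3, conjTranspose_zero]
  rw [conjTranspose_fromCols_eq_fromRows_conjTranspose, fromRows_mul_fromCols, h1]
  have a1 : Xᴴ * Y.submatrix id (fun _ : Unit => j) = 0 := by
    ext a b; exact congrFun (congrFun h3 a) j
  have a2 : (Y.submatrix id (fun _ : Unit => j))ᴴ * X = 0 := by
    ext a b; exact congrFun (congrFun h3' j) b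
  have a3 : (Y.submatrix id (fun _ : Unit => j))ᴴ * Y.submatrix id (fun _ : Unit => j) = 1 := by
    ext a b
    have := congrFun (congrFun h2 j) j
    rw [one_apply_eq] at this ⊢
    exact this
  rw [a1, a2, a3, fromBlocks_one]

/-- The trailing singular values of a perturbation of a matrix of rank at most `L` are bounded by
the perturbation. -/
theorem trailing_singular_value_le {L : ℕ} {H H₀ : Matrix m n ℂ} {A : Matrix m (Fin L) ℂ}
    {B : Matrix (Fin L) n ℂ} (hH₀ : H₀ = A * B) {k : ℕ} {U : Matrix m (Fin L) ℂ}
    {U' : Matrix m (Fin k) ℂ} {V : Matrix n (Fin L) ℂ} {V' : Matrix n (Fin k) ℂ}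
    {σ : Fin L → ℝ} {σ' : Fin k → ℝ}
    (hU : Uᴴ * U = 1) (hU' : U'ᴴ * U' = 1) (hUU' : Uᴴ * U' = 0)
    (hV : Vᴴ * V = 1) (hV' : V'ᴴ * V' = 1) (hVV' : Vᴴ * V' = 0)
    (hσ' : ∀ j, 0 ≤ σ' j) (hσσ' : ∀ i j, σ' j ≤ σ i)
    (hH : H = U * diagonal (fun i => (σ i : ℂ)) * Vᴴ
      + U' * diagonal (fun j => (σ' j : ℂ)) * V'ᴴ) (j : Fin k) :
    σ' j ≤ ∑ i, ∑ i', ‖(H - H₀) i i'‖ := by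
  set ν := ∑ i, ∑ i', ‖(H - H₀) i i'‖ with hν
  have hν0 : 0 ≤ ν := Finset.sum_nonneg fun i _ => Finset.sum_nonneg fun _ _ => norm_nonneg _
  let e : Unit → Fin k := fun _ => j
  let V₁ : Matrix n (Fin L ⊕ Unit) ℂ := fromCols V (V'.submatrix id e)
  let U₁ : Matrix m (Fin L ⊕ Unit) ℂ := fromCols U (U'.submatrix id e)
  let s : Fin L ⊕ Unit → ℝ := Sum.elim σ (fun _ => σ' j)
  have hV₁ : V₁ᴴ * V₁ = 1 := fromCols_isometry hV hV' hVV' j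
  have hU₁ : U₁ᴴ * U₁ = 1 := fromCols_isometry hU hU' hUU' j
  have hVV'' : V'ᴴ * V = 0 := by
    rw [← conjTranspose_conjTranspose V, ← conjTranspose_mul, hVV', conjTranspose_zero]
  have hHV : H * V = U * diagonal (fun i => (σ i : ℂ)) := by
    rw [hH, Matrix.add_mul, Matrix.mul_assoc, hV, Matrix.mul_assoc _ V'ᴴ, hVV'']; simp
  have hHV' : H * V' = U' * diagonal (fun i => (σ' i : ℂ)) := by
    rw [hH, Matrix.add_mul, Matrix.mul_assoc _ V'ᴴ, hV', Matrix.mul_assoc _ Vᴴ, hVV']; simp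
  have hHV₁ : H * V₁ = U₁ * diagonal (fun i => (s i : ℂ)) := by
    ext a b
    rcases b with b | b
    · have := congrFun (congrFun hHV a) b
      rw [mul_diagonal] at this ⊢
      exact this
    · have := congrFun (congrFun hHV' a) j
      rw [mul_diagonal] at this ⊢
      exact this
  -- `B * V₁` maps dimension `L + 1` to dimension `L`, so it has a kernel. On such a vector `H₀`
  -- vanishes while `H` stretches by at least `σ' j`, so `H - H₀` must be at least that large.
  obtain ⟨v, hv0, hv⟩ : ∃ v : Fin L ⊕ Unit → ℂ, v ≠ 0 ∧ (B * V₁) *ᵥ v = 0 := by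
    have := LinearMap.ker_ne_bot_of_finrank_lt (f := (B * V₁).mulVecLin) (by simp)
    obtain ⟨v, hv, hv0⟩ := Submodule.exists_mem_ne_zero_of_ne_bot this
    exact ⟨v, hv0, by simpa using hv⟩
  have hw : (H - H₀) *ᵥ (V₁ *ᵥ v) = U₁ *ᵥ (fun i => (s i : ℂ) * v i) := by
    have h1 : H₀ *ᵥ (V₁ *ᵥ v) = 0 := by
      rw [hH₀, mulVec_mulVec, Matrix.mul_assoc, ← mulVec_mulVec, hv, mulVec_zero]
    rw [sub_mulVec, h1, sub_zero, mulVec_mulVec, hHV₁, ← mulVec_mulVec]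
    congr 1
    ext i
    rw [mulVec_diagonal]
  have h1 := sum_norm_sq_mulVec_le (H - H₀) (V₁ *ᵥ v)
  rw [hw, sum_norm_sq_mulVec_of_isometry hU₁, sum_norm_sq_mulVec_of_isometry hV₁, ← hν] at h1
  have hs : ∀ i, σ' j ≤ s i := by
    rintro (i | i)
    · exact hσσ' i j
    · exact le_rfl
  have h2 : σ' j ^ 2 * ∑ i, ‖v i‖ ^ 2 ≤ ∑ i, ‖(s i : ℂ) * v i‖ ^ 2 := by
    rw [Finset.mul_sum]
    refine Finset.sum_le_sum fun i _ => ?_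
    rw [norm_mul, mul_pow, Complex.norm_real, Real.norm_of_nonneg ((hσ' j).trans (hs i))]
    have := hσ' j
    gcongr
    exact hs i
  have h3 : 0 < ∑ i, ‖v i‖ ^ 2 := by
    obtain ⟨i, hi⟩ := Function.ne_iff.1 hv0
    refine Finset.sum_pos' (fun i _ => by positivity) ⟨i, Finset.mem_univ i, ?_⟩
    have : 0 < ‖v i‖ := norm_pos_iff.2 hi
    positivity
  have h4 : σ' j ^ 2 ≤ ν ^ 2 := le_of_mul_le_mul_right (h2.trans h1) h3
  exact (pow_le_pow_iff_left₀ (hσ' j) hν0 two_ne_zero).1 h4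

/-- Splits off the trailing part `Z` of the decomposition. Its row space is orthogonal to that of
the leading part, and its entries are controlled by the trailing singular values, at most `card m`
in number. -/
theorem IsLeadingLeftSingular.exists_decomposition {L : ℕ} {H H₀ : Matrix m n ℂ}
    {A : Matrix m (Fin L) ℂ} {B : Matrix (Fin L) n ℂ} (hH₀ : H₀ = A * B)
    {U : Matrix m (Fin L) ℂ} (hU : IsLeadingLeftSingular H U) :
    ∃ (R : Matrix (Fin L) n ℂ) (Z : Matrix m n ℂ), H = U * R + Z ∧ Z * Rᴴ = 0 ∧
      ∀ i j, ‖Z i j‖ ≤ Fintype.card m * ∑ i, ∑ i', ‖(H - H₀) i i'‖ := by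
  obtain ⟨k, U', V, V', σ, σ', hU, hU', hUU', hV, hV', hVV', hσ, hσ', hσσ', hH⟩ := hU
  have hb := trailing_singular_value_le hH₀ hU hU' hUU' hV hV' hVV' hσ' hσσ' hH
  set ν := ∑ i, ∑ i', ‖(H - H₀) i i'‖ with hν
  have hν0 : 0 ≤ ν := Finset.sum_nonneg fun i _ => Finset.sum_nonneg fun _ _ => norm_nonneg _
  have hVV'' : V'ᴴ * V = 0 := by
    rw [← conjTranspose_conjTranspose V, ← conjTranspose_mul, hVV', conjTranspose_zero]
  refine ⟨diagonal (fun i => (σ i : ℂ)) * Vᴴ, U' * diagonal (fun j => (σ' j : ℂ)) * V'ᴴ,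
    by rw [hH, Matrix.mul_assoc U], ?_, fun i j => ?_⟩
  · rw [conjTranspose_mul, conjTranspose_conjTranspose, Matrix.mul_assoc, ← Matrix.mul_assoc V'ᴴ,
      hVV'']
    simp
  · rw [mul_apply]
    have h1 : ∀ x ∈ Finset.univ, ‖(U' * diagonal fun j => (σ' j : ℂ)) i x * V'ᴴ x j‖ ≤ ν := by
      intro x _
      rw [mul_diagonal, conjTranspose_apply, norm_mul, norm_mul, norm_star, Complex.norm_real,
        Real.norm_of_nonneg (hσ' x)]
      have a1 := norm_le_one_of_isometry hU' i x
      have a2 := norm_le_one_of_isometry hV' j x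
      calc ‖U' i x‖ * σ' x * ‖V' j x‖ ≤ 1 * ν * 1 := by
            have := hσ' x
            gcongr
            exact hb x
        _ = ν := by ring
    refine (norm_sum_le_of_le _ h1).trans ?_
    rw [Finset.sum_const, Finset.card_univ, nsmul_eq_mul]
    have := card_le_of_isometry hU'
    gcongr

end SingularValues

/-! ### Existence of leading singular vectors -/

section SingularValueExistence

variable {m n : Type*} [Fintype m] [Fintype n]

theorem isometry_submatrix {m p q : Type*} [Fintype m] [DecidableEq p] [DecidableEq q]
    {X : Matrix m p ℂ} (hX : Xᴴ * X = 1) {g : q → p} (hg : Function.Injective g) :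
    (X.submatrix id g)ᴴ * X.submatrix id g = 1 := by
  rw [conjTranspose_submatrix, ← submatrix_mul _ _ g id g Function.bijective_id, hX,
    submatrix_one _ hg]

theorem orthogonal_submatrix {m p q q' : Type*} [Fintype m] [DecidableEq p]
    {X : Matrix m p ℂ} (hX : Xᴴ * X = 1) {g : q → p} {g' : q' → p} (hg : ∀ i j, g i ≠ g' j) :
    (X.submatrix id g)ᴴ * X.submatrix id g' = 0 := by
  rw [conjTranspose_submatrix, ← submatrix_mul _ _ g id g' Function.bijective_id, hX]
  ext i j
  exact one_apply_ne (hg i j)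

open scoped ComplexOrder in
/-- A compact singular value decomposition with positive, decreasing singular values. -/
theorem exists_compact_svd (H : Matrix m n ℂ) :
    ∃ (U : Matrix m (Fin H.rank) ℂ) (V : Matrix n (Fin H.rank) ℂ) (s : Fin H.rank → ℝ),
      Uᴴ * U = 1 ∧ Vᴴ * V = 1 ∧ (∀ i, 0 < s i) ∧ Antitone s ∧
      H = U * diagonal (fun i => (s i : ℂ)) * Vᴴ := by
  classical
  have hA := Matrix.isHermitian_conjTranspose_mul_self H
  have hpos := (Matrix.posSemidef_conjTranspose_mul_self H).eigenvalues_nonneg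
  set d := hA.eigenvalues with hd
  obtain ⟨W, hW, hW', hG⟩ : ∃ W : Matrix n n ℂ, Wᴴ * W = 1 ∧ W * Wᴴ = 1 ∧
      Hᴴ * H = W * diagonal (fun i => (d i : ℂ)) * Wᴴ := by
    refine ⟨hA.eigenvectorUnitary, Unitary.coe_star_mul_self _, Unitary.coe_mul_star_self _, ?_⟩
    have h := hA.spectral_theorem
    rw [Unitary.conjStarAlgAut_apply] at h
    exact h
  have hr : Fintype.card {i // d i ≠ 0} = H.rank := by
    rw [← hA.rank_eq_card_non_zero_eigs, rank_conjTranspose_mul_self]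
  let e : Fin H.rank ≃ {i // d i ≠ 0} := (Fintype.equivFinOfCardEq hr).symm
  -- Sorting `-d` increasingly lists the nonzero eigenvalues of `Hᴴ H` in decreasing order.
  let p : Equiv.Perm (Fin H.rank) := Tuple.sort fun i => -d (e i)
  have hp : Monotone ((fun i => -d (e i)) ∘ p) := Tuple.monotone_sort _
  let g : Fin H.rank → n := fun i => (e (p i)).1
  have hg : Function.Injective g := fun i j h => p.injective (e.injective (Subtype.ext h))
  have hg0 : ∀ i, 0 < d (g i) := fun i => lt_of_le_of_ne (hpos _) (Ne.symm (e (p i)).2)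
  let V : Matrix n (Fin H.rank) ℂ := W.submatrix id g
  let s : Fin H.rank → ℝ := fun i => Real.sqrt (d (g i))
  have hs : ∀ i, 0 < s i := fun i => Real.sqrt_pos.2 (hg0 i)
  have hss : ∀ i, s i * s i = d (g i) := fun i => Real.mul_self_sqrt (hg0 i).le
  have hV : Vᴴ * V = 1 := isometry_submatrix hW hg
  have hHV : Hᴴ * H * V = V * diagonal (fun i => (d (g i) : ℂ)) := by
    have h1 : Hᴴ * H * W = W * diagonal (fun i => (d i : ℂ)) := by
      rw [hG, Matrix.mul_assoc, hW, Matrix.mul_one]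
    ext a b
    have := congrFun (congrFun h1 a) (g b)
    rw [mul_diagonal] at this ⊢
    exact this
  have hVV : V * diagonal (fun i => (d (g i) : ℂ)) * Vᴴ = Hᴴ * H := by
    rw [hG]
    ext a b
    rw [mul_apply, mul_apply]
    simp only [mul_diagonal, conjTranspose_apply]
    refine Finset.sum_of_injOn g hg.injOn (fun _ _ => Finset.mem_coe.2 (Finset.mem_univ _)) ?_
      fun i _ => rfl
    -- Eigenvectors outside the image of `g` have eigenvalue zero and contribute nothing.
    intro i _ hi
    have hdi : d i = 0 := by
      by_contra h
      exact hi ⟨p.symm (e.symm ⟨i, h⟩), by simp, by simp [g]⟩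
    simp [hdi]
  let D : Matrix (Fin H.rank) (Fin H.rank) ℂ := diagonal fun i => (s i : ℂ)
  let D' : Matrix (Fin H.rank) (Fin H.rank) ℂ := diagonal fun i => ((s i)⁻¹ : ℂ)
  have hs0 : ∀ i, (s i : ℂ) ≠ 0 := fun i => Complex.ofReal_ne_zero.2 (hs i).ne'
  have hD'D : D' * D = 1 := by
    rw [diagonal_mul_diagonal, ← diagonal_one]
    congr 1; ext i; exact inv_mul_cancel₀ (hs0 i)
  have hDD : D * D = diagonal fun i => (d (g i) : ℂ) := by
    rw [diagonal_mul_diagonal]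
    congr 1; ext i; rw [← hss]; push_cast; rfl
  have hDD' : D * D' = 1 := by
    rw [diagonal_mul_diagonal, ← diagonal_one]
    congr 1; ext i; exact mul_inv_cancel₀ (hs0 i)
  have hD'h : D'ᴴ = D' := by
    rw [diagonal_conjTranspose]; congr 1; ext i; simp
  refine ⟨H * V * D', V, s, ?_, hV, hs, fun i j hij => ?_, ?_⟩
  · calc (H * V * D')ᴴ * (H * V * D') = D' * Vᴴ * (Hᴴ * H * V) * D' := by
          simp only [conjTranspose_mul, hD'h, Matrix.mul_assoc]
      _ = D' * (Vᴴ * V) * (D * D) * D' := by rw [hHV, hDD]; simp only [Matrix.mul_assoc]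
      _ = (D' * D) * (D * D') := by rw [hV, Matrix.mul_one]; simp only [Matrix.mul_assoc]
      _ = 1 := by rw [hD'D, hDD', Matrix.mul_one]
  · have := hp hij
    simp only [Function.comp_apply, neg_le_neg_iff] at this
    exact Real.sqrt_le_sqrt this
  · have h0 : Hᴴ * H * (1 - V * Vᴴ) = 0 := by
      rw [Matrix.mul_sub, Matrix.mul_one, ← Matrix.mul_assoc, hHV, hVV, sub_self]
    rw [conjTranspose_mul_self_mul_eq_zero, Matrix.mul_sub, Matrix.mul_one, sub_eq_zero] at h0
    calc H = H * (V * Vᴴ) := h0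
      _ = H * V * (D' * D) * Vᴴ := by rw [hD'D, Matrix.mul_one, Matrix.mul_assoc]
      _ = _ := by simp only [Matrix.mul_assoc]; rfl

/-- `IsLeadingLeftSingular` does not ask for a full basis of singular vectors, so a compact
decomposition of size `rank H = L + k` suffices: its first `L` columns lead and the other `k` trail.
-/
theorem exists_isLeadingLeftSingular {L : ℕ} {H : Matrix m n ℂ} (h : L ≤ H.rank) :
    ∃ U : Matrix m (Fin L) ℂ, IsLeadingLeftSingular H U := by
  obtain ⟨U, V, s, hU, hV, hs, hanti, hH⟩ := exists_compact_svd H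
  obtain ⟨k, hk⟩ := Nat.exists_eq_add_of_le h
  generalize H.rank = r at *
  subst hk
  have hne : ∀ i j, Fin.castAdd k i ≠ Fin.natAdd L j := fun i j h => by
    have := congrArg Fin.val h
    simp only [Fin.val_castAdd, Fin.val_natAdd] at this
    omega
  refine ⟨U.submatrix id (Fin.castAdd k), k, U.submatrix id (Fin.natAdd L),
    V.submatrix id (Fin.castAdd k), V.submatrix id (Fin.natAdd L), s ∘ Fin.castAdd k,
    s ∘ Fin.natAdd L, isometry_submatrix hU (Fin.castAdd_injective L k),
    isometry_submatrix hU (Fin.natAdd_injective k L), orthogonal_submatrix hU hne,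
    isometry_submatrix hV (Fin.castAdd_injective L k),
    isometry_submatrix hV (Fin.natAdd_injective k L), orthogonal_submatrix hV hne,
    fun i => (hs _).le, fun i => (hs _).le, fun i j => hanti ?_, ?_⟩
  · rw [Fin.le_def, Fin.val_castAdd, Fin.val_natAdd]
    omega
  · rw [hH]
    ext a b
    rw [Matrix.add_apply, mul_apply, mul_apply, mul_apply, Fin.sum_univ_add]
    simp only [mul_diagonal]
    rfl

end SingularValueExistence

/-! ### Diagonalizability near a diagonal matrix with distinct entries -/

section EigenvalueExistence

variable {ι : Type*} [Fintype ι] [DecidableEq ι]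

/-- The determinant is the product of `z - w` over the eigenvalues `w`. If all of them were at
distance at least `ε`, the product would be at least `ε` to the power of the dimension. -/
theorem exists_root_charpoly_near {M : Matrix ι ι ℂ} {z : ℂ} {ε : ℝ} (hε : 0 < ε)
    (h : ‖(z • (1 : Matrix ι ι ℂ) - M).det‖ < ε ^ Fintype.card ι) :
    ∃ w, M.charpoly.IsRoot w ∧ ‖w - z‖ < ε := by
  by_contra! hcon
  have hs : M.charpoly.Splits := IsAlgClosed.splits _
  have h1 : (z • (1 : Matrix ι ι ℂ) - M).det = (M.charpoly.roots.map fun w => z - w).prod := by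
    rw [smul_one_eq_diagonal, ← scalar_apply, ← eval_charpoly]
    rw [hs.eval_eq_prod_roots_of_monic (charpoly_monic M)]
  have h2 : ∀ s : Multiset ℂ, (∀ w ∈ s, ε ≤ ‖w - z‖) →
      ε ^ Multiset.card s ≤ ‖(s.map fun w => z - w).prod‖ := by
    intro s
    induction s using Multiset.induction_on with
    | empty => simp
    | cons a s ih =>
      intro hs
      rw [Multiset.map_cons, Multiset.prod_cons, norm_mul, Multiset.card_cons, pow_succ']
      have h3 := ih fun w hw => hs w (Multiset.mem_cons_of_mem hw)
      have h4 := hs a (Multiset.mem_cons_self a s)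
      rw [norm_sub_rev] at h4
      gcongr
  have h3 := h2 M.charpoly.roots fun w hw => hcon w (Polynomial.isRoot_of_mem_roots hw)
  rw [← h1, ← hs.natDegree_eq_card_roots, charpoly_natDegree_eq_dim] at h3
  exact absurd h (not_lt.2 h3)

/-- Matrices close to a diagonal matrix with distinct entries are diagonalizable, with eigenvalues
close to these entries. -/
theorem eventually_exists_diagonalization {D : ι → ℂ} (hD : Function.Injective D) {ε : ℝ}
    (hε : 0 < ε) :
    ∀ᶠ M in 𝓝 (diagonal D), ∃ (F : Matrix ι ι ℂ) (d : ι → ℂ), IsUnit F ∧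
      F⁻¹ * M * F = diagonal d ∧ ∀ i, ‖d i - D i‖ < ε := by
  -- Open discs of radius `ε'` about the entries of `D` are disjoint, so an eigenvalue chosen in
  -- each disc yields distinct eigenvalues.
  obtain ⟨ε', hε', hle, hgap⟩ : ∃ ε' > 0, ε' ≤ ε ∧ ∀ i j, i ≠ j → 2 * ε' ≤ ‖D i - D j‖ := by
    have h1 : ∀ p : ι × ι, ∀ᶠ t in 𝓝[>] (0 : ℝ), p.1 ≠ p.2 → 2 * t ≤ ‖D p.1 - D p.2‖ := by
      intro p
      by_cases hp : p.1 = p.2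
      · simp [hp]
      · have : 0 < ‖D p.1 - D p.2‖ / 2 := by
          have := norm_pos_iff.2 (sub_ne_zero.2 (hD.ne hp)); positivity
        filter_upwards [Ioo_mem_nhdsGT this] with t ht _
        linarith [ht.2]
    have h2 := eventually_all.2 h1
    obtain ⟨t, ⟨ht, ht'⟩, ht''⟩ :=
      ((h2.and (Ioc_mem_nhdsGT hε)).and self_mem_nhdsWithin).exists
    exact ⟨t, ht'', ht'.2, fun i j hij => ht (i, j) hij⟩
  have h1 : ∀ i, ∀ᶠ M in 𝓝 (diagonal D),
      ‖(D i • (1 : Matrix ι ι ℂ) - M).det‖ < ε' ^ Fintype.card ι := by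
    intro i
    have hc : Continuous fun M : Matrix ι ι ℂ => ‖(D i • (1 : Matrix ι ι ℂ) - M).det‖ :=
      (continuous_const.sub continuous_id).matrix_det.norm
    have h0 : ‖(D i • (1 : Matrix ι ι ℂ) - diagonal D).det‖ = 0 := by
      rw [smul_one_eq_diagonal, diagonal_sub, det_diagonal, norm_eq_zero]
      exact Finset.prod_eq_zero (Finset.mem_univ i) (sub_self _)
    have := hc.tendsto (diagonal D)
    rw [h0] at this
    exact this.eventually_lt_const (by positivity)
  filter_upwards [eventually_all.2 h1] with M hM
  choose d hd hdD using fun i => exists_root_charpoly_near hε' (hM i)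
  have hinj : Function.Injective d := by
    intro i j hij
    by_contra hne
    have h2 := hgap i j hne
    have h3 : ‖D i - D j‖ ≤ ‖d i - D i‖ + ‖d j - D j‖ := by
      have : D i - D j = -(d i - D i) + (d j - D j) := by rw [hij]; ring
      rw [this]
      exact (norm_add_le _ _).trans (by rw [norm_neg])
    linarith [hdD i, hdD j]
  have hv : ∀ i, ∃ v : ι → ℂ, v ≠ 0 ∧ M *ᵥ v = d i • v := by
    intro i
    have h2 : (d i • (1 : Matrix ι ι ℂ) - M).det = 0 := by
      rw [smul_one_eq_diagonal, ← scalar_apply, ← eval_charpoly]; exact hd i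
    obtain ⟨v, hv0, hv⟩ := exists_mulVec_eq_zero_iff.2 h2
    refine ⟨v, hv0, ?_⟩
    rw [sub_mulVec, smul_mulVec, one_mulVec, sub_eq_zero] at hv
    exact hv.symm
  choose v hv0 hv using hv
  have hli : LinearIndependent ℂ v := by
    refine Module.End.eigenvectors_linearIndependent' (toLin' M) d hinj v fun i => ?_
    rw [Module.End.hasEigenvector_iff, Module.End.mem_eigenspace_iff, toLin'_apply]
    exact ⟨hv i, hv0 i⟩
  let F : Matrix ι ι ℂ := (of v)ᵀ
  have hF : IsUnit F := by
    rw [isUnit_transpose]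
    exact linearIndependent_rows_iff_isUnit.1 hli
  have hMF : M * F = F * diagonal d := by
    ext i j
    rw [mul_diagonal]
    have := congrFun (hv j) i
    rw [Pi.smul_apply, smul_eq_mul, mul_comm] at this
    exact this
  refine ⟨F, d, hF, ?_, fun i => (hdD i).trans_le hle⟩
  rw [Matrix.mul_assoc, hMF, ← Matrix.mul_assoc,
    nonsing_inv_mul _ ((isUnit_iff_isUnit_det _).1 hF), Matrix.one_mul]

end EigenvalueExistence

/-! ### Second-order accuracy of diagonal entries in an eigenbasis -/

section EigenvectorPerturbation

variable {ι : Type*} [Fintype ι] [DecidableEq ι]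

/-- Row `i` of the eigenvalue equation reads `(d - D i) f i = (N f) i`. With `j` the coordinate of
largest modulus, the right side is at most `card ι * ν * ‖f j‖`. -/
theorem exists_dominant_coordinate {D : ι → ℂ} {N : Matrix ι ι ℂ} {ν : ℝ} (hN : ∀ i j, ‖N i j‖ ≤ ν)
    {f : ι → ℂ} (hf0 : f ≠ 0) {d : ℂ} (hf : (diagonal D + N) *ᵥ f = d • f) :
    ∃ j, f j ≠ 0 ∧ ∀ i, ‖d - D i‖ * ‖f i‖ ≤ Fintype.card ι * ν * ‖f j‖ := by
  obtain ⟨i₀, hi₀⟩ := Function.ne_iff.1 hf0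
  have : Nonempty ι := ⟨i₀⟩
  obtain ⟨j, hj⟩ := Finite.exists_max fun i => ‖f i‖
  refine ⟨j, norm_pos_iff.1 ((norm_pos_iff.2 hi₀).trans_le (hj i₀)), fun i => ?_⟩
  have h1 : (d - D i) * f i = (N *ᵥ f) i := by
    have := congrFun hf i
    rw [add_mulVec, Pi.add_apply, mulVec_diagonal, Pi.smul_apply, smul_eq_mul] at this
    rw [sub_mul, ← this, add_sub_cancel_left]
  rw [← norm_mul, h1, mulVec, dotProduct]
  refine (norm_sum_le_of_le (f := fun k => N i k * f k) (n := fun _ => ν * ‖f j‖) _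
    fun k _ => ?_).trans ?_
  · rw [norm_mul]
    exact mul_le_mul (hN i k) (hj k) (norm_nonneg _) ((norm_nonneg _).trans (hN i k))
  · rw [Finset.sum_const, Finset.card_univ, nsmul_eq_mul, mul_assoc]

/-- A right eigenvector `f` and a left eigenvector `e` each have a dominant coordinate whose entry
of `D` is near `d`; the gap `3 g` forces these to coincide. Every other coordinate is smaller by the
factor `q = card ι * ν / g`, so `e i * f i` is quadratic in `q` off `j`. Only products appear, since
`e ⬝ᵥ f = 1` leaves the separate scales of `e` and `f` free. -/
theorem eigenpair_estimate {D : ι → ℂ} {g ν : ℝ} (hg : 0 < g)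
    (hD : ∀ i j, i ≠ j → 3 * g ≤ ‖D i - D j‖) {N : Matrix ι ι ℂ} (hN : ∀ i j, ‖N i j‖ ≤ ν)
    (hν : 0 ≤ ν) (h1 : Fintype.card ι * ν ≤ g)
    (h2 : Fintype.card ι * (Fintype.card ι * ν / g) ^ 2 ≤ 1 / 2)
    {e f : ι → ℂ} {d : ℂ} (hf : (diagonal D + N) *ᵥ f = d • f)
    (he : e ᵥ* (diagonal D + N) = d • e) (hef : e ⬝ᵥ f = 1) :
    ∃ j, ‖d - D j‖ ≤ Fintype.card ι * ν ∧
      (∀ i, i ≠ j → ‖e i * f i‖ ≤ 2 * (Fintype.card ι * ν / g) ^ 2) ∧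
      ∀ i k, ‖e i * f k - if i = j ∧ k = j then 1 else 0‖ ≤
        2 * Fintype.card ι * (Fintype.card ι * ν / g) := by
  have hf0 : f ≠ 0 := by rintro rfl; simp at hef
  have he0 : e ≠ 0 := by rintro rfl; simp at hef
  obtain ⟨j, hj0, hj⟩ := exists_dominant_coordinate hN hf0 hf
  have he' : (diagonal D + Nᵀ) *ᵥ e = d • e := by
    rw [← he, ← mulVec_transpose, transpose_add, diagonal_transpose]
  obtain ⟨j', hj0', hj'⟩ := exists_dominant_coordinate (N := Nᵀ) (fun i k => hN k i) he0 he'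
  have hpos : 0 < ‖f j‖ := norm_pos_iff.2 hj0
  have hpos' : 0 < ‖e j'‖ := norm_pos_iff.2 hj0'
  have hdj : ‖d - D j‖ ≤ Fintype.card ι * ν := le_of_mul_le_mul_right (hj j) hpos
  have hdj' : ‖d - D j'‖ ≤ Fintype.card ι * ν := le_of_mul_le_mul_right (hj' j') hpos'
  have hjj : j' = j := by
    by_contra hne
    have h3 := hD j' j hne
    have h4 : ‖D j' - D j‖ ≤ ‖d - D j'‖ + ‖d - D j‖ := by
      have : D j' - D j = -(d - D j') + (d - D j) := by ring
      rw [this]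
      exact (norm_add_le _ _).trans (by rw [norm_neg])
    linarith
  subst hjj
  set n := (Fintype.card ι : ℝ) with hn
  set q : ℝ := n * ν / g with hq
  have hn1 : 1 ≤ n := by
    have : Nonempty ι := ⟨j'⟩
    rw [hn]; exact_mod_cast Fintype.card_pos
  have hq0 : 0 ≤ q := by positivity
  have hq1 : q ≤ 1 := by rw [hq, div_le_one hg]; exact h1
  have hgap : ∀ i, i ≠ j' → g ≤ ‖d - D i‖ := by
    intro i hi
    have h3 := hD i j' hi
    have h4 : ‖D i - D j'‖ ≤ ‖d - D i‖ + ‖d - D j'‖ := by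
      have : D i - D j' = -(d - D i) + (d - D j') := by ring
      rw [this]
      exact (norm_add_le _ _).trans (by rw [norm_neg])
    linarith
  have hfi : ∀ i, i ≠ j' → ‖f i‖ ≤ q * ‖f j'‖ := by
    intro i hi
    rw [hq, div_mul_eq_mul_div, le_div_iff₀ hg, mul_comm]
    exact (mul_le_mul_of_nonneg_right (hgap i hi) (norm_nonneg _)).trans (hj i)
  have hei : ∀ i, i ≠ j' → ‖e i‖ ≤ q * ‖e j'‖ := by
    intro i hi
    rw [hq, div_mul_eq_mul_div, le_div_iff₀ hg, mul_comm]
    exact (mul_le_mul_of_nonneg_right (hgap i hi) (norm_nonneg _)).trans (hj' i)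
  set p := ‖e j'‖ * ‖f j'‖ with hp
  have hp0 : 0 ≤ p := by positivity
  have hdiag : ∀ i, i ≠ j' → ‖e i * f i‖ ≤ q ^ 2 * p := by
    intro i hi
    rw [norm_mul]
    calc ‖e i‖ * ‖f i‖ ≤ (q * ‖e j'‖) * (q * ‖f j'‖) := by
          gcongr
          · exact hei i hi
          · exact hfi i hi
      _ = q ^ 2 * p := by rw [hp]; ring
  have hsum : ‖e j' * f j' - 1‖ ≤ n * (q ^ 2 * p) := by
    have h3 : e j' * f j' - 1 = -∑ i ∈ Finset.univ.erase j', e i * f i := by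
      rw [← hef, dotProduct, ← Finset.add_sum_erase _ _ (Finset.mem_univ j')]; ring
    rw [h3, norm_neg]
    refine (norm_sum_le_of_le _ fun i hi => hdiag i (Finset.ne_of_mem_erase hi)).trans ?_
    rw [Finset.sum_const, nsmul_eq_mul]
    have : ((Finset.univ.erase j').card : ℝ) ≤ n := by
      rw [hn, ← Finset.card_univ]
      exact_mod_cast Finset.card_le_card (Finset.erase_subset _ _)
    gcongr
  -- The smallness `h2` gives `p ≤ 1 + p / 2`, so the normalization bounds `p`.
  have hp2 : p ≤ 2 := by
    have h3 : p ≤ 1 + ‖e j' * f j' - 1‖ := by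
      rw [hp, ← norm_mul]
      calc ‖e j' * f j'‖ = ‖1 + (e j' * f j' - 1)‖ := by congr 1; ring
        _ ≤ _ := (norm_add_le _ _).trans (by rw [norm_one])
    have h4 : n * (q ^ 2 * p) ≤ 1 / 2 * p := by
      rw [← mul_assoc]; exact mul_le_mul_of_nonneg_right h2 hp0
    linarith
  refine ⟨j', hdj, fun i hi => (hdiag i hi).trans ?_, fun i k => ?_⟩
  · nlinarith [sq_nonneg q]
  · have hmain : ∀ t : ℝ, t ≤ 1 → 0 ≤ t → q * t * p ≤ 2 * n * q := by
      intro t ht ht0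
      calc q * t * p ≤ q * 1 * 2 := by gcongr
        _ ≤ 2 * n * q := by nlinarith
    by_cases hi : i = j' <;> by_cases hk : k = j'
    · subst hi; subst hk
      simp only [and_self, if_true]
      refine hsum.trans ?_
      calc n * (q ^ 2 * p) ≤ n * (q ^ 2 * 2) := by gcongr
        _ = 2 * n * q * q := by ring
        _ ≤ 2 * n * q * 1 := by gcongr
        _ = 2 * n * q := mul_one _
    · simp only [hk, and_false, if_false, sub_zero]
      subst hi
      rw [norm_mul]
      refine le_trans ?_ (hmain 1 le_rfl zero_le_one)
      calc ‖e i‖ * ‖f k‖ ≤ ‖e i‖ * (q * ‖f i‖) := by gcongr; exact hfi k hk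
        _ = _ := by rw [hp]; ring
    · simp only [hi, false_and, if_false, sub_zero]
      subst hk
      rw [norm_mul]
      refine le_trans ?_ (hmain 1 le_rfl zero_le_one)
      calc ‖e i‖ * ‖f k‖ ≤ (q * ‖e k‖) * ‖f k‖ := by gcongr; exact hei i hi
        _ = _ := by rw [hp]; ring
    · simp only [hi, false_and, if_false, sub_zero]
      rw [norm_mul]
      refine le_trans ?_ (hmain q hq1 hq0)
      calc ‖e i‖ * ‖f k‖ ≤ (q * ‖e j'‖) * (q * ‖f j'‖) := by
            gcongr
            · exact hei i hi
            · exact hfi k hk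
        _ = _ := by rw [hp]; ring

/-- Writing `D j` as `D j * (e ⬝ᵥ f)` leaves `∑ e i * f i * (D i - D j)`, in which the term `i = j`
cancels and the others are quadratic. The first-order errors of `e i * f k` only meet entries of
`Λ`, which are themselves small. -/
theorem bilinear_estimate {D : ι → ℂ} {Λ : Matrix ι ι ℂ} {ν q : ℝ} {e f : ι → ℂ} {j : ι}
    (hD : ∀ i, ‖D i‖ ≤ 1) (hΛ : ∀ i j, ‖Λ i j‖ ≤ ν) (hef : e ⬝ᵥ f = 1)
    (h1 : ∀ i, i ≠ j → ‖e i * f i‖ ≤ 2 * q ^ 2)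
    (h2 : ∀ i k, ‖e i * f k - if i = j ∧ k = j then 1 else 0‖ ≤ 2 * Fintype.card ι * q) :
    ‖e ⬝ᵥ (diagonal D + Λ) *ᵥ f - (D j + Λ j j)‖ ≤
      Fintype.card ι * (4 * q ^ 2) + Fintype.card ι * (Fintype.card ι * (2 * Fintype.card ι * q * ν)) := by
  have h3 : e ⬝ᵥ (diagonal D + Λ) *ᵥ f - (D j + Λ j j) = ∑ i, e i * f i * (D i - D j) +
      ∑ i, ∑ k, (e i * f k - if i = j ∧ k = j then 1 else 0) * Λ i k := by
    have a1 : ∑ i, e i * f i * (D i - D j) = ∑ i, e i * (D i * f i) - D j := by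
      have : D j = ∑ i, e i * f i * D j := by
        rw [← Finset.sum_mul]
        change D j = (e ⬝ᵥ f) * D j
        rw [hef, one_mul]
      conv_rhs => rw [this]
      rw [← Finset.sum_sub_distrib]
      exact Finset.sum_congr rfl fun i _ => by ring
    have a2 : ∑ i, ∑ k, (e i * f k - if i = j ∧ k = j then 1 else 0) * Λ i k
        = e ⬝ᵥ Λ *ᵥ f - Λ j j := by
      have : Λ j j = ∑ i, ∑ k, (if i = j ∧ k = j then (1 : ℂ) else 0) * Λ i k := by
        simp [ite_and]
      conv_rhs => rw [this]
      simp only [dotProduct, mulVec, sub_mul, Finset.sum_sub_distrib, Finset.mul_sum]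
      congr 1
      exact Finset.sum_congr rfl fun i _ => Finset.sum_congr rfl fun k _ => by ring
    rw [a1, a2, add_mulVec, dotProduct_add]
    have a3 : e ⬝ᵥ diagonal D *ᵥ f = ∑ i, e i * (D i * f i) := by
      simp only [dotProduct, mulVec_diagonal]
    rw [a3]; ring
  rw [h3]
  refine (norm_add_le _ _).trans (add_le_add ?_ ?_)
  · refine (norm_sum_le_of_le (n := fun _ => 4 * q ^ 2) _ fun i _ => ?_).trans ?_
    · by_cases hi : i = j
      · subst hi; simp only [sub_self, mul_zero, norm_zero]; positivity
      · rw [norm_mul]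
        have b1 : ‖D i - D j‖ ≤ 2 := by
          refine (norm_sub_le _ _).trans ?_; linarith [hD i, hD j]
        calc ‖e i * f i‖ * ‖D i - D j‖ ≤ 2 * q ^ 2 * 2 := by
              gcongr
              exact h1 i hi
          _ = 4 * q ^ 2 := by ring
    · rw [Finset.sum_const, Finset.card_univ, nsmul_eq_mul]
  · refine (norm_sum_le_of_le
      (n := fun _ => Fintype.card ι * (2 * Fintype.card ι * q * ν)) _ fun i _ => ?_).trans ?_
    · refine (norm_sum_le_of_le (n := fun _ => 2 * Fintype.card ι * q * ν) _ fun k _ => ?_).trans ?_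
      · rw [norm_mul]
        exact mul_le_mul (h2 i k) (hΛ i k) (norm_nonneg _) ((norm_nonneg _).trans (h2 i k))
      · rw [Finset.sum_const, Finset.card_univ, nsmul_eq_mul]
    · rw [Finset.sum_const, Finset.card_univ, nsmul_eq_mul]

/-- First-order perturbation of the diagonal of matrices `D + Λ` in an eigenbasis of a matrix
close to a diagonal matrix with distinct entries. -/
theorem exists_diagonalization_estimate {D₀ : ι → ℂ} (hD₀ : Function.Injective D₀) :
    ∃ C r : ℝ, 0 < r ∧ ∀ (ν : ℝ) (N F : Matrix ι ι ℂ) (d : ι → ℂ), 0 ≤ ν → ν ≤ r →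
      (∀ i j, ‖N i j‖ ≤ ν) → IsUnit F → F⁻¹ * (diagonal D₀ + N) * F = diagonal d →
      ∀ l, ∃ j, ‖d l - D₀ j‖ ≤ C * ν ∧
        ∀ (D : ι → ℂ) (Λ : Matrix ι ι ℂ), (∀ i, ‖D i‖ ≤ 1) → (∀ i j, ‖Λ i j‖ ≤ ν) →
          ‖(F⁻¹ * (diagonal D + Λ) * F) l l - (D j + Λ j j)‖ ≤ C * ν ^ 2 := by
  rcases isEmpty_or_nonempty ι with hι | hι
  · exact ⟨0, 1, one_pos, fun _ _ _ _ _ _ _ _ _ l => isEmptyElim l⟩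
  obtain ⟨g, hg, hgap⟩ : ∃ g > 0, ∀ i j, i ≠ j → 3 * g ≤ ‖D₀ i - D₀ j‖ := by
    have h1 : ∀ p : ι × ι, ∀ᶠ t in 𝓝[>] (0 : ℝ), p.1 ≠ p.2 → 3 * t ≤ ‖D₀ p.1 - D₀ p.2‖ := by
      intro p
      by_cases hp : p.1 = p.2
      · simp [hp]
      · have : 0 < ‖D₀ p.1 - D₀ p.2‖ / 3 := by
          have := norm_pos_iff.2 (sub_ne_zero.2 (hD₀.ne hp)); positivity
        filter_upwards [Ioo_mem_nhdsGT this] with t ht _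
        linarith [ht.2]
    obtain ⟨t, ht, ht'⟩ := ((eventually_all.2 h1).and self_mem_nhdsWithin).exists
    exact ⟨t, ht', fun i j hij => ht (i, j) hij⟩
  set n := (Fintype.card ι : ℝ) with hn
  have hn1 : 1 ≤ n := by
    rw [hn]; exact_mod_cast Fintype.card_pos
  set C₁ := n * (4 * (n / g) ^ 2) + n * (n * (2 * n * (n / g))) with hC₁
  have hC₁0 : 0 ≤ C₁ := by positivity
  -- The radius makes `n * ν / g ≤ 1 / (2 * n)`, which implies both smallness conditions of
  -- `eigenpair_estimate`. The summand `n` of the constant serves the eigenvalue and `C₁` the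
  -- diagonal entries.
  refine ⟨n + C₁, g / (2 * n ^ 2), by positivity, fun ν N F d hν hνr hN hF hFd l => ?_⟩
  have hnν : n * ν ≤ g / (2 * n) := by
    calc n * ν ≤ n * (g / (2 * n ^ 2)) := by gcongr
      _ = g / (2 * n) := by field_simp
  have h1 : n * ν ≤ g := hnν.trans (div_le_self hg.le (by linarith))
  have h2 : n * (n * ν / g) ^ 2 ≤ 1 / 2 := by
    have : n * ν / g ≤ 1 / (2 * n) := by
      rw [div_le_iff₀ hg]; refine hnν.trans (le_of_eq (by ring))
    calc n * (n * ν / g) ^ 2 ≤ n * (1 / (2 * n)) ^ 2 := by gcongr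
      _ = 1 / (4 * n) := by field_simp; norm_num
      _ ≤ 1 / 2 := by
        apply one_div_le_one_div_of_le <;> linarith
  have hdet : IsUnit F.det := (isUnit_iff_isUnit_det _).1 hF
  have hMF : (diagonal D₀ + N) * F = F * diagonal d := by
    rw [← hFd, ← Matrix.mul_assoc, ← Matrix.mul_assoc, mul_nonsing_inv _ hdet, Matrix.one_mul]
  have hFM : F⁻¹ * (diagonal D₀ + N) = diagonal d * F⁻¹ := by
    rw [← hFd, Matrix.mul_assoc _ F, mul_nonsing_inv _ hdet, Matrix.mul_one]
  have hf : (diagonal D₀ + N) *ᵥ (fun i => F i l) = d l • fun i => F i l := by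
    ext i
    have := congrFun (congrFun hMF i) l
    rw [mul_diagonal, mul_comm] at this
    exact this
  have he : (fun i => F⁻¹ l i) ᵥ* (diagonal D₀ + N) = d l • fun i => F⁻¹ l i := by
    ext i
    have := congrFun (congrFun hFM l) i
    rw [diagonal_mul] at this
    exact this
  have hef : (fun i => F⁻¹ l i) ⬝ᵥ (fun i => F i l) = 1 := by
    have := congrFun (congrFun (nonsing_inv_mul F hdet) l) l
    rw [one_apply_eq] at this
    exact this
  obtain ⟨j, hj, hj1, hj2⟩ := eigenpair_estimate hg hgap hN hν h1 h2 hf he hef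
  refine ⟨j, hj.trans (by rw [← hn]; nlinarith), fun D Λ hD hΛ => ?_⟩
  have h3 : (F⁻¹ * (diagonal D + Λ) * F) l l =
      (fun i => F⁻¹ l i) ⬝ᵥ (diagonal D + Λ) *ᵥ (fun i => F i l) := by
    rw [Matrix.mul_assoc]; rfl
  rw [h3]
  refine (bilinear_estimate hD hΛ hef hj1 hj2).trans ?_
  rw [← hn]
  calc n * (4 * (n * ν / g) ^ 2) + n * (n * (2 * n * (n * ν / g) * ν)) = C₁ * ν ^ 2 := by
        rw [hC₁]; ring
    _ ≤ (n + C₁) * ν ^ 2 := by nlinarith [sq_nonneg ν]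

end EigenvectorPerturbation

/-! ### Entrywise asymptotics of matrix products -/

section EntrywiseAsymptotics

open Asymptotics

variable {α : Type*} {l : Filter α} {m n p : Type*} [Fintype n]

theorem isBigO_mul_entries {A : α → Matrix m n ℂ} {B : α → Matrix n p ℂ} {f g : α → ℝ}
    (hA : ∀ i j, (fun a => A a i j) =O[l] f) (hB : ∀ i j, (fun a => B a i j) =O[l] g) (i : m)
    (j : p) : (fun a => (A a * B a) i j) =O[l] fun a => f a * g a := by
  simp only [mul_apply]
  exact IsBigO.fun_sum fun k _ => (hA i k).mul (hB k j)

theorem isLittleO_mul_entries_right {A : α → Matrix m n ℂ} {B : α → Matrix n p ℂ} {f g : α → ℝ}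
    (hA : ∀ i j, (fun a => A a i j) =O[l] f) (hB : ∀ i j, (fun a => B a i j) =o[l] g) (i : m)
    (j : p) : (fun a => (A a * B a) i j) =o[l] fun a => f a * g a := by
  simp only [mul_apply]
  exact IsLittleO.fun_sum fun k _ => (hA i k).mul_isLittleO (hB k j)

theorem isLittleO_mul_entries_left {A : α → Matrix m n ℂ} {B : α → Matrix n p ℂ} {f g : α → ℝ}
    (hA : ∀ i j, (fun a => A a i j) =o[l] f) (hB : ∀ i j, (fun a => B a i j) =O[l] g) (i : m)
    (j : p) : (fun a => (A a * B a) i j) =o[l] fun a => f a * g a := by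
  simp only [mul_apply]
  exact IsLittleO.fun_sum fun k _ => (hA i k).mul_isBigO (hB k j)

theorem isBigO_one_const_entries {m n : Type*} (A : Matrix m n ℂ) (i : m) (j : n) :
    (fun _ : α => A i j) =O[l] fun _ => (1 : ℝ) :=
  isBigO_const_const _ one_ne_zero _

theorem tendsto_matrix_of_entries {m n : Type*} {A : α → Matrix m n ℂ} {A₀ : Matrix m n ℂ}
    (h : ∀ i j, Tendsto (fun a => A a i j) l (𝓝 (A₀ i j))) : Tendsto A l (𝓝 A₀) :=
  tendsto_pi_nhds.2 fun i => tendsto_pi_nhds.2 fun j => h i j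

theorem tendsto_entries_of_matrix {m n : Type*} {A : α → Matrix m n ℂ} {A₀ : Matrix m n ℂ}
    (h : Tendsto A l (𝓝 A₀)) (i : m) (j : n) : Tendsto (fun a => A a i j) l (𝓝 (A₀ i j)) :=
  tendsto_pi_nhds.1 (tendsto_pi_nhds.1 h i) j

theorem tendsto_const_mul_matrix (C : Matrix m n ℂ) {A : α → Matrix n p ℂ} {A₀ : Matrix n p ℂ}
    (h : Tendsto A l (𝓝 A₀)) : Tendsto (fun a => C * A a) l (𝓝 (C * A₀)) :=
  ((continuous_const.matrix_mul continuous_id).tendsto A₀).comp h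

end EntrywiseAsymptotics

/-! ### First-order perturbation of the signal subspace and the shift equations -/

section SubspacePerturbation

open Asymptotics

variable {α : Type*} {𝓛 : Filter α} {m n : Type*} [Fintype m] [Fintype n] {L : ℕ}

/-- Shows that the columns of `pinv A` lie in the range of `Aᴴ`. This is what puts the right inverse
`X` of `leading_subspace_expansion` in the range of `(P * B)ᴴ`. -/
theorem pinv_eq_conjTranspose_mul (A : Matrix m n ℂ) : pinv A = Aᴴ * ((pinv A)ᴴ * pinv A) := by
  have h := isMoorePenrose_pinv A
  rw [← Matrix.mul_assoc, ← conjTranspose_mul, h.herm_right, h.mul_mul_right]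

theorem mul_pinv_of_isUnit [DecidableEq m] {A : Matrix m n ℂ} (h : IsUnit (A * Aᴴ)) :
    A * pinv A = 1 := by
  have hd := (isUnit_iff_isUnit_det _).1 h
  have h1 : A * pinv A * (A * Aᴴ) = A * Aᴴ := by
    rw [← Matrix.mul_assoc, (isMoorePenrose_pinv A).mul_mul_left]
  calc A * pinv A = A * pinv A * ((A * Aᴴ) * (A * Aᴴ)⁻¹) := by
        rw [mul_nonsing_inv _ hd, Matrix.mul_one]
    _ = 1 := by rw [← Matrix.mul_assoc, h1, mul_nonsing_inv _ hd]

/-- First-order expansion of the span of the leading left singular vectors: up to a change of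
basis `R`, it is spanned by the columns of a matrix `W = P + (H - P B) X + o(g)`. -/
theorem leading_subspace_expansion {P : Matrix m (Fin L) ℂ} {B : Matrix (Fin L) n ℂ}
    {X : Matrix n (Fin L) ℂ} {Y : Matrix m (Fin L) ℂ} (hP : IsUnit (Pᴴ * P))
    (hX : P * B * X = P) (hY : X = (P * B)ᴴ * Y) {H : α → Matrix m n ℂ} {g : α → ℝ}
    (hg : Tendsto g 𝓛 (𝓝 0)) (hH : ∀ i j, (fun a => (H a - P * B) i j) =O[𝓛] g)
    {U : α → Matrix m (Fin L) ℂ} (hU : ∀ a, IsLeadingLeftSingular (H a) (U a)) :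
    ∃ (R : α → Matrix (Fin L) (Fin L) ℂ) (W : α → Matrix m (Fin L) ℂ),
      (∀ᶠ a in 𝓛, IsUnit (R a) ∧ U a = W a * (R a)⁻¹) ∧
      (∀ i j, (fun a => (W a - P - (H a - P * B) * X) i j) =o[𝓛] g) ∧
      Tendsto W 𝓛 (𝓝 P) := by
  choose R₀ Z hUR hZR hZ using fun a => (hU a).exists_decomposition (H₀ := P * B) rfl
  have hZO : ∀ i j, (fun a => Z a i j) =O[𝓛] g := by
    intro i j
    have h1 : (fun a => Z a i j) =O[𝓛] fun a =>
        (Fintype.card m : ℝ) * ∑ i, ∑ i', ‖(H a - P * B) i i'‖ :=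
      IsBigO.of_norm_le fun a => hZ a i j
    refine h1.trans (IsBigO.const_mul_left ?_ _)
    exact IsBigO.fun_sum fun i _ => IsBigO.fun_sum fun i' _ => (hH i i').norm_left
  have hgg : (fun a => g a * g a) =o[𝓛] g := by
    simpa using ((isLittleO_one_iff ℝ).2 hg).mul_isBigO (isBigO_refl g 𝓛)
  -- The key cancellation: `Z Hᴴ = Z Zᴴ` because `Z R₀ᴴ = 0`. Replacing `(P B)ᴴ` by `Hᴴ - (H - P
  -- B)ᴴ` in `X = (P B)ᴴ Y` makes `Z X` a sum of products of two small factors.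
  have hZX : ∀ a, Z a * X = Z a * (Z a)ᴴ * Y - Z a * (H a - P * B)ᴴ * Y := by
    intro a
    have h1 : Z a * (H a)ᴴ = Z a * (Z a)ᴴ := by
      rw [hUR a, conjTranspose_add, conjTranspose_mul, Matrix.mul_add, ← Matrix.mul_assoc, hZR a,
        Matrix.zero_mul, zero_add]
    rw [conjTranspose_sub, Matrix.mul_sub, h1, Matrix.sub_mul, hY, sub_sub_cancel,
      Matrix.mul_assoc]
  have hconj : ∀ {p q : Type _} {A : α → Matrix p q ℂ}, (∀ i j, (fun a => A a i j) =O[𝓛] g) →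
      ∀ i j, (fun a => (A a)ᴴ i j) =O[𝓛] g := by
    intro p q A hA i j
    simp only [conjTranspose_apply]
    exact IsBigO.of_norm_left (by simpa using hA j i)
  have hZXo : ∀ i j, (fun a => (Z a * X) i j) =o[𝓛] g := by
    intro i j
    simp only [hZX, Matrix.sub_apply]
    have h1 := isBigO_mul_entries (isBigO_mul_entries hZO (hconj hZO))
      (isBigO_one_const_entries (l := 𝓛) Y) i j
    have h2 := isBigO_mul_entries (isBigO_mul_entries hZO (hconj hH))
      (isBigO_one_const_entries (l := 𝓛) Y) i j
    simp only [mul_one] at h1 h2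
    exact (h1.trans_isLittleO hgg).sub (h2.trans_isLittleO hgg)
  set W : α → Matrix m (Fin L) ℂ := fun a => U a * (R₀ a * X) with hW
  have hWZ : ∀ a, W a - P - (H a - P * B) * X = -(Z a * X) := by
    intro a
    have h1 : H a * X = W a + Z a * X := by
      conv_lhs => rw [hUR a]
      rw [Matrix.add_mul, Matrix.mul_assoc]
    rw [Matrix.sub_mul, hX, h1]
    abel
  have hWo : ∀ i j, (fun a => (W a - P - (H a - P * B) * X) i j) =o[𝓛] g := by
    intro i j
    simp only [hWZ, Matrix.neg_apply]
    exact (hZXo i j).neg_left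
  have hWP : Tendsto W 𝓛 (𝓝 P) := by
    refine tendsto_matrix_of_entries fun i j => ?_
    have h1 := isBigO_mul_entries hH (isBigO_one_const_entries (l := 𝓛) X) i j
    simp only [mul_one] at h1
    have h2 := ((hWo i j).isBigO.add h1).trans_tendsto hg
    have h3 : (fun a => W a i j) = fun a =>
        (W a - P - (H a - P * B) * X) i j + ((H a - P * B) * X) i j + P i j := by
      ext a; simp only [Matrix.sub_apply]; ring
    rw [h3]
    simpa using h2.add_const (P i j)
  refine ⟨fun a => R₀ a * X, W, ?_, hWo, hWP⟩
  -- `pinv P * W` tends to the identity and equals `(pinv P * U) * (R₀ * X)`; hence the square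
  -- factor `R₀ * X` is eventually invertible.
  have h1 : Tendsto (fun a => pinv P * W a) 𝓛 (𝓝 1) := by
    have := tendsto_const_mul_matrix (pinv P) hWP
    rwa [pinv_mul_self_of_isUnit hP] at this
  filter_upwards [eventually_isUnit_of_tendsto h1 isUnit_one] with a ha
  have hR : IsUnit (R₀ a * X) := by
    rw [hW, ← Matrix.mul_assoc, isUnit_iff_isUnit_det, det_mul] at ha
    exact (isUnit_iff_isUnit_det _).2 (isUnit_of_mul_isUnit_right ha)
  refine ⟨hR, ?_⟩
  rw [hW, Matrix.mul_assoc, mul_nonsing_inv _ ((isUnit_iff_isUnit_det _).1 hR), Matrix.mul_one]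

/-- Since `pinv (A₁ W) * (A₁ W) = 1`, the diagonal part can be added and subtracted, and the basis
change acts by conjugation. The remaining term measures how far `W` is from satisfying the exact
shift relation. -/
theorem pinv_mul_eq_conj {r : Type*} [Fintype r] {A₁ A₂ : Matrix r m ℂ} {φ : Fin L → ℂ}
    {W : Matrix m (Fin L) ℂ} {R : Matrix (Fin L) (Fin L) ℂ} (hR : IsUnit R)
    (hW : IsUnit ((A₁ * W)ᴴ * (A₁ * W))) :
    pinv (A₁ * (W * R⁻¹)) * (A₂ * (W * R⁻¹)) =
      R * (diagonal φ + pinv (A₁ * W) * (A₂ * W - A₁ * W * diagonal φ)) * R⁻¹ := by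
  have hR' : IsUnit R⁻¹ := (isUnit_nonsing_inv_iff).2 hR
  rw [← Matrix.mul_assoc A₁, pinv_mul_of_isUnit hW hR',
    nonsing_inv_nonsing_inv _ ((isUnit_iff_isUnit_det _).1 hR), Matrix.mul_sub,
    ← Matrix.mul_assoc (pinv _) (A₁ * W), pinv_mul_self_of_isUnit hW, Matrix.one_mul,
    add_sub_cancel]
  simp only [Matrix.mul_assoc]

/-- First-order expansion of the solution of the shift invariance equation. -/
theorem shift_matrix_expansion {r : Type*} [Fintype r] {A₁ A₂ : Matrix r m ℂ} {φ : Fin L → ℂ}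
    {P : Matrix m (Fin L) ℂ} (hA : A₂ * P = A₁ * P * diagonal φ)
    (hP : IsUnit ((A₁ * P)ᴴ * (A₁ * P))) {W Δ : α → Matrix m (Fin L) ℂ} {g : α → ℝ}
    (hΔ : ∀ i j, (fun a => Δ a i j) =O[𝓛] g)
    (hWo : ∀ i j, (fun a => (W a - P - Δ a) i j) =o[𝓛] g) (hWP : Tendsto W 𝓛 (𝓝 P)) :
    (∀ᶠ a in 𝓛, IsUnit ((A₁ * W a)ᴴ * (A₁ * W a))) ∧
    (∀ i j, (fun a => (pinv (A₁ * W a) * (A₂ * W a - A₁ * W a * diagonal φ)) i j) =O[𝓛] g) ∧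
    ∀ i j, (fun a => (pinv (A₁ * W a) * (A₂ * W a - A₁ * W a * diagonal φ)
      - pinv (A₁ * P) * (A₂ * Δ a - A₁ * Δ a * diagonal φ)) i j) =o[𝓛] g := by
  have hAW := tendsto_const_mul_matrix A₁ hWP
  have hpinv := tendsto_pinv hAW hP
  set E : α → Matrix m (Fin L) ℂ := fun a => W a - P - Δ a with hE
  set T : α → Matrix r (Fin L) ℂ := fun a => A₂ * Δ a - A₁ * Δ a * diagonal φ with hT
  set T' : α → Matrix r (Fin L) ℂ := fun a => A₂ * E a - A₁ * E a * diagonal φ with hT'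
  have hTT : ∀ a, A₂ * W a - A₁ * W a * diagonal φ = T a + T' a := by
    intro a
    have h1 : W a = P + Δ a + E a := by rw [hE]; simp only; abel
    rw [h1, hT, hT']
    simp only [Matrix.mul_add, Matrix.add_mul, hA]
    abel
  have hTO : ∀ i j, (fun a => T a i j) =O[𝓛] g := by
    intro i j
    have h1 := isBigO_mul_entries (isBigO_one_const_entries (l := 𝓛) A₂) hΔ i j
    have h2 := isBigO_mul_entries (isBigO_mul_entries (isBigO_one_const_entries (l := 𝓛) A₁) hΔ)
      (isBigO_one_const_entries (l := 𝓛) (diagonal φ)) i j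
    simp only [one_mul, mul_one] at h1 h2
    exact h1.sub h2
  have hTo : ∀ i j, (fun a => T' a i j) =o[𝓛] g := by
    intro i j
    have h1 := isLittleO_mul_entries_right (isBigO_one_const_entries (l := 𝓛) A₂) hWo i j
    have h2 := isLittleO_mul_entries_left
      (isLittleO_mul_entries_right (isBigO_one_const_entries (l := 𝓛) A₁) hWo)
      (isBigO_one_const_entries (l := 𝓛) (diagonal φ)) i j
    simp only [one_mul, mul_one] at h1 h2
    exact h1.sub h2
  have hp1 : ∀ i j, (fun a => pinv (A₁ * W a) i j) =O[𝓛] fun _ => (1 : ℝ) := fun i j =>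
    (tendsto_entries_of_matrix hpinv i j).isBigO_one ℝ
  have hp0 : ∀ i j, (fun a => (pinv (A₁ * W a) - pinv (A₁ * P)) i j) =o[𝓛] fun _ => (1 : ℝ) := by
    intro i j
    rw [isLittleO_one_iff]
    simpa using (tendsto_entries_of_matrix hpinv i j).sub_const (pinv (A₁ * P) i j)
  refine ⟨eventually_isUnit_of_tendsto (tendsto_conjTranspose_mul_self hAW) hP, fun i j => ?_,
    fun i j => ?_⟩
  · have := isBigO_mul_entries hp1 (B := fun a => T a + T' a) (g := g)
      (fun i j => (hTO i j).add (hTo i j).isBigO) i j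
    simpa only [hTT, one_mul] using this
  · have h1 := isLittleO_mul_entries_left hp0 hTO i j
    have h2 := isLittleO_mul_entries_right hp1 hTo i j
    simp only [one_mul] at h1 h2
    refine (h1.add h2).congr_left fun a => ?_
    rw [hTT, Matrix.mul_add, Matrix.sub_mul]
    simp only [Matrix.sub_apply, Matrix.add_apply]
    ring

end SubspacePerturbation

namespace Beamspace

open Asymptotics

variable {L : ℕ}

/-! ### Shift invariance of the noiseless factor `P` -/

section ShiftInvariance

theorem vandermondeVec_add (M K : ℕ) (ω : ℝ) {i : ℕ} (hi : i < M) {j : ℕ} (hj : j < K) {N : ℕ}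
    (h : i + j < N) :
    vandermondeVec N ω ⟨i + j, h⟩ = vandermondeVec M ω ⟨i, hi⟩ * vandermondeVec K ω ⟨j, hj⟩ := by
  simp only [vandermondeVec, ← Complex.exp_add]
  congr 1
  push_cast
  ring

theorem selFirst_mulVec {K : ℕ} (v : Fin K → ℂ) (i : Fin (K - 1)) :
    (selFirst K *ᵥ v) i = v ⟨i, by omega⟩ := by
  simp only [mulVec, dotProduct, selFirst, of_apply]
  rw [Finset.sum_eq_single ⟨(i : ℕ), by omega⟩]
  · simp
  · intro j _ hj
    rw [if_neg fun h => hj (Fin.ext h), zero_mul]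
  · simp

theorem selLast_mulVec {K : ℕ} (v : Fin K → ℂ) (i : Fin (K - 1)) :
    (selLast K *ᵥ v) i = v ⟨i + 1, by omega⟩ := by
  simp only [mulVec, dotProduct, selLast, of_apply]
  rw [Finset.sum_eq_single ⟨(i : ℕ) + 1, by omega⟩]
  · simp
  · intro j _ hj
    rw [if_neg fun h => hj (Fin.ext h), zero_mul]
  · simp

theorem selLast_vandermondeVec (K : ℕ) (ω : ℝ) :
    selLast K *ᵥ vandermondeVec K ω =
      Complex.exp (Complex.I * (ω : ℂ)) • (selFirst K *ᵥ vandermondeVec K ω) := by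
  ext i
  rw [selLast_mulVec, Pi.smul_apply, selFirst_mulVec, smul_eq_mul]
  simp only [vandermondeVec, ← Complex.exp_add]
  congr 1
  push_cast
  ring

/-- The restored shift invariance of a beamspace steering vector. -/
theorem restored_shift {M N : ℕ} {T : Matrix (Fin M) (Fin N) ℂ} {F Q : Matrix (Fin N) (Fin N) ℂ}
    (hT : HasShiftInvariance T F) (hQ : RestoresShiftInvariance T F Q) (ω : ℝ) :
    (Q * Fᴴ * Tᴴ) *ᵥ vandermondeVec M ω =
      Complex.exp (Complex.I * (ω : ℂ)) • ((Q * Tᴴ) *ᵥ vandermondeVec M ω) := by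
  have h1 : Tᴴ * (selFirst M)ᴴ = Fᴴ * (Tᴴ * (selLast M)ᴴ) := by
    rw [← conjTranspose_mul, hT.2, conjTranspose_mul, conjTranspose_mul]
  -- `(selLast M)ᴴ * selLast M` is the identity except for a zero in the first diagonal position,
  -- which is harmless when column `0` of `B` vanishes. `hsplit1` is the mirror statement for the
  -- last column. The two conditions on `Q` supply these vanishing columns.
  have hsplit0 : ∀ (B : Matrix (Fin N) (Fin M) ℂ) (v : Fin M → ℂ),
      (∀ m : Fin M, (m : ℕ) = 0 → B.col m = 0) →
      B *ᵥ v = (B * (selLast M)ᴴ) *ᵥ (selLast M *ᵥ v) := by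
    intro B v hB
    rw [mulVec_mulVec, Matrix.mul_assoc]
    ext a
    rw [mulVec, mulVec, dotProduct, dotProduct]
    refine Finset.sum_congr rfl fun m _ => ?_
    congr 1
    rw [mul_apply, Finset.sum_eq_single m]
    · by_cases hm : (m : ℕ) = 0
      · have := congrFun (hB m hm) a
        rw [col_apply] at this
        rw [this]; simp
      · rw [mul_apply, Finset.sum_eq_single ⟨(m : ℕ) - 1, by omega⟩]
        · have : (m : ℕ) = m - 1 + 1 := by omega
          simp [selLast, ← this]
        · intro j _ hj
          have : ¬ (m : ℕ) = j + 1 := fun h => hj (Fin.ext (by simp [h]))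
          simp [selLast, this]
        · simp
    · intro k _ hk
      rw [mul_apply, Finset.sum_eq_zero, mul_zero]
      intro j _
      by_cases hkj : (k : ℕ) = j + 1
      · have : ¬ (m : ℕ) = j + 1 := fun h => hk (Fin.ext (by omega))
        simp [selLast, this]
      · simp [selLast, hkj]
    · simp
  have hsplit1 : ∀ (B : Matrix (Fin N) (Fin M) ℂ) (v : Fin M → ℂ),
      (∀ m : Fin M, (m : ℕ) + 1 = M → B.col m = 0) →
      B *ᵥ v = (B * (selFirst M)ᴴ) *ᵥ (selFirst M *ᵥ v) := by
    intro B v hB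
    rw [mulVec_mulVec, Matrix.mul_assoc]
    ext a
    rw [mulVec, mulVec, dotProduct, dotProduct]
    refine Finset.sum_congr rfl fun m _ => ?_
    congr 1
    rw [mul_apply, Finset.sum_eq_single m]
    · by_cases hm : (m : ℕ) + 1 = M
      · have := congrFun (hB m hm) a
        rw [col_apply] at this
        rw [this]; simp
      · rw [mul_apply, Finset.sum_eq_single ⟨(m : ℕ), by omega⟩]
        · simp [selFirst]
        · intro j _ hj
          have : ¬ (m : ℕ) = j := fun h => hj (Fin.ext (by simp [h]))
          simp [selFirst, this]
        · simp
    · intro k _ hk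
      rw [mul_apply, Finset.sum_eq_zero, mul_zero]
      intro j _
      by_cases hkj : (k : ℕ) = j
      · have : ¬ (m : ℕ) = j := fun h => hk (Fin.ext (by omega))
        simp [selFirst, this]
      · simp [selFirst, hkj]
    · simp
  rw [hsplit0 (Q * Fᴴ * Tᴴ), hsplit1 (Q * Tᴴ), selLast_vandermondeVec, mulVec_smul]
  · rw [Matrix.mul_assoc Q Tᴴ, h1]
    simp only [Matrix.mul_assoc]
  · intro m hm
    have := hQ.1 m hm
    rw [← this]
    ext a
    simp [mul_apply, mulVec, dotProduct]
  · intro m hm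
    have := hQ.2 m hm
    rw [← this]
    ext a
    rw [col_apply, mul_apply]; rfl

theorem inMode_mul_P (S : Model L) (n : Fin 4) (A : Matrix (Fin (S.N n)) (Fin (S.N n)) ℂ)
    (p : SIdx S) (l : Fin L) :
    (inMode S n A * P S) p l = (∏ i ∈ Finset.univ.erase n, B S i (p.1 i) l) * (A * B S n) (p.1 n) l *
      vandermondeVec S.K5 (omega S l 4) p.2 := by
  obtain ⟨b, k⟩ := p
  rw [mul_apply, Fintype.sum_prod_type]
  have h1 : ∀ b' : Beam S, ∑ k', inMode S n A (b, k) (b', k') * P S (b', k') l =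
      (if ∀ i, i ≠ n → b i = b' i then A (b n) (b' n) else 0) * (∏ i, B S i (b' i) l) *
        vandermondeVec S.K5 (omega S l 4) k := by
    intro b'
    rw [Finset.sum_eq_single k]
    · simp [inMode, P, mul_assoc]
    · intro k' _ hk'
      simp [inMode, one_apply_ne hk'.symm]
    · simp
  simp only [h1]
  rw [← Finset.sum_mul]
  congr 1
  rw [mul_apply, Finset.mul_sum]
  symm
  -- The beam indices that agree with `b` outside mode `n` are exactly the updates of `b` at `n`, so
  -- the sum collapses to that mode.
  refine Finset.sum_of_injOn (fun x => Function.update b n x) ?_ ?_ ?_ ?_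
  · exact (Function.update_injective b n).injOn
  · exact fun _ _ => Finset.mem_coe.2 (Finset.mem_univ _)
  · intro b' _ hb'
    rw [if_neg, zero_mul]
    intro h
    refine hb' ⟨b' n, by simp, ?_⟩
    ext i
    by_cases hi : i = n
    · subst hi; simp
    · simp [hi, h i hi]
  · intro x _
    have h2 : ∏ i ∈ Finset.univ.erase n, B S i (Function.update b n x i) l =
        ∏ i ∈ Finset.univ.erase n, B S i (b i) l :=
      Finset.prod_congr rfl fun i hi => by rw [Function.update_of_ne (Finset.ne_of_mem_erase hi)]
    rw [if_pos fun i hi => by simp [hi], Function.update_self,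
      ← Finset.mul_prod_erase _ _ (Finset.mem_univ n), Function.update_self, h2]
    ring

theorem J2_mul_P (S : Model L) (n : Fin 4) (hT : HasShiftInvariance (S.T n) (S.F n))
    (hQ : RestoresShiftInvariance (S.T n) (S.F n) (S.Q n)) :
    J2 S n * P S = J1 S n * P S * diagonal fun l => Phi S l n.castSucc := by
  ext p l
  rw [mul_diagonal, J1, J2, inMode_mul_P, inMode_mul_P]
  have h1 : (S.Q n * (S.F n)ᴴ * B S n) (p.1 n) l =
      Phi S l n.castSucc * (S.Q n * B S n) (p.1 n) l := by
    have := congrFun (restored_shift hT hQ (omega S l n.castSucc)) (p.1 n)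
    rw [B, ← Matrix.mul_assoc, ← Matrix.mul_assoc]
    exact this
  rw [h1]
  ring

theorem one_kronecker_mul_P (S : Model L) {q : Type} [Fintype q] (A : Matrix q (Fin S.K5) ℂ)
    (b : Beam S) (k : q) (l : Fin L) :
    (((1 : Matrix (Beam S) (Beam S) ℂ) ⊗ₖ A) * P S) (b, k) l =
      (∏ i, B S i (b i) l) * (A *ᵥ vandermondeVec S.K5 (omega S l 4)) k := by
  rw [mul_apply, Fintype.sum_prod_type, Finset.sum_eq_single b]
  · rw [mulVec, dotProduct, Finset.mul_sum]
    refine Finset.sum_congr rfl fun k' _ => ?_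
    simp [P]
    ring
  · intro b' _ hb'
    refine Finset.sum_eq_zero fun k' _ => ?_
    simp [one_apply_ne hb'.symm]
  · simp

theorem J2freq_mul_P (S : Model L) :
    J2freq S * P S = J1freq S * P S * diagonal fun l => Phi S l 4 := by
  ext ⟨b, k⟩ l
  rw [mul_diagonal, J1freq, J2freq, one_kronecker_mul_P, one_kronecker_mul_P,
    selLast_vandermondeVec, Pi.smul_apply, smul_eq_mul, ← Phi]
  ring

end ShiftInvariance

/-! ### Smoothing as a linear map and its factorization -/

section Smoothing

theorem smooth_add (S : Model L) (h h' : Idx S → ℂ) :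
    smooth S (h + h') = smooth S h + smooth S h' := by
  ext p ℓ; rfl

theorem smooth_channel (S : Model L) :
    smooth S (channel S) = P S * (diagonal S.γ * (G S)ᵀ) := by
  ext ⟨b, k⟩ ℓ
  rw [mul_apply]
  simp only [smooth, channel, of_apply, diagonal_mul, transpose_apply, P, G]
  refine Finset.sum_congr rfl fun l _ => ?_
  rw [vandermondeVec_add S.K5 S.L5 _ k.2 ℓ.2]
  ring

theorem smooth_entry_isBigO (S : Model L) {α : Type*} {𝓛 : Filter α} (Δh : α → Idx S → ℂ)
    (p : SIdx S) (ℓ : Fin S.L5) :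
    (fun a => smooth S (Δh a) p ℓ) =O[𝓛] fun a => ‖Δh a‖ :=
  IsBigO.of_bound' (Eventually.of_forall fun a => by
    rw [norm_norm]; exact norm_le_pi_norm (Δh a) _)

/-- Bilinear form of the smoothed matrix as a linear form in the channel. -/
theorem sum_smooth_eq (S : Model L) (u : SIdx S → ℂ) (v : Fin S.L5 → ℂ) (h : Idx S → ℂ) :
    u ⬝ᵥ (smooth S h) *ᵥ v =
      ∑ p : Idx S, (∑ k : Fin S.K5, ∑ ℓ : Fin S.L5,
        if (k : ℕ) + (ℓ : ℕ) = p.2 then u (p.1, k) * v ℓ else 0) * h p := by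
  rw [dotProduct, Fintype.sum_prod_type, Fintype.sum_prod_type]
  refine Finset.sum_congr rfl fun b _ => ?_
  simp only [Finset.sum_mul]
  rw [Finset.sum_comm]
  refine Finset.sum_congr rfl fun k _ => ?_
  rw [Finset.sum_comm, mulVec, dotProduct, Finset.mul_sum]
  refine Finset.sum_congr rfl fun ℓ _ => ?_
  have hlt : (k : ℕ) + (ℓ : ℕ) < S.M5 := by
    have := k.2; have := ℓ.2; have := S.smoothing; omega
  rw [Finset.sum_eq_single ⟨(k : ℕ) + (ℓ : ℕ), hlt⟩]
  · simp only [smooth, of_apply, if_true]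
    ring
  · intro m _ hm
    rw [if_neg fun h => hm (Fin.ext h.symm), zero_mul]
  · simp

end Smoothing

/-! ### A right inverse adapted to the signal subspace -/

section Factorization

theorem isUnit_P (S : Model L) {r : Type*} [Fintype r] {A : Matrix r (SIdx S) ℂ}
    (h : LinearIndependent ℂ (A * P S).col) : IsUnit ((P S)ᴴ * P S) := by
  refine isUnit_conjTranspose_mul_self (mulVec_injective_iff.1 fun v w hvw => ?_)
  refine mulVec_injective_iff.2 h ?_
  rw [← mulVec_mulVec, ← mulVec_mulVec, hvw]

/-- The right inverse of `diag(γ) Gᵀ` in terms of which the signal subspace is perturbed. -/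
def snapshotInverse (S : Model L) : Matrix (Fin S.L5) (Fin L) ℂ :=
  pinv (G S)ᵀ * diagonal fun l => (S.γ l)⁻¹

theorem G_transpose_mul_pinv (S : Model L) (hG : LinearIndependent ℂ (G S).col) :
    (G S)ᵀ * pinv (G S)ᵀ = 1 := by
  refine mul_pinv_of_isUnit ?_
  have h1 : (G S)ᵀ * (G S)ᵀᴴ = ((G S)ᴴ * G S)ᵀ := by
    rw [transpose_mul]; rfl
  rw [h1, isUnit_transpose]
  exact isUnit_conjTranspose_mul_self hG

theorem channel_mul_snapshotInverse (S : Model L) (hγ : ∀ l, S.γ l ≠ 0)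
    (hG : LinearIndependent ℂ (G S).col) :
    P S * (diagonal S.γ * (G S)ᵀ) * snapshotInverse S = P S := by
  rw [snapshotInverse, Matrix.mul_assoc, Matrix.mul_assoc, ← Matrix.mul_assoc (G S)ᵀ,
    G_transpose_mul_pinv S hG, Matrix.one_mul, diagonal_mul_diagonal]
  have : (fun i => S.γ i * (S.γ i)⁻¹) = fun _ => 1 := by
    ext i; exact mul_inv_cancel₀ (hγ i)
  rw [this, diagonal_one, Matrix.mul_one]

/-- Supplies the range condition that makes `Z X` second order: `pinv Gᵀ` has its columns in the
range of `(Gᵀ)ᴴ`, and the factors `diag(γ)ᴴ` and `Pᴴ` are undone by `diag(γ⁻¹)ᴴ` and `(pinv P)ᴴ`. -/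
theorem exists_snapshotInverse_eq (S : Model L) (hγ : ∀ l, S.γ l ≠ 0)
    (hP : IsUnit ((P S)ᴴ * P S)) :
    ∃ Y : Matrix (SIdx S) (Fin L) ℂ, snapshotInverse S = (P S * (diagonal S.γ * (G S)ᵀ))ᴴ * Y := by
  refine ⟨(pinv (P S))ᴴ * ((diagonal fun l => (S.γ l)⁻¹)ᴴ *
    ((pinv (G S)ᵀ)ᴴ * pinv (G S)ᵀ * diagonal fun l => (S.γ l)⁻¹)), ?_⟩
  have h1 : (P S)ᴴ * (pinv (P S))ᴴ = 1 := by
    rw [← conjTranspose_mul, pinv_mul_self_of_isUnit hP, conjTranspose_one]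
  have h2 : (diagonal S.γ)ᴴ * (diagonal fun l => (S.γ l)⁻¹)ᴴ = 1 := by
    rw [← conjTranspose_mul, diagonal_mul_diagonal]
    have : (fun i => (S.γ i)⁻¹ * S.γ i) = fun _ => 1 := by
      ext i; exact inv_mul_cancel₀ (hγ i)
    rw [this, diagonal_one, conjTranspose_one]
  rw [conjTranspose_mul, conjTranspose_mul, Matrix.mul_assoc _ (P S)ᴴ, ← Matrix.mul_assoc (P S)ᴴ,
    h1, Matrix.one_mul, Matrix.mul_assoc, ← Matrix.mul_assoc (diagonal S.γ)ᴴ, h2, Matrix.one_mul,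
    snapshotInverse]
  conv_lhs => rw [pinv_eq_conjTranspose_mul]
  simp only [Matrix.mul_assoc]

end Factorization

/-! ### First-order expansion of the matrices `Γ_n` -/

section Expansion

/-- The first-order term of the diagonal of the solution of the shift invariance equation. -/
theorem first_order_diagonal (S : Model L) {r : Type} [Fintype r] (A₁ A₂ : Matrix r (SIdx S) ℂ)
    (φ : Fin L → ℂ) (h : Idx S → ℂ) (l : Fin L) :
    (pinv (A₁ * P S) * (A₂ * (smooth S h * snapshotInverse S)
      - A₁ * (smooth S h * snapshotInverse S) * diagonal φ)) l l =
      lambdaH S A₁ A₂ (φ l) l ⬝ᵥ (smooth S h) *ᵥ (fun ℓ => pinv (G S)ᵀ ℓ l) / S.γ l := by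
  set Δ := smooth S h * snapshotInverse S with hΔ
  -- In the diagonal entry `(l, l)` the right factor `diagonal φ` acts only through the scalar `φ
  -- l`; this produces the operator `A₂ - φ l • A₁` of `lambdaH`.
  have h1 : (pinv (A₁ * P S) * (A₂ * Δ - A₁ * Δ * diagonal φ)) l l =
      (pinv (A₁ * P S) * (A₂ - φ l • A₁) * Δ) l l := by
    generalize Δ = Δ'
    simp only [Matrix.mul_sub, Matrix.sub_mul, Matrix.sub_apply, ← Matrix.mul_assoc, mul_diagonal,
      Matrix.mul_smul, Matrix.smul_mul, Matrix.smul_apply, smul_eq_mul]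
    ring
  rw [h1, hΔ, snapshotInverse, ← Matrix.mul_assoc, ← Matrix.mul_assoc, mul_diagonal,
    Matrix.mul_assoc _ (smooth S h), div_eq_mul_inv]
  rfl

/-- Convolution is the adjoint of smoothing, so a bilinear form in the smoothed error becomes a
linear form in the error. The conjugations in `lambda` and `chi` cancel against the outer `star`. -/
theorem star_xi_dotProduct (S : Model L) (h : Idx S → ℂ) (l : Fin L) (n : Fin 5) :
    star (xi S l n) ⬝ᵥ h =
      star (lambda S l n) ⬝ᵥ (smooth S h) *ᵥ fun ℓ => pinv (G S)ᵀ ℓ l := by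
  rw [sum_smooth_eq, dotProduct]
  refine Finset.sum_congr rfl fun p _ => ?_
  congr 1
  simp only [xi, Pi.star_apply, star_sum]
  refine Finset.sum_congr rfl fun k _ => Finset.sum_congr rfl fun ℓ _ => ?_
  split_ifs
  · rw [star_mul', chi, star_star]
  · exact star_zero _

/-- The shift invariance equations have solutions that are, up to a common change of basis,
perturbations of the diagonal matrices of the `Φ_{l,n}`. -/
theorem gam_expansion (S : Model L)
    (hshift : ∀ n, HasShiftInvariance (S.T n) (S.F n))
    (hQ : ∀ n, RestoresShiftInvariance (S.T n) (S.F n) (S.Q n))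
    (hγ : ∀ l, S.γ l ≠ 0) (hG : LinearIndependent ℂ (G S).col)
    (hJ : ∀ n, LinearIndependent ℂ (J1 S n * P S).col)
    (hJ5 : LinearIndependent ℂ (J1freq S * P S).col)
    {α : Type*} {𝓛 : Filter α} {Δh : α → Idx S → ℂ} (hΔ : Tendsto Δh 𝓛 (𝓝 0))
    {U : α → Matrix (SIdx S) (Fin L) ℂ}
    (hU : ∀ a, IsLeadingLeftSingular (smooth S (channel S + Δh a)) (U a)) :
    ∃ (R : α → Matrix (Fin L) (Fin L) ℂ) (Λ : Fin 5 → α → Matrix (Fin L) (Fin L) ℂ),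
      (∀ᶠ a in 𝓛, IsUnit (R a) ∧
        ∀ n, Gam S (U a) n = R a * (diagonal (fun l => Phi S l n) + Λ n a) * (R a)⁻¹) ∧
      (∀ n i j, (fun a => Λ n a i j) =O[𝓛] fun a => ‖Δh a‖) ∧
      ∀ n l, (fun a => Λ n a l l - star (xi S l n) ⬝ᵥ Δh a / S.γ l) =o[𝓛] fun a => ‖Δh a‖ := by
  have hP := isUnit_P S hJ5
  obtain ⟨Y, hY⟩ := exists_snapshotInverse_eq S hγ hP
  have hg : Tendsto (fun a => ‖Δh a‖) 𝓛 (𝓝 0) := by simpa using hΔ.norm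
  have hsub : ∀ a, smooth S (channel S + Δh a) - P S * (diagonal S.γ * (G S)ᵀ) =
      smooth S (Δh a) := by
    intro a
    rw [smooth_add, smooth_channel, add_sub_cancel_left]
  obtain ⟨R, W, hRW, hWo, hWP⟩ := leading_subspace_expansion hP
    (channel_mul_snapshotInverse S hγ hG) hY hg
    (fun i j => by simpa only [hsub] using smooth_entry_isBigO S Δh i j) hU
  simp only [hsub] at hWo
  have hΔX : ∀ i j, (fun a => (smooth S (Δh a) * snapshotInverse S) i j) =O[𝓛]
      fun a => ‖Δh a‖ := by
    intro i j
    have := isBigO_mul_entries (smooth_entry_isBigO S (𝓛 := 𝓛) Δh)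
      (isBigO_one_const_entries (l := 𝓛) (snapshotInverse S)) i j
    simpa only [mul_one] using this
  -- One pair of selection matrices at a time, always with the same `R` and `W`: only a common basis
  -- change permits joint diagonalization.
  have hmain : ∀ {r : Type} [Fintype r] (A₁ A₂ : Matrix r (SIdx S) ℂ) (φ : Fin L → ℂ),
      A₂ * P S = A₁ * P S * diagonal φ → LinearIndependent ℂ (A₁ * P S).col →
      ∃ Λ : α → Matrix (Fin L) (Fin L) ℂ,
        (∀ᶠ a in 𝓛, pinv (A₁ * U a) * (A₂ * U a) = R a * (diagonal φ + Λ a) * (R a)⁻¹) ∧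
        (∀ i j, (fun a => Λ a i j) =O[𝓛] fun a => ‖Δh a‖) ∧
        ∀ l, (fun a => Λ a l l -
          lambdaH S A₁ A₂ (φ l) l ⬝ᵥ (smooth S (Δh a)) *ᵥ (fun ℓ => pinv (G S)ᵀ ℓ l) / S.γ l)
            =o[𝓛] fun a => ‖Δh a‖ := by
    intro r _ A₁ A₂ φ hA hi
    obtain ⟨h1, h2, h3⟩ := shift_matrix_expansion hA (isUnit_conjTranspose_mul_self hi) hΔX hWo hWP
    refine ⟨_, ?_, h2, fun l => ?_⟩
    · filter_upwards [hRW, h1] with a ha ha'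
      rw [ha.2]
      exact pinv_mul_eq_conj ha.1 ha'
    · refine (h3 l l).congr_left fun a => ?_
      rw [Matrix.sub_apply, first_order_diagonal]
  have hn : ∀ n : Fin 5, ∃ Λ : α → Matrix (Fin L) (Fin L) ℂ,
      (∀ᶠ a in 𝓛, Gam S (U a) n = R a * (diagonal (fun l => Phi S l n) + Λ a) * (R a)⁻¹) ∧
      (∀ i j, (fun a => Λ a i j) =O[𝓛] fun a => ‖Δh a‖) ∧
      ∀ l, (fun a => Λ a l l - star (xi S l n) ⬝ᵥ Δh a / S.γ l) =o[𝓛] fun a => ‖Δh a‖ := by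
    intro n
    induction n using Fin.lastCases with
    | last =>
      have := hmain (J1freq S) (J2freq S) (fun l => Phi S l 4) (J2freq_mul_P S) hJ5
      simp only [star_xi_dotProduct, lambda, star_star, Gam, Fin.snoc_last]
      exact this
    | cast n =>
      have := hmain (J1 S n) (J2 S n) (fun l => Phi S l n.castSucc)
        (J2_mul_P S n (hshift n) (hQ n)) (hJ n)
      simp only [star_xi_dotProduct, lambda, star_star, Gam, Fin.snoc_castSucc]
      exact this
  choose Λ hΛ1 hΛ2 hΛ3 using hn
  refine ⟨R, Λ, ?_, hΛ2, hΛ3⟩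
  filter_upwards [hRW, eventually_all.2 hΛ1] with a ha ha'
  exact ⟨ha.1, ha'⟩

end Expansion

end Beamspace

/-! ### The angular frequency map and its invertible Jacobian -/

section AngularFrequencies

open Asymptotics

/-- Jacobian of the angular frequencies. -/
def angFreqJac (Δf : ℝ) (x : Fin 5 → ℝ) (v : Fin 5 → ℝ) : Fin 5 → ℝ :=
  ![Real.pi * Real.cos (x 0) * Real.sin (x 1) * v 0 + Real.pi * Real.sin (x 0) * Real.cos (x 1) * v 1,
    -(Real.pi * Real.sin (x 1) * v 1),
    Real.pi * Real.cos (x 2) * Real.sin (x 3) * v 2 + Real.pi * Real.sin (x 2) * Real.cos (x 3) * v 3,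
    -(Real.pi * Real.sin (x 3) * v 3),
    -(2 * Real.pi * Δf * v 4)]

/-- Inverse of the Jacobian of the angular frequencies. -/
def angFreqJacInv (Δf : ℝ) (x : Fin 5 → ℝ) (w : Fin 5 → ℝ) : Fin 5 → ℝ :=
  ![1 / (Real.pi * Real.cos (x 0) * Real.sin (x 1)) * w 0
      + Real.sin (x 0) * Real.cos (x 1) / (Real.pi * Real.cos (x 0) * Real.sin (x 1) ^ 2) * w 1,
    -(1 / (Real.pi * Real.sin (x 1)) * w 1),
    1 / (Real.pi * Real.cos (x 2) * Real.sin (x 3)) * w 2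
      + Real.sin (x 2) * Real.cos (x 3) / (Real.pi * Real.cos (x 2) * Real.sin (x 3) ^ 2) * w 3,
    -(1 / (Real.pi * Real.sin (x 3)) * w 3),
    -(1 / (2 * Real.pi * Δf) * w 4)]

/-- The Jacobian of the angular frequencies at a nondegenerate point, as an equivalence. -/
def angFreqJacEquiv {Δf : ℝ} (hΔf : Δf ≠ 0) {x : Fin 5 → ℝ}
    (hφ : Real.cos (x 0) ≠ 0 ∧ Real.sin (x 1) ≠ 0) (hθ : Real.cos (x 2) ≠ 0 ∧ Real.sin (x 3) ≠ 0) :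
    (Fin 5 → ℝ) ≃L[ℝ] (Fin 5 → ℝ) :=
  LinearEquiv.toContinuousLinearEquiv
    { toFun := angFreqJac Δf x
      invFun := angFreqJacInv Δf x
      map_add' := fun v w => by
        ext i; fin_cases i <;> simp [angFreqJac] <;> ring
      map_smul' := fun c v => by
        ext i; fin_cases i <;> simp [angFreqJac] <;> ring
      left_inv := fun v => by
        have h1 := hφ.1
        have h2 := hφ.2
        have h3 := hθ.1
        have h4 := hθ.2
        have h5 := Real.pi_ne_zero
        ext i; fin_cases i <;> simp [angFreqJac, angFreqJacInv] <;> field_simp <;> ring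
      right_inv := fun w => by
        have h1 := hφ.1
        have h2 := hφ.2
        have h3 := hθ.1
        have h4 := hθ.2
        have h5 := Real.pi_ne_zero
        ext i; fin_cases i <;> simp [angFreqJac, angFreqJacInv] <;> field_simp <;> ring }

theorem hasStrictFDerivAt_angFreq {Δf : ℝ} (hΔf : Δf ≠ 0) {x : Fin 5 → ℝ}
    (hφ : Real.cos (x 0) ≠ 0 ∧ Real.sin (x 1) ≠ 0) (hθ : Real.cos (x 2) ≠ 0 ∧ Real.sin (x 3) ≠ 0) :
    HasStrictFDerivAt (angFreq Δf)
      (angFreqJacEquiv hΔf hφ hθ : (Fin 5 → ℝ) →L[ℝ] (Fin 5 → ℝ)) x := by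
  have hp : ∀ i : Fin 5, HasStrictFDerivAt (fun y : Fin 5 → ℝ => y i)
      (ContinuousLinearMap.proj i : (Fin 5 → ℝ) →L[ℝ] ℝ) x := fun i => hasStrictFDerivAt_apply i x
  rw [hasStrictFDerivAt_pi']
  intro i
  fin_cases i
  · refine (((hp 0).sin.const_mul Real.pi).mul (hp 1).sin).congr_fderiv ?_
    ext v; simp [angFreqJacEquiv, angFreqJac]; ring
  · refine ((hp 1).cos.const_mul Real.pi).congr_fderiv ?_
    ext v; simp [angFreqJacEquiv, angFreqJac]; ring
  · refine (((hp 2).sin.const_mul Real.pi).mul (hp 3).sin).congr_fderiv ?_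
    ext v; simp [angFreqJacEquiv, angFreqJac]; ring
  · refine ((hp 3).cos.const_mul Real.pi).congr_fderiv ?_
    ext v; simp [angFreqJacEquiv, angFreqJac]; ring
  · refine ((hp 4).const_mul (2 * Real.pi * Δf)).neg.congr_fderiv ?_
    ext v; simp [angFreqJacEquiv, angFreqJac]

end AngularFrequencies

/-! ### Linearization of the position estimator -/

section Position

theorem dotProduct_self_ne_zero_of_ne_zero {μ : Fin 3 → ℝ} (h : μ ≠ 0) : μ ⬝ᵥ μ ≠ 0 :=
  fun h0 => h (dotProduct_self_eq_zero.1 h0)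

/-- Lets each coordinate derivative come from the calculus rules by unification, recording only its
values on vectors. -/
theorem exists_hasFDerivAt_pi {E ι : Type*} [NormedAddCommGroup E] [NormedSpace ℝ E] [Fintype ι]
    {f : E → ι → ℝ} {F : E → ι → ℝ} {x : E}
    (h : ∀ i, ∃ D : E →L[ℝ] ℝ, HasFDerivAt (fun y => f y i) D x ∧ ∀ v, D v = F v i) :
    ∃ D : E →L[ℝ] (ι → ℝ), HasFDerivAt f D x ∧ ∀ v, D v = F v := by
  choose D hD hF using h
  exact ⟨ContinuousLinearMap.pi D, hasFDerivAt_pi.2 hD, fun v => funext fun i => hF i v⟩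

/-- Product rule for the projection orthogonal to `μ`, applied to `r`. The coefficient of `μ'` is,
up to the weight, `breveC` when `r = δ - p_R`. -/
theorem exists_hasFDerivAt_projection {E : Type*} [NormedAddCommGroup E] [NormedSpace ℝ E]
    {μ r : E → Fin 3 → ℝ} {μ' r' : E →L[ℝ] (Fin 3 → ℝ)} {x : E} (hμ : HasFDerivAt μ μ' x)
    (hr : HasFDerivAt r r' x) (h0 : μ x ≠ 0) :
    ∃ D : E →L[ℝ] (Fin 3 → ℝ),
      HasFDerivAt (fun y => (1 - (μ y ⬝ᵥ μ y)⁻¹ • vecMulVec (μ y) (μ y)) *ᵥ r y) D x ∧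
      ∀ v, D v = (1 - (μ x ⬝ᵥ μ x)⁻¹ • vecMulVec (μ x) (μ x)) *ᵥ r' v +
        ((2 * (μ x ⬝ᵥ r x) / (μ x ⬝ᵥ μ x) ^ 2) • vecMulVec (μ x) (μ x)
          - (μ x ⬝ᵥ μ x)⁻¹ • ((μ x ⬝ᵥ r x) • (1 : Matrix (Fin 3) (Fin 3) ℝ)
            + vecMulVec (μ x) (r x))) *ᵥ μ' v := by
  have hne := dotProduct_self_ne_zero_of_ne_zero h0
  have hμi : ∀ i, HasFDerivAt (fun y => μ y i) ((ContinuousLinearMap.proj i).comp μ') x :=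
    hasFDerivAt_pi'.1 hμ
  have hri : ∀ i, HasFDerivAt (fun y => r y i) ((ContinuousLinearMap.proj i).comp r') x :=
    hasFDerivAt_pi'.1 hr
  have hμμ : HasFDerivAt (fun y => μ y ⬝ᵥ μ y) _ x :=
    HasFDerivAt.fun_sum fun i _ => (hμi i).mul (hμi i)
  have hμr : HasFDerivAt (fun y => μ y ⬝ᵥ r y) _ x :=
    HasFDerivAt.fun_sum fun i _ => (hμi i).mul (hri i)
  have hinv := (hasDerivAt_inv hne).comp_hasFDerivAt x hμμ
  have hcoord : ∀ i, HasFDerivAt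
      (fun y => r y i - (μ y ⬝ᵥ μ y)⁻¹ * (μ y ⬝ᵥ r y) * μ y i) _ x := fun i =>
    (hri i).sub ((hinv.mul hμr).mul (hμi i))
  have hform : ∀ m s : Fin 3 → ℝ, (1 - (m ⬝ᵥ m)⁻¹ • vecMulVec m m) *ᵥ s =
      fun i => s i - (m ⬝ᵥ m)⁻¹ * (m ⬝ᵥ s) * m i := by
    intro m s
    rw [sub_mulVec, one_mulVec, smul_mulVec, vecMulVec_mulVec]
    ext i
    simp
    ring
  simp only [hform]
  refine exists_hasFDerivAt_pi fun i => ⟨_, hcoord i, fun v => ?_⟩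
  rw [sub_mulVec, smul_mulVec, smul_mulVec, add_mulVec, smul_mulVec, one_mulVec,
    vecMulVec_mulVec, vecMulVec_mulVec]
  simp only [ContinuousLinearMap.comp_apply, ContinuousLinearMap.proj_apply, _root_.sub_apply,
    _root_.add_apply, _root_.smul_apply, _root_.sum_apply, smul_eq_mul, Pi.mul_apply,
    Function.comp_apply, Pi.sub_apply, Pi.add_apply, Pi.smul_apply, MulOpposite.smul_eq_mul_unop,
    MulOpposite.unop_op, Finset.sum_add_distrib]
  have e1 : ∑ j, μ x j * μ' v j = μ x ⬝ᵥ μ' v := rfl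
  have e2 : ∑ j, μ x j * r' v j = μ x ⬝ᵥ r' v := rfl
  have e3 : ∑ j, r x j * μ' v j = r x ⬝ᵥ μ' v := rfl
  rw [e1, e2, e3]
  field_simp
  ring

theorem exists_hasFDerivAt_dirVec (i j : Fin 5) (x : Fin 5 → ℝ) :
    ∃ D : (Fin 5 → ℝ) →L[ℝ] (Fin 3 → ℝ), HasFDerivAt (fun y => dirVec (y i) (y j)) D x ∧
      ∀ v, D v = fun k => omegaMat (x i) (x j) k 0 * v i + omegaMat (x i) (x j) k 1 * v j := by
  have hp : ∀ i : Fin 5, HasFDerivAt (fun y : Fin 5 → ℝ => y i)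
      (ContinuousLinearMap.proj i : (Fin 5 → ℝ) →L[ℝ] ℝ) x := fun i => hasFDerivAt_apply i x
  refine exists_hasFDerivAt_pi fun k => ?_
  fin_cases k
  · refine ⟨_, (hp i).cos.mul (hp j).sin, fun v => ?_⟩
    simp [omegaMat]; ring
  · refine ⟨_, (hp i).sin.mul (hp j).sin, fun v => ?_⟩
    simp [omegaMat]; ring
  · refine ⟨_, (hp j).cos, fun v => ?_⟩
    simp [omegaMat]

theorem exists_hasFDerivAt_muVec (c : ℝ) (x : Fin 5 → ℝ) :
    ∃ D : (Fin 5 → ℝ) →L[ℝ] (Fin 3 → ℝ), HasFDerivAt (muVec c) D x ∧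
      ∀ v, D v = c • (blockE x *ᵥ v) := by
  obtain ⟨DT, hDT, hDT'⟩ := exists_hasFDerivAt_dirVec 0 1 x
  obtain ⟨DR, hDR, hDR'⟩ := exists_hasFDerivAt_dirVec 2 3 x
  refine ⟨_, ((hasFDerivAt_apply (𝕜 := ℝ) (4 : Fin 5) x).const_mul c).smul (hDT.add hDR),
    fun v => ?_⟩
  ext k
  simp [hDT', hDR', blockE, mulVec, dotProduct, Fin.sum_univ_five, fT, fR]
  ring

theorem exists_hasFDerivAt_deltaVec (c : ℝ) (pT : Fin 3 → ℝ) (x : Fin 5 → ℝ) :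
    ∃ D : (Fin 5 → ℝ) →L[ℝ] (Fin 3 → ℝ), HasFDerivAt (deltaVec c pT) D x ∧
      ∀ v, D v = (-c) • (blockD x *ᵥ ![v 2, v 3, v 4]) := by
  obtain ⟨DR, hDR, hDR'⟩ := exists_hasFDerivAt_dirVec 2 3 x
  refine ⟨_, (((hasFDerivAt_apply (𝕜 := ℝ) (4 : Fin 5) x).const_mul c).smul hDR).const_sub pT,
    fun v => ?_⟩
  ext k
  simp [hDR', blockD, fR]
  ring

/-- First-order change of the contribution of one path to the normal equations. -/
def pathResidualDeriv (c ι : ℝ) (pT pR : Fin 3 → ℝ) (x v : Fin 5 → ℝ) : Fin 3 → ℝ :=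
  (-c) • ((projMat c ι x * blockD x) *ᵥ ![v 2, v 3, v 4]) +
    c • ((breveC c ι pT pR x * blockE x) *ᵥ v)

theorem exists_hasFDerivAt_pathResidual (c ι : ℝ) (pT pR : Fin 3 → ℝ) (x : Fin 5 → ℝ)
    (hμ : ι ≠ 0 → muVec c x ≠ 0) :
    ∃ D : (Fin 5 → ℝ) →L[ℝ] (Fin 3 → ℝ),
      HasFDerivAt (fun y => projMat c ι y *ᵥ (deltaVec c pT y - pR)) D x ∧
      ∀ v, D v = pathResidualDeriv c ι pT pR x v := by
  -- At zero weight the map is constant, while `μ` may vanish and the general formula with `‖μ‖⁻²`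
  -- is unavailable.
  rcases eq_or_ne ι 0 with rfl | hι
  · refine ⟨0, ?_, fun v => ?_⟩
    · simp only [projMat, zero_smul, zero_mulVec]
      exact hasFDerivAt_const _ _
    · simp [pathResidualDeriv, projMat, breveC]
  · obtain ⟨Dμ, hDμ, hDμ'⟩ := exists_hasFDerivAt_muVec c x
    obtain ⟨Dr, hDr, hDr'⟩ := exists_hasFDerivAt_deltaVec c pT x
    obtain ⟨D, hD, hD'⟩ := exists_hasFDerivAt_projection hDμ (hDr.sub_const pR) (hμ hι)
    refine ⟨ι • D, ?_, fun v => ?_⟩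
    · simp only [projMat, smul_mulVec]
      exact hD.const_smul ι
    · rw [_root_.smul_apply, hD', hDμ', hDr', pathResidualDeriv, projMat, breveC,
        mulVec_smul, mulVec_smul, mulVec_mulVec, mulVec_mulVec, Matrix.smul_mul, Matrix.smul_mul,
        smul_mulVec, smul_mulVec, smul_add, smul_comm ι, smul_comm ι]

theorem tendsto_projMat {α : Type*} {𝓛 : Filter α} {c ι : ℝ} {x : Fin 5 → ℝ}
    (hμ : ι ≠ 0 → muVec c x ≠ 0) {y : α → Fin 5 → ℝ} (hy : Tendsto y 𝓛 (𝓝 x)) :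
    Tendsto (fun a => projMat c ι (y a)) 𝓛 (𝓝 (projMat c ι x)) := by
  rcases eq_or_ne ι 0 with rfl | hι
  · simp only [projMat, zero_smul]
    exact tendsto_const_nhds
  · obtain ⟨Dμ, hDμ, -⟩ := exists_hasFDerivAt_muVec c x
    have h1 : ContinuousAt (fun z => projMat c ι z) x := by
      have hm := hDμ.continuousAt
      have h2 : ContinuousAt (fun z => muVec c z ⬝ᵥ muVec c z) x := by
        have hd : Continuous fun u : Fin 3 → ℝ => u ⬝ᵥ u := continuous_id.dotProduct continuous_id
        exact hd.continuousAt.comp hm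
      have h3 : ContinuousAt (fun z => vecMulVec (muVec c z) (muVec c z)) x := by
        have hd : Continuous fun u : Fin 3 → ℝ => vecMulVec u u :=
          continuous_id.matrix_vecMulVec continuous_id
        exact hd.continuousAt.comp hm
      exact (continuousAt_const.sub
        ((h2.inv₀ (dotProduct_self_ne_zero_of_ne_zero (hμ hι))).smul h3)).const_smul ι
    exact h1.tendsto.comp hy

/-- At the true parameters of a single-bounce path, the user lies on the line of the path. -/
theorem IsSingleBounce.projMat_mulVec_eq_zero {c ι : ℝ} {pT pR : Fin 3 → ℝ} {x : Fin 5 → ℝ}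
    (h : IsSingleBounce c pT pR x) (hμ : ι ≠ 0 → muVec c x ≠ 0) :
    projMat c ι x *ᵥ (deltaVec c pT x - pR) = 0 := by
  rcases eq_or_ne ι 0 with rfl | hι
  · simp [projMat]
  · obtain ⟨s, dT, dR, -, -, hT, hR, hτ⟩ := h
    have hμ0 := hμ hι
    have hτ0 : c * x 4 ≠ 0 := fun h0 => hμ0 (by rw [muVec, h0, zero_smul])
    -- Substituting the two path equations and `c τ = d_T + d_R` gives `δ - p_R = -d_T (f_T + f_R)`,
    -- a multiple of `μ`.
    have hr : deltaVec c pT x - pR = (-dT / (c * x 4)) • muVec c x := by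
      rw [muVec, smul_smul, div_mul_cancel₀ _ hτ0]
      have h1 : pT = s - dT • fT x := by rw [← hT]; abel
      have h2 : pR = s - dR • fR x := by rw [← hR]; abel
      rw [deltaVec, h1, h2, hτ]
      module
    rw [hr, mulVec_smul, projMat, smul_mulVec, sub_mulVec, one_mulVec, smul_mulVec,
      vecMulVec_mulVec]
    have hne := dotProduct_self_ne_zero_of_ne_zero hμ0
    have h3 : (muVec c x ⬝ᵥ muVec c x)⁻¹ • MulOpposite.op (muVec c x ⬝ᵥ muVec c x) • muVec c x
        = muVec c x := by
      ext i
      simp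
      field_simp
    rw [h3]; simp

open Asymptotics in
/-- First-order expansion of the position estimate. -/
theorem posEst_expansion {L : ℕ} {c : ℝ} {pT pR : Fin 3 → ℝ} {ι : Fin L → ℝ}
    {x : Fin L → Fin 5 → ℝ} (hμ : ∀ l, ι l ≠ 0 → muVec c (x l) ≠ 0)
    (hC : IsUnit (∑ l, projMat c (ι l) (x l))) (hgeo : ∀ l, IsSingleBounce c pT pR (x l))
    {α : Type*} {𝓛 : Filter α} {y : α → Fin L → Fin 5 → ℝ} (hy : Tendsto y 𝓛 (𝓝 x)) {g : α → ℝ}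
    {δ : α → Fin L → Fin 5 → ℝ} (hyg : (fun a => y a - x) =O[𝓛] g)
    (hδ : (fun a => y a - x - δ a) =o[𝓛] g) :
    (fun a => posEst c pT ι (y a) - pR - (∑ l, projMat c (ι l) (x l))⁻¹ *ᵥ
      ∑ l, pathResidualDeriv c (ι l) pT pR (x l) (δ a l)) =o[𝓛] g := by
  choose D hD hD' using fun l => exists_hasFDerivAt_pathResidual c (ι l) pT pR (x l) (hμ l)
  -- `q` is the residual of the normal equations at `p_R`, and the position error is the inverse of
  -- `∑ C` applied to `q`. As `q x = 0`, the change of the inverse multiplies a quantity already of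
  -- order `g`.
  set q : (Fin L → Fin 5 → ℝ) → Fin 3 → ℝ := fun z =>
    ∑ l, projMat c (ι l) (z l) *ᵥ (deltaVec c pT (z l) - pR) with hq
  have hq0 : q x = 0 :=
    Finset.sum_eq_zero fun l _ => (hgeo l).projMat_mulVec_eq_zero (hμ l)
  have hqD : HasFDerivAt q
      (∑ l, (D l).comp (ContinuousLinearMap.proj l : (Fin L → Fin 5 → ℝ) →L[ℝ] (Fin 5 → ℝ))) x :=
    HasFDerivAt.fun_sum fun l _ => by
      have hl : HasFDerivAt (fun z : Fin L → Fin 5 → ℝ => z l) (ContinuousLinearMap.proj l) x :=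
        hasFDerivAt_apply (𝕜 := ℝ) l x
      exact HasFDerivAt.comp (f := fun z : Fin L → Fin 5 → ℝ => z l)
        (g := fun y => projMat c (ι l) y *ᵥ (deltaVec c pT y - pR)) x (hD l) hl
  set D₀ := ∑ l, (D l).comp (ContinuousLinearMap.proj l : (Fin L → Fin 5 → ℝ) →L[ℝ] (Fin 5 → ℝ))
    with hD₀
  have hD₀' : ∀ v, D₀ v = ∑ l, pathResidualDeriv c (ι l) pT pR (x l) (v l) := by
    intro v
    rw [hD₀, _root_.sum_apply]
    exact Finset.sum_congr rfl fun l _ => hD' l _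
  have hqo : (fun a => q (y a) - D₀ (δ a)) =o[𝓛] g := by
    have h1 : (fun a => q (y a) - q x - D₀ (y a - x)) =o[𝓛] fun a => y a - x :=
      hqD.isLittleO.comp_tendsto hy
    have h2 : (fun a => D₀ (y a - x - δ a)) =o[𝓛] g :=
      (D₀.isBigO_comp _ _).trans_isLittleO hδ
    refine ((h1.trans_isBigO hyg).add h2).congr_left fun a => ?_
    rw [hq0, D₀.map_sub (y a - x)]
    abel
  have hqO : (fun a => q (y a)) =O[𝓛] g := by
    have h2 : (fun a => q (y a) - q x) =O[𝓛] fun a => y a - x :=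
      hqD.isBigO_sub.comp_tendsto hy
    simpa only [hq0, sub_zero] using h2.trans hyg
  have hS : Tendsto (fun a => ∑ l, projMat c (ι l) (y a l)) 𝓛 (𝓝 (∑ l, projMat c (ι l) (x l))) :=
    tendsto_finsetSum _ fun l _ => tendsto_projMat (hμ l) (tendsto_pi_nhds.1 hy l)
  have hSinv := tendsto_matrix_inv hS hC
  have hform : ∀ᶠ a in 𝓛, (∑ l, projMat c (ι l) (y a l))⁻¹ *ᵥ q (y a) = posEst c pT ι (y a) - pR := by
    filter_upwards [eventually_isUnit_of_tendsto hS hC] with a ha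
    have h1 : q (y a) = ∑ l, projMat c (ι l) (y a l) *ᵥ deltaVec c pT (y a l) -
        (∑ l, projMat c (ι l) (y a l)) *ᵥ pR := by
      rw [hq, sum_mulVec, ← Finset.sum_sub_distrib]
      exact Finset.sum_congr rfl fun l _ => mulVec_sub _ _ _
    rw [h1, mulVec_sub, mulVec_mulVec, nonsing_inv_mul _ ((isUnit_iff_isUnit_det _).1 ha),
      one_mulVec, posEst]
  have hmain : (fun a => (∑ l, projMat c (ι l) (y a l))⁻¹ *ᵥ q (y a) -
      (∑ l, projMat c (ι l) (x l))⁻¹ *ᵥ D₀ (δ a)) =o[𝓛] g := by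
    refine isLittleO_pi.2 fun i => ?_
    have h1 : ∀ j, (fun a => ((∑ l, projMat c (ι l) (y a l))⁻¹ i j -
        (∑ l, projMat c (ι l) (x l))⁻¹ i j) * q (y a) j) =o[𝓛] g := by
      intro j
      have h2 : (fun a => (∑ l, projMat c (ι l) (y a l))⁻¹ i j -
          (∑ l, projMat c (ι l) (x l))⁻¹ i j) =o[𝓛] fun _ => (1 : ℝ) := by
        rw [isLittleO_one_iff]
        simpa using (tendsto_pi_nhds.1 (tendsto_pi_nhds.1 hSinv i) j).sub_const
          ((∑ l, projMat c (ι l) (x l))⁻¹ i j)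
      simpa only [one_mul] using h2.mul_isBigO (isBigO_pi.1 hqO j)
    have h3 : ∀ j, (fun a => (∑ l, projMat c (ι l) (x l))⁻¹ i j * (q (y a) - D₀ (δ a)) j)
        =o[𝓛] g := fun j => (isLittleO_pi.1 hqo j).const_mul_left _
    refine ((IsLittleO.fun_sum fun j (_ : j ∈ Finset.univ) => h1 j).add
      (IsLittleO.fun_sum fun j (_ : j ∈ Finset.univ) => h3 j)).congr_left fun a => ?_
    rw [← Finset.sum_add_distrib, Pi.sub_apply, mulVec, mulVec, dotProduct, dotProduct,
      ← Finset.sum_sub_distrib]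
    refine Finset.sum_congr rfl fun j _ => ?_
    rw [Pi.sub_apply]; ring
  refine hmain.congr' ?_ EventuallyEq.rfl
  filter_upwards [hform] with a ha
  rw [ha, hD₀']

end Position

namespace Beamspace

open Asymptotics

variable {L : ℕ}

/-! ### Matching `Ψ` with the derivative of the position estimate -/

section FirstOrderCoefficients

theorem im_map_ofReal_mulVec {m n : Type*} [Fintype n] (A : Matrix m n ℝ) (w : n → ℂ) (i : m) :
    ((A.map Complex.ofReal *ᵥ w) i).im = (A *ᵥ fun j => (w j).im) i := by
  simp only [mulVec, dotProduct, map_apply, Complex.im_sum, Complex.im_ofReal_mul]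

theorem im_star_kappa_dotProduct (S : Model L) (l : Fin L) (h : Idx S → ℂ) :
    (fun i => (star (kappa S l i) ⬝ᵥ h).im) =
      angFreqJacInv S.Δf (S.x l) fun n => (star (upsilon S l n) ⬝ᵥ h).im := by
  have hre : ∀ (r : ℝ) (u : Idx S → ℂ), (star ((r : ℂ) • u) ⬝ᵥ h).im = r * (star u ⬝ᵥ h).im := by
    intro r u
    rw [star_smul, Complex.star_def, Complex.conj_ofReal, smul_dotProduct, smul_eq_mul,
      Complex.im_ofReal_mul]
  ext i
  fin_cases i
  · change (star (_ • _ + _ • _) ⬝ᵥ h).im = _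
    rw [star_add, add_dotProduct, Complex.add_im, hre, hre]; rfl
  · change (star (-(_ • _)) ⬝ᵥ h).im = _
    rw [star_neg, neg_dotProduct, Complex.neg_im, hre]; rfl
  · change (star (_ • _ + _ • _) ⬝ᵥ h).im = _
    rw [star_add, add_dotProduct, Complex.add_im, hre, hre]; rfl
  · change (star (-(_ • _)) ⬝ᵥ h).im = _
    rw [star_neg, neg_dotProduct, Complex.neg_im, hre]; rfl
  · change (star (-(_ • _)) ⬝ᵥ h).im = _
    rw [star_neg, neg_dotProduct, Complex.neg_im, hre]; rfl

/-- `D̆_l` and `Ĕ_l` are real, so taking imaginary parts commutes with them and acts only on the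
forms `κᴴ h`. -/
theorem im_Psi_mulVec (S : Model L) (h : Idx S → ℂ) :
    (fun i => ((Psi S *ᵥ h) i).im) = (sumC S)⁻¹ *ᵥ
      ∑ l, pathResidualDeriv S.c (S.ι l) S.pT S.pR (S.x l) fun i => (star (kappa S l i) ⬝ᵥ h).im := by
  have h3 : ∀ l, (fun j => ((kappaH3 S l *ᵥ h) j).im) =
      ![(star (kappa S l 2) ⬝ᵥ h).im, (star (kappa S l 3) ⬝ᵥ h).im,
        (star (kappa S l 4) ⬝ᵥ h).im] := by
    intro l; ext j; fin_cases j <;> rfl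
  have h5 : ∀ l, (fun j => ((kappaH5 S l *ᵥ h) j).im) = fun i => (star (kappa S l i) ⬝ᵥ h).im :=
    fun l => rfl
  ext i
  rw [Psi, sum_mulVec, Finset.sum_apply, Complex.im_sum, mulVec_sum, Finset.sum_apply]
  refine Finset.sum_congr rfl fun l _ => ?_
  rw [add_mulVec, Pi.add_apply, Complex.add_im, ← mulVec_mulVec, ← mulVec_mulVec,
    im_map_ofReal_mulVec, im_map_ofReal_mulVec, h3, h5, pathResidualDeriv, mulVec_add, mulVec_smul,
    mulVec_smul, mulVec_mulVec, mulVec_mulVec, breveD, breveE, smul_mulVec, smul_mulVec,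
    Matrix.mul_assoc, Matrix.mul_assoc]
  rfl

end FirstOrderCoefficients

/-! ### Uniform bounds over all joint diagonalizations -/

section Diagonalization

theorem norm_Phi (S : Model L) (l : Fin L) (n : Fin 5) : ‖Phi S l n‖ = 1 := by
  rw [Phi, mul_comm, Complex.norm_exp_ofReal_mul_I]

theorem Phi_ne_zero (S : Model L) (l : Fin L) (n : Fin 5) : Phi S l n ≠ 0 := Complex.exp_ne_zero _

/-- Perturbation bounds for all joint diagonalizations. -/
theorem diagonalization_bounds (S : Model L)
    (hβ : Function.Injective fun l => ∑ n, S.β n * Phi S l n)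
    {α : Type*} {𝓛 : Filter α} {g : α → ℝ} (hg : Tendsto g 𝓛 (𝓝 0))
    {Λ : Fin 5 → α → Matrix (Fin L) (Fin L) ℂ} (hΛ : ∀ n i j, (fun a => Λ n a i j) =O[𝓛] g) :
    ∃ κ : α → ℝ, Tendsto κ 𝓛 (𝓝 0) ∧ ∃ ρ : α → ℝ, ρ =o[𝓛] g ∧
      ∀ᶠ a in 𝓛, ∀ (F : Matrix (Fin L) (Fin L) ℂ) (d : Fin L → ℂ), IsUnit F →
        F⁻¹ * (∑ n, S.β n • (diagonal (fun l => Phi S l n) + Λ n a)) * F = diagonal d →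
        ∀ l, ∃ j, ‖d l - ∑ n, S.β n * Phi S j n‖ ≤ κ a ∧
          (∀ n, ‖(F⁻¹ * (diagonal (fun l => Phi S l n) + Λ n a) * F) l l - Phi S j n‖ ≤ κ a) ∧
          ∀ n, ‖(F⁻¹ * (diagonal (fun l => Phi S l n) + Λ n a) * F) l l - Phi S j n - Λ n a j j‖
            ≤ ρ a := by
  obtain ⟨C, r, hr, hmain⟩ := exists_diagonalization_estimate hβ
  set N : α → Matrix (Fin L) (Fin L) ℂ := fun a => ∑ n, S.β n • Λ n a with hN
  have hNO : ∀ i j, (fun a => N a i j) =O[𝓛] g := by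
    intro i j
    simp only [hN, Matrix.sum_apply, Matrix.smul_apply, smul_eq_mul]
    exact IsBigO.fun_sum fun n _ => (hΛ n i j).const_mul_left _
  have hsum : ∀ a, ∑ n, S.β n • (diagonal (fun l => Phi S l n) + Λ n a) =
      diagonal (fun l => ∑ n, S.β n * Phi S l n) + N a := by
    intro a
    simp only [smul_add, Finset.sum_add_distrib, hN]
    congr 1
    ext i j
    rw [Matrix.sum_apply]
    by_cases hij : i = j
    · subst hij; simp
    · simp [hij]
  -- A single bound for the perturbation of the diagonalized combination and for those of all five
  -- modes, so that one index `j` serves every mode.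
  set ν : α → ℝ := fun a => ∑ i, ∑ j, ‖N a i j‖ + ∑ n, ∑ i, ∑ j, ‖Λ n a i j‖ with hν
  have hνO : ν =O[𝓛] g :=
    (IsBigO.fun_sum fun i _ => IsBigO.fun_sum fun j _ => (hNO i j).norm_left).add
      (IsBigO.fun_sum fun n _ => IsBigO.fun_sum fun i _ => IsBigO.fun_sum fun j _ =>
        (hΛ n i j).norm_left)
  have hν0 : Tendsto ν 𝓛 (𝓝 0) := hνO.trans_tendsto hg
  have hentry : ∀ (A : Matrix (Fin L) (Fin L) ℂ) i j, ‖A i j‖ ≤ ∑ i, ∑ j, ‖A i j‖ := fun A i j =>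
    (Finset.single_le_sum (f := fun j => ‖A i j‖) (fun j _ => norm_nonneg _)
      (Finset.mem_univ j)).trans
    (Finset.single_le_sum (f := fun i => ∑ j, ‖A i j‖)
      (fun i _ => Finset.sum_nonneg fun j _ => norm_nonneg _) (Finset.mem_univ i))
  have hpos : ∀ A : Matrix (Fin L) (Fin L) ℂ, 0 ≤ ∑ i, ∑ j, ‖A i j‖ := fun A =>
    Finset.sum_nonneg fun i _ => Finset.sum_nonneg fun j _ => norm_nonneg _
  have hNν : ∀ a i j, ‖N a i j‖ ≤ ν a := fun a i j =>
    (hentry _ i j).trans (le_add_of_nonneg_right (Finset.sum_nonneg fun n _ => hpos _))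
  have hΛν : ∀ n a i j, ‖Λ n a i j‖ ≤ ν a := fun n a i j =>
    ((hentry _ i j).trans (Finset.single_le_sum (f := fun n => ∑ i, ∑ j, ‖Λ n a i j‖)
      (fun n _ => hpos _) (Finset.mem_univ n))).trans (le_add_of_nonneg_left (hpos _))
  have hνnn : ∀ a, 0 ≤ ν a := fun a => add_nonneg (hpos _) (Finset.sum_nonneg fun n _ => hpos _)
  refine ⟨fun a => |C| * ν a + (|C| * ν a ^ 2 + ν a), ?_, fun a => C * ν a ^ 2, ?_, ?_⟩
  · have h1 := (hν0.const_mul |C|).add (((hν0.pow 2).const_mul |C|).add hν0)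
    simpa using h1
  · refine IsLittleO.const_mul_left ?_ C
    have : (fun a => ν a * ν a) =o[𝓛] fun a => (1 : ℝ) * g a :=
      ((isLittleO_one_iff ℝ).2 hν0).mul_isBigO hνO
    simpa only [one_mul, ← pow_two] using this
  · filter_upwards [hν0.eventually_le_const hr] with a ha F d hF hFd l
    rw [hsum] at hFd
    obtain ⟨j, hj1, hj2⟩ := hmain (ν a) (N a) F d (hνnn a) ha (hNν a) hF hFd l
    have hj3 : ∀ n, _ := fun n =>
      hj2 (fun l => Phi S l n) (Λ n a) (fun i => (norm_Phi S i n).le) (hΛν n a)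
    have hC1 : C * ν a ≤ |C| * ν a := mul_le_mul_of_nonneg_right (le_abs_self C) (hνnn a)
    have hC2 : C * ν a ^ 2 ≤ |C| * ν a ^ 2 := mul_le_mul_of_nonneg_right (le_abs_self C) (sq_nonneg _)
    have hC3 : 0 ≤ |C| * ν a := mul_nonneg (abs_nonneg C) (hνnn a)
    have hC4 : 0 ≤ |C| * ν a ^ 2 := mul_nonneg (abs_nonneg C) (sq_nonneg _)
    refine ⟨j, ?_, fun n => ?_, fun n => ?_⟩
    · linarith [hνnn a]
    · calc _ = ‖((F⁻¹ * (diagonal (fun l => Phi S l n) + Λ n a) * F) l l -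
            (Phi S j n + Λ n a j j)) + Λ n a j j‖ := by congr 1; ring
        _ ≤ C * ν a ^ 2 + ν a := (norm_add_le _ _).trans (add_le_add (hj3 n) (hΛν n a j j))
        _ ≤ _ := by linarith
    · rw [sub_sub]; exact hj3 n

theorem inv_mul_conj_mul {R E A : Matrix (Fin L) (Fin L) ℂ} (hR : IsUnit R) :
    E⁻¹ * (R * A * R⁻¹) * E = (R⁻¹ * E)⁻¹ * A * (R⁻¹ * E) := by
  rw [Matrix.mul_inv_rev, nonsing_inv_nonsing_inv _ ((isUnit_iff_isUnit_det _).1 hR)]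
  simp only [Matrix.mul_assoc]

end Diagonalization

/-! ### Recovering path parameters from angular frequencies -/

section LocalParametrization

/-- The parameters are determined by the angular frequencies, with first-order expansion. -/
theorem angFreq_inverse_expansion {Δf : ℝ} (hΔf : Δf ≠ 0) {x : Fin 5 → ℝ}
    (hφ : Real.cos (x 0) ≠ 0 ∧ Real.sin (x 1) ≠ 0) (hθ : Real.cos (x 2) ≠ 0 ∧ Real.sin (x 3) ≠ 0) :
    (fun y => y - x) =O[𝓝 x] (fun y => angFreq Δf y - angFreq Δf x) ∧
    (fun y => y - x - angFreqJacInv Δf x (angFreq Δf y - angFreq Δf x)) =o[𝓝 x] fun y => y - x := by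
  set e := angFreqJacEquiv hΔf hφ hθ with he
  have h := (hasStrictFDerivAt_angFreq hΔf hφ hθ).hasFDerivAt
  have h0 : (fun y => y - x) =O[𝓝 x] fun y => e (y - x) := by
    simpa using (e.symm : (Fin 5 → ℝ) →L[ℝ] (Fin 5 → ℝ)).isBigO_comp (fun y => e (y - x)) (𝓝 x)
  have h0' : (fun y => angFreq Δf y - angFreq Δf x - e (y - x)) =o[𝓝 x] fun y => e (y - x) :=
    h.isLittleO.trans_isBigO h0
  refine ⟨h0.trans (h0'.right_isBigO_add.congr_right fun y => by simp), ?_⟩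
  have h1 := (e.symm : (Fin 5 → ℝ) →L[ℝ] (Fin 5 → ℝ)).isBigO_comp
    (fun y => angFreq Δf y - angFreq Δf x - e (y - x)) (𝓝 x)
  refine (h1.trans_isLittleO h.isLittleO).neg_left.congr_left fun y => ?_
  have h2 : e.symm (angFreq Δf y - angFreq Δf x) =
    angFreqJacInv Δf x (angFreq Δf y - angFreq Δf x) := rfl
  rw [← h2]
  simp

theorem angFreq_image_mem_nhds {Δf : ℝ} (hΔf : Δf ≠ 0) {x : Fin 5 → ℝ}
    (hφ : Real.cos (x 0) ≠ 0 ∧ Real.sin (x 1) ≠ 0) (hθ : Real.cos (x 2) ≠ 0 ∧ Real.sin (x 3) ≠ 0)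
    {V : Set (Fin 5 → ℝ)} (hV : V ∈ 𝓝 x) : angFreq Δf '' V ∈ 𝓝 (angFreq Δf x) := by
  have h := (hasStrictFDerivAt_angFreq hΔf hφ hθ).map_nhds_eq_of_equiv
  rw [← h]
  exact image_mem_map hV

theorem continuous_angFreq (Δf : ℝ) : Continuous (angFreq Δf) := by
  refine continuous_pi fun i => ?_
  fin_cases i
  · change Continuous fun x : Fin 5 → ℝ => Real.pi * Real.sin (x 0) * Real.sin (x 1); fun_prop
  · change Continuous fun x : Fin 5 → ℝ => Real.pi * Real.cos (x 1); fun_prop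
  · change Continuous fun x : Fin 5 → ℝ => Real.pi * Real.sin (x 2) * Real.sin (x 3); fun_prop
  · change Continuous fun x : Fin 5 → ℝ => Real.pi * Real.cos (x 3); fun_prop
  · change Continuous fun x : Fin 5 → ℝ => -(2 * Real.pi * Δf * x 4); fun_prop

end LocalParametrization

/-! ### Phases and the branch of the logarithm -/

section Phase

/-- Projecting `w` radially onto the unit circle moves it by `|1 - ‖w‖|`, at most `‖w - φ‖` because
`‖φ‖ = 1`. -/
theorem norm_phase_sub_le {z w φ : ℂ} (hφ : ‖φ‖ = 1) (hz : Complex.exp z = w) :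
    ‖Complex.exp (Complex.I * (z.im : ℂ)) - φ‖ ≤ 2 * ‖w - φ‖ := by
  have h1 : w = (Real.exp z.re : ℂ) * Complex.exp (Complex.I * (z.im : ℂ)) := by
    rw [← hz, Complex.ofReal_exp, ← Complex.exp_add, mul_comm Complex.I, Complex.re_add_im]
  have h2 : ‖Complex.exp (Complex.I * (z.im : ℂ))‖ = 1 := by
    rw [mul_comm, Complex.norm_exp_ofReal_mul_I]
  have h3 : ‖w‖ = Real.exp z.re := by rw [← hz, Complex.norm_exp]
  have h4 : ‖Complex.exp (Complex.I * (z.im : ℂ)) - w‖ = |‖φ‖ - ‖w‖| := by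
    have : Complex.exp (Complex.I * (z.im : ℂ)) - w =
        ((1 - Real.exp z.re : ℝ) : ℂ) * Complex.exp (Complex.I * (z.im : ℂ)) := by
      conv_lhs => rw [h1]
      push_cast; ring
    rw [this, norm_mul, h2, mul_one, Complex.norm_real, Real.norm_eq_abs, hφ, h3]
  calc ‖Complex.exp (Complex.I * (z.im : ℂ)) - φ‖
      ≤ ‖Complex.exp (Complex.I * (z.im : ℂ)) - w‖ + ‖w - φ‖ := norm_sub_le_norm_sub_add_norm_sub _ _ _
    _ ≤ ‖w - φ‖ + ‖w - φ‖ := by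
        rw [h4, abs_sub_comm]
        gcongr
        exact abs_norm_sub_norm_le w φ
    _ = _ := by ring

/-- An imaginary part within `1 < π` of `ω` leaves no freedom in the branch: after division by
`exp(iω)` it is the principal one. -/
theorem im_sub_eq_im_log {z w : ℂ} {ω : ℝ} (hz : Complex.exp z = w) (h : |z.im - ω| < 1) :
    z.im - ω = (Complex.log (w / Complex.exp (Complex.I * (ω : ℂ)))).im := by
  have h0 : (z - Complex.I * (ω : ℂ)).im = z.im - ω := by simp
  have hpi := Real.pi_gt_three
  rw [abs_lt] at h
  rw [← hz, ← Complex.exp_sub, Complex.log_exp, h0]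
  · rw [h0]; linarith
  · rw [h0]; linarith

theorem im_log_expansion {α : Type*} {𝓛 : Filter α} {g : α → ℝ} (hg : Tendsto g 𝓛 (𝓝 0))
    {w : α → ℂ} {φ : ℂ} (hφ : φ ≠ 0) {u : α → ℂ} (hu : u =O[𝓛] g)
    (hw : (fun a => w a - φ - u a) =o[𝓛] g) :
    (fun a => (Complex.log (w a / φ)).im - (u a / φ).im) =o[𝓛] g := by
  have hO : (fun a => w a - φ) =O[𝓛] g :=
    (hw.isBigO.add hu).congr_left fun a => by ring
  have hO' : (fun a => w a / φ - 1) =O[𝓛] g := by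
    refine (hO.const_mul_left φ⁻¹).congr_left fun a => ?_
    field_simp
  have ht : Tendsto (fun a => w a / φ) 𝓛 (𝓝 1) := by
    simpa using (hO'.trans_tendsto hg).add_const 1
  have hlog : HasDerivAt Complex.log 1 1 := by
    simpa using Complex.hasDerivAt_log Complex.one_mem_slitPlane
  have h1 : (fun a => Complex.log (w a / φ) - Complex.log 1 - (w a / φ - 1) • (1 : ℂ)) =o[𝓛]
      fun a => w a / φ - 1 := hlog.isLittleO.comp_tendsto ht
  have h2 : (fun a => Complex.log (w a / φ) - u a / φ) =o[𝓛] g := by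
    refine ((h1.trans_isBigO hO').add (hw.const_mul_left φ⁻¹)).congr_left fun a => ?_
    rw [Complex.log_one, smul_eq_mul]
    field_simp
    ring
  refine IsBigO.trans_isLittleO (g := fun a => ‖Complex.log (w a / φ) - u a / φ‖)
    (IsBigO.of_norm_le fun a => ?_) h2.norm_left
  rw [← Complex.sub_im, Real.norm_eq_abs]
  exact Complex.abs_im_le_norm _

/-- A positive lower bound that also covers an empty index type, as for pairs of distinct paths when
`L ≤ 1`. -/
theorem exists_pos_forall_le {ι : Type*} [Finite ι] {f : ι → ℝ} (hf : ∀ i, 0 < f i) :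
    ∃ ε > 0, ∀ i, ε ≤ f i := by
  have h : ∀ i, ∀ᶠ t in 𝓝[>] (0 : ℝ), t ≤ f i := fun i => by
    filter_upwards [Ioc_mem_nhdsGT (hf i)] with t ht using ht.2
  obtain ⟨t, ht, ht'⟩ := ((eventually_all.2 h).and self_mem_nhdsWithin).exists
  exact ⟨t, ht', ht⟩

end Phase

/-! ### Existence and expansion of parameter estimates -/

section Estimator

/-- The first-order change of the phase of `Φ_{l,n}`. -/
theorem star_upsilon_dotProduct (S : Model L) (l : Fin L) (n : Fin 5) (h : Idx S → ℂ) :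
    star (upsilon S l n) ⬝ᵥ h = star (xi S l n) ⬝ᵥ h / S.γ l / Phi S l n := by
  -- `Φ` is unimodular, so the conjugated factor in `υ` is a division by `Φ`, as in the derivative
  -- of the logarithm.
  have h1 : star (Phi S l n) = (Phi S l n)⁻¹ := by
    rw [Complex.star_def, Complex.inv_def, Complex.normSq_eq_norm_sq, norm_Phi]
    simp
  rw [upsilon, star_smul, star_div₀, star_star, h1, smul_dotProduct, smul_eq_mul]
  ring

theorem dotProduct_isBigO {ι α : Type*} [Fintype ι] {𝓛 : Filter α} (u : ι → ℂ) (h : α → ι → ℂ) :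
    (fun a => u ⬝ᵥ h a) =O[𝓛] fun a => ‖h a‖ := by
  simp only [dotProduct]
  refine IsBigO.fun_sum fun i _ => IsBigO.const_mul_left ?_ _
  exact IsBigO.of_bound' (Eventually.of_forall fun a => by
    rw [norm_norm]; exact norm_le_pi_norm (h a) i)

theorem gam_conj_eq (S : Model L) {U : Matrix (SIdx S) (Fin L) ℂ}
    {R E : Matrix (Fin L) (Fin L) ℂ} {A : Fin 5 → Matrix (Fin L) (Fin L) ℂ} (hR : IsUnit R)
    (hG : ∀ n, Gam S U n = R * A n * R⁻¹) :
    (∀ n, E⁻¹ * Gam S U n * E = (R⁻¹ * E)⁻¹ * A n * (R⁻¹ * E)) ∧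
    E⁻¹ * (∑ n, S.β n • Gam S U n) * E =
      (R⁻¹ * E)⁻¹ * (∑ n, S.β n • A n) * (R⁻¹ * E) := by
  have h1 : ∀ n, E⁻¹ * Gam S U n * E = (R⁻¹ * E)⁻¹ * A n * (R⁻¹ * E) := fun n => by
    rw [hG, inv_mul_conj_mul hR]
  refine ⟨h1, ?_⟩
  simp only [Matrix.mul_sum, Matrix.sum_mul, Matrix.mul_smul, Matrix.smul_mul, h1]

theorem tendsto_smooth_channel (S : Model L) :
    Tendsto (fun Δh => smooth S (channel S + Δh)) (𝓝 0) (𝓝 (smooth S (channel S))) := by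
  refine tendsto_matrix_of_entries fun i j => ?_
  simp only [smooth_add, Matrix.add_apply]
  have hc : Continuous fun Δh : Idx S → ℂ => smooth S Δh i j := continuous_apply _
  have := (hc.tendsto 0).const_add (smooth S (channel S) i j)
  rwa [show smooth S 0 i j = 0 from rfl, add_zero] at this

/-- The `L × L` matrix `pinv P * H * X` tends to the identity. Once it is invertible, `H` has rank
at least `L`. -/
theorem eventually_exists_isLeadingLeftSingular (S : Model L) (hγ : ∀ l, S.γ l ≠ 0)
    (hG : LinearIndependent ℂ (G S).col) (hP : IsUnit ((P S)ᴴ * P S)) :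
    ∀ᶠ Δh in 𝓝 (0 : Idx S → ℂ), ∃ U : Matrix (SIdx S) (Fin L) ℂ,
      IsLeadingLeftSingular (smooth S (channel S + Δh)) U := by
  have hc : Continuous fun H : Matrix (SIdx S) (Fin S.L5) ℂ => pinv (P S) * (H * snapshotInverse S) :=
    continuous_const.matrix_mul (continuous_id.matrix_mul continuous_const)
  have h1 := (hc.tendsto _).comp (tendsto_smooth_channel S)
  rw [smooth_channel, channel_mul_snapshotInverse S hγ hG, pinv_mul_self_of_isUnit hP] at h1
  filter_upwards [eventually_isUnit_of_tendsto h1 isUnit_one] with Δh hΔh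
  refine exists_isLeadingLeftSingular ?_
  have h2 := rank_of_isUnit _ hΔh
  rw [Fintype.card_fin] at h2
  calc L = _ := h2.symm
    _ ≤ _ := rank_mul_le_right _ _
    _ ≤ _ := rank_mul_le_left _ _

/-- Parameter estimates exist in every neighbourhood of the true parameters. -/
theorem eventually_exists_isParamEstimate (S : Model L) (hΔf : S.Δf ≠ 0)
    (hshift : ∀ n, HasShiftInvariance (S.T n) (S.F n))
    (hQ : ∀ n, RestoresShiftInvariance (S.T n) (S.F n) (S.Q n))
    (hγ : ∀ l, S.γ l ≠ 0) (hG : LinearIndependent ℂ (G S).col)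
    (hJ : ∀ n, LinearIndependent ℂ (J1 S n * P S).col)
    (hJ5 : LinearIndependent ℂ (J1freq S * P S).col)
    (hβ : Function.Injective fun l => ∑ n, S.β n * Phi S l n)
    (hφ : ∀ l, Real.cos (S.x l 0) ≠ 0 ∧ Real.sin (S.x l 1) ≠ 0)
    (hθ : ∀ l, Real.cos (S.x l 2) ≠ 0 ∧ Real.sin (S.x l 3) ≠ 0)
    {V : Set (Fin L → Fin 5 → ℝ)} (hV : V ∈ 𝓝 S.x) :
    ∀ᶠ Δh in 𝓝 (0 : Idx S → ℂ), ∃ y ∈ V, IsParamEstimate S (channel S + Δh) y := by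
  -- Pairs of an error and admissible singular vectors, filtered by the error alone: eventual
  -- statements are then uniform in the singular vectors.
  let α := {p : (Idx S → ℂ) × Matrix (SIdx S) (Fin L) ℂ //
    IsLeadingLeftSingular (smooth S (channel S + p.1)) p.2}
  let 𝓛 : Filter α := comap (fun a => a.1.1) (𝓝 0)
  have hΔ : Tendsto (fun a : α => a.1.1) 𝓛 (𝓝 0) := tendsto_comap
  have hg : Tendsto (fun a : α => ‖a.1.1‖) 𝓛 (𝓝 0) := by simpa using hΔ.norm
  suffices h : ∀ᶠ a in 𝓛, ∃ y ∈ V, IsParamEstimate S (channel S + a.1.1) y by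
    filter_upwards [eventually_comap.1 h,
      eventually_exists_isLeadingLeftSingular S hγ hG (isUnit_P S hJ5)] with Δh h1 ⟨U, hU⟩
    exact h1 ⟨(Δh, U), hU⟩ rfl
  obtain ⟨R, Λ, hR, hΛO, -⟩ := gam_expansion S hshift hQ hγ hG hJ hJ5 hΔ (fun a => a.2)
  obtain ⟨κ, hκ, _, _, hbound⟩ := diagonalization_bounds S hβ hg hΛO
  obtain ⟨gap, hgap0, hgap⟩ : ∃ gap > 0, ∀ p : {p : Fin L × Fin L // p.1 ≠ p.2},
      gap ≤ ‖(∑ n, S.β n * Phi S p.1.1 n) - ∑ n, S.β n * Phi S p.1.2 n‖ :=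
    exists_pos_forall_le fun p => norm_pos_iff.2 (sub_ne_zero.2 (hβ.ne p.2))
  obtain ⟨ρ, hρ, hball⟩ := Metric.mem_nhds_iff.1 hV
  have himg : ∀ l, ∃ r > 0, Metric.ball (angFreq S.Δf (S.x l)) r ⊆
      angFreq S.Δf '' Metric.ball (S.x l) ρ := fun l =>
    Metric.mem_nhds_iff.1
      (angFreq_image_mem_nhds hΔf (hφ l) (hθ l) (Metric.ball_mem_nhds _ hρ))
  choose r' hr' hsub using himg
  obtain ⟨r, hr, hrr⟩ := exists_pos_forall_le hr'
  obtain ⟨s, hs, hlog⟩ : ∃ s > 0, ∀ v : ℂ, ‖v - 1‖ < s → v ≠ 0 ∧ |(Complex.log v).im| < r := by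
    have hc : ContinuousAt (fun v => |(Complex.log v).im|) 1 :=
      (Complex.continuous_im.continuousAt.comp (continuousAt_clog (by simp))).abs
    have h1 : ∀ᶠ v in 𝓝 (1 : ℂ), v ≠ 0 ∧ |(Complex.log v).im| < r :=
      (eventually_ne_nhds one_ne_zero).and (hc.eventually_lt_const (by simpa using hr))
    obtain ⟨s, hs, h2⟩ := Metric.eventually_nhds_iff.1 h1
    exact ⟨s, hs, fun v hv => h2 (by rwa [dist_eq_norm])⟩
  have hM : Tendsto (fun a => ∑ n, S.β n • (diagonal (fun l => Phi S l n) + Λ n a)) 𝓛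
      (𝓝 (diagonal fun l => ∑ n, S.β n * Phi S l n)) := by
    have h0 : diagonal (fun l => ∑ n, S.β n * Phi S l n) =
        ∑ n, S.β n • (diagonal (fun l => Phi S l n) + 0) := by
      ext i j
      rw [Matrix.sum_apply]
      by_cases hij : i = j
      · subst hij; simp
      · simp [hij]
    rw [h0]
    refine tendsto_finsetSum _ fun n _ => (tendsto_const_nhds.add ?_).const_smul _
    exact tendsto_matrix_of_entries fun i j => (hΛO n i j).trans_tendsto hg
  filter_upwards [hR, hbound, hκ.eventually_lt_const hs,
    hκ.eventually_lt_const (half_pos hgap0),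
    hM.eventually (eventually_exists_diagonalization hβ (half_pos hgap0))]
    with a ⟨haR, haG⟩ hab has hag ⟨F, d, hF, hFd, hd⟩
  have hdetR := (isUnit_iff_isUnit_det _).1 haR
  have hRF : (R a)⁻¹ * (R a * F) = F := by
    rw [← Matrix.mul_assoc, nonsing_inv_mul _ hdetR, Matrix.one_mul]
  obtain ⟨hconj, hconj'⟩ := gam_conj_eq S (E := R a * F) haR haG
  rw [hRF] at hconj hconj'
  have hclose : ∀ l n, ‖((R a * F)⁻¹ * Gam S a.1.2 n * (R a * F)) l l - Phi S l n‖ ≤ κ a := by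
    intro l
    obtain ⟨j, hj1, hj2, -⟩ := hab F d hF hFd l
    -- The eigenvalue `d l` is closer than `gap / 2` both to the combination of path `j` and to that
    -- of path `l`, so the ordering of the eigenvectors is the true one.
    have hjl : j = l := by
      by_contra hne
      have h1 := hgap ⟨(j, l), hne⟩
      have h2 : ‖(∑ n, S.β n * Phi S j n) - ∑ n, S.β n * Phi S l n‖ ≤
          ‖d l - ∑ n, S.β n * Phi S j n‖ + ‖d l - ∑ n, S.β n * Phi S l n‖ := by
        rw [norm_sub_rev (d l)]
        exact norm_sub_le_norm_sub_add_norm_sub _ _ _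
      have h3 := hd l
      simp only at h1 h3
      linarith
    subst hjl
    intro n
    rw [hconj]
    exact hj2 n
  set w : Fin L → Fin 5 → ℂ := fun l n => ((R a * F)⁻¹ * Gam S a.1.2 n * (R a * F)) l l with hw
  have hwΦ : ∀ l n, ‖w l n / Phi S l n - 1‖ < s := by
    intro l n
    rw [div_sub_one (Phi_ne_zero S l n), norm_div, norm_Phi, div_one]
    exact (hclose l n).trans_lt has
  have hfreq : ∀ l, ∃ y ∈ Metric.ball (S.x l) ρ, angFreq S.Δf y =
      fun n => omega S l n + (Complex.log (w l n / Phi S l n)).im := by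
    intro l
    apply hsub l
    rw [mem_ball_iff_norm, pi_norm_lt_iff (hr' l)]
    intro n
    have h1 : omega S l n + (Complex.log (w l n / Phi S l n)).im - angFreq S.Δf (S.x l) n
        = (Complex.log (w l n / Phi S l n)).im := by
      rw [omega]; ring
    rw [Pi.sub_apply, Real.norm_eq_abs, h1]
    exact ((hlog _ (hwΦ l n)).2).trans_le (hrr l)
  choose y hy hyf using hfreq
  refine ⟨y, hball ?_, a.1.2, R a * F, d, a.2, haR.mul hF, ?_, fun l n => ?_⟩
  · rw [Metric.mem_ball, dist_pi_lt_iff hρ]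
    exact fun l => hy l
  · rw [hconj', hFd]
  · refine ⟨Complex.log (w l n / Phi S l n) + Complex.I * (omega S l n : ℂ), ?_, ?_⟩
    · rw [Complex.exp_add, Complex.exp_log (hlog _ (hwΦ l n)).1, ← Phi,
        div_mul_cancel₀ _ (Phi_ne_zero S l n)]
    · rw [hyf]
      simp [add_comm]

/-- First-order expansion of the angular frequencies of parameter estimates close to the true
parameters. -/
theorem isParamEstimate_expansion (S : Model L)
    (hshift : ∀ n, HasShiftInvariance (S.T n) (S.F n))
    (hQ : ∀ n, RestoresShiftInvariance (S.T n) (S.F n) (S.Q n))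
    (hγ : ∀ l, S.γ l ≠ 0) (hG : LinearIndependent ℂ (G S).col)
    (hJ : ∀ n, LinearIndependent ℂ (J1 S n * P S).col)
    (hJ5 : LinearIndependent ℂ (J1freq S * P S).col)
    (hβ : Function.Injective fun l => ∑ n, S.β n * Phi S l n)
    {η : ℝ} (hη : 0 < η) (hsep : ∀ l j, l ≠ j → ∃ n, 2 * η ≤ ‖Phi S l n - Phi S j n‖)
    {α : Type*} {𝓛 : Filter α} {Δh : α → Idx S → ℂ} (hΔ : Tendsto Δh 𝓛 (𝓝 0))
    {y : α → Fin L → Fin 5 → ℝ} (hy : ∀ a, IsParamEstimate S (channel S + Δh a) (y a))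
    (hy1 : ∀ a l n, |angFreq S.Δf (y a l) n - omega S l n| < 1)
    (hyη : ∀ a l n, ‖Complex.exp (Complex.I * (angFreq S.Δf (y a l) n : ℂ)) - Phi S l n‖ < η)
    (l : Fin L) (n : Fin 5) :
    (fun a => angFreq S.Δf (y a l) n - omega S l n - (star (upsilon S l n) ⬝ᵥ Δh a).im)
      =o[𝓛] fun a => ‖Δh a‖ := by
  have hg : Tendsto (fun a => ‖Δh a‖) 𝓛 (𝓝 0) := by simpa using hΔ.norm
  choose U E d hU hE hEd hz using hy
  choose z hz hzy using hz
  obtain ⟨R, Λ, hR, hΛO, hΛo⟩ := gam_expansion S hshift hQ hγ hG hJ hJ5 hΔ hU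
  obtain ⟨κ, hκ, ρ, hρ, hbound⟩ := diagonalization_bounds S hβ hg hΛO
  set w : α → ℂ := fun a => ((E a)⁻¹ * Gam S (U a) n * E a) l l with hw
  have hwρ : ∀ᶠ a in 𝓛, ‖w a - Phi S l n - Λ n a l l‖ ≤ ρ a := by
    filter_upwards [hR, hbound, hκ.eventually_lt_const (half_pos hη)] with a ⟨haR, haG⟩ hab haκ
    obtain ⟨hconj, hconj'⟩ := gam_conj_eq S (E := E a) haR haG
    have hF : IsUnit ((R a)⁻¹ * E a) := (isUnit_nonsing_inv_iff.2 haR).mul (hE a)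
    obtain ⟨j, -, hj2, hj3⟩ := hab _ (d a) hF (by rw [← hconj', hEd]) l
    -- The phase of the estimate lies within `η` of `Φ_l` by the choice of neighbourhood, and within
    -- `2 κ < η` of `Φ_j`. Two different paths differ by at least `2 η` in some mode.
    have hjl : l = j := by
      by_contra hne
      obtain ⟨n', hn'⟩ := hsep l j hne
      have h1 := norm_phase_sub_le (norm_Phi S j n') (hz a l n')
      rw [← hzy, hconj] at h1
      have h2 := hj2 n'
      have h3 := hyη a l n'
      have h4 : ‖Phi S l n' - Phi S j n'‖ ≤
          ‖Complex.exp (Complex.I * (angFreq S.Δf (y a l) n' : ℂ)) - Phi S l n'‖ +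
          ‖Complex.exp (Complex.I * (angFreq S.Δf (y a l) n' : ℂ)) - Phi S j n'‖ := by
        rw [norm_sub_rev _ (Phi S l n')]
        exact norm_sub_le_norm_sub_add_norm_sub _ _ _
      linarith
    subst hjl
    simp only [hw, hconj]
    exact hj3 n
  have hwo : (fun a => w a - Phi S l n - star (xi S l n) ⬝ᵥ Δh a / S.γ l) =o[𝓛]
      fun a => ‖Δh a‖ := by
    have h1 : (fun a => w a - Phi S l n - Λ n a l l) =o[𝓛] fun a => ‖Δh a‖ := by
      refine IsBigO.trans_isLittleO (IsBigO.of_bound' ?_) hρ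
      filter_upwards [hwρ] with a ha
      exact ha.trans (le_abs_self _)
    exact (h1.add (hΛo n l)).congr_left fun a => by ring
  have hu : (fun a => star (xi S l n) ⬝ᵥ Δh a / S.γ l) =O[𝓛] fun a => ‖Δh a‖ := by
    simp only [div_eq_inv_mul]
    exact (dotProduct_isBigO _ _).const_mul_left _
  refine (im_log_expansion hg (Phi_ne_zero S l n) hu hwo).congr_left fun a => ?_
  rw [star_upsilon_dotProduct, hzy a l n, im_sub_eq_im_log (hz a l n) (by
    rw [← hzy]; exact hy1 a l n)]
  rfl

end Estimator

end Beamspace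

end

/-- The user position error `p̂_R - p_R` equals `Im{Ψ Δh}` up to `o(‖Δh‖)`, where `p̂_R` is computed
from any channel parameter estimates for the observation `h + Δh` that lie in a fixed
neighbourhood `V` of the true parameters; such estimates exist for all small `Δh`. -/
theorem lemma3 {L : ℕ} (S : Beamspace.Model L)
    (hΔf : 0 < S.Δf) (hc : 0 < S.c)
    (hshift : ∀ n, HasShiftInvariance (S.T n) (S.F n))
    (hQ : ∀ n, RestoresShiftInvariance (S.T n) (S.F n) (S.Q n))
    (hγ : ∀ l, S.γ l ≠ 0)
    (hG : LinearIndependent ℂ (Beamspace.G S).col)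
    (hJ : ∀ n, LinearIndependent ℂ (Beamspace.J1 S n * Beamspace.P S).col)
    (hJ5 : LinearIndependent ℂ (Beamspace.J1freq S * Beamspace.P S).col)
    (hβ : Function.Injective fun l => ∑ n, S.β n * Beamspace.Phi S l n)
    (hφ : ∀ l, Real.cos (S.x l 0) ≠ 0 ∧ Real.sin (S.x l 1) ≠ 0)
    (hθ : ∀ l, Real.cos (S.x l 2) ≠ 0 ∧ Real.sin (S.x l 3) ≠ 0)
    (hι : ∀ l, 0 ≤ S.ι l)
    (hμ : ∀ l, S.ι l ≠ 0 → muVec S.c (S.x l) ≠ 0)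
    (hC : IsUnit (Beamspace.sumC S))
    (hgeo : ∀ l, IsSingleBounce S.c S.pT S.pR (S.x l)) :
    ∃ V ∈ 𝓝 S.x,
      (∀ᶠ Δh in 𝓝 (0 : Beamspace.Idx S → ℂ),
        ∃ y ∈ V, Beamspace.IsParamEstimate S (Beamspace.channel S + Δh) y) ∧
      ∀ ε : ℝ, 0 < ε → ∀ᶠ Δh in 𝓝 (0 : Beamspace.Idx S → ℂ),
        ∀ y ∈ V, Beamspace.IsParamEstimate S (Beamspace.channel S + Δh) y →
          ‖posEst S.c S.pT S.ι y - S.pR - fun i => ((Beamspace.Psi S *ᵥ Δh) i).im‖ ≤ ε * ‖Δh‖ := by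
  open Beamspace Asymptotics in
  obtain ⟨η, hη, hsep⟩ : ∃ η > 0, ∀ l j, l ≠ j → ∃ n, 2 * η ≤ ‖Phi S l n - Phi S j n‖ := by
    have h1 : ∀ p : {p : Fin L × Fin L // p.1 ≠ p.2}, ∃ n, 0 < ‖Phi S p.1.1 n - Phi S p.1.2 n‖ := by
      intro p
      by_contra! hcon
      refine p.2 (hβ (Finset.sum_congr rfl fun n _ => ?_))
      rw [sub_eq_zero.1 (norm_le_zero_iff.1 (hcon n))]
    choose n hn using h1
    obtain ⟨ε, hε, h2⟩ := exists_pos_forall_le hn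
    exact ⟨ε / 2, half_pos hε, fun l j hlj => ⟨n ⟨(l, j), hlj⟩, by
      rw [mul_div_cancel₀ _ two_ne_zero]; exact h2 ⟨(l, j), hlj⟩⟩⟩
  have hloc := fun l => angFreq_inverse_expansion hΔf.ne' (hφ l) (hθ l)
  choose K hK using fun l => (hloc l).1.bound
  have hev : ∀ l : Fin L, Tendsto (fun y : Fin L → Fin 5 → ℝ => y l) (𝓝 S.x) (𝓝 (S.x l)) :=
    fun l => (continuous_apply l).tendsto S.x
  have hfreq : ∀ l n, Tendsto (fun y : Fin L → Fin 5 → ℝ => angFreq S.Δf (y l) n) (𝓝 S.x)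
      (𝓝 (omega S l n)) := fun l n =>
    ((continuous_apply n).comp ((continuous_angFreq S.Δf).comp (continuous_apply l))).tendsto S.x
  have hV1 : ∀ᶠ y in 𝓝 S.x, ∀ l n, |angFreq S.Δf (y l) n - omega S l n| < 1 := by
    refine eventually_all.2 fun l => eventually_all.2 fun n => ?_
    have := ((hfreq l n).sub_const (omega S l n)).abs
    rw [sub_self, abs_zero] at this
    exact this.eventually_lt_const one_pos
  have hV2 : ∀ᶠ y in 𝓝 S.x, ∀ l n,
      ‖Complex.exp (Complex.I * (angFreq S.Δf (y l) n : ℂ)) - Phi S l n‖ < η := by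
    refine eventually_all.2 fun l => eventually_all.2 fun n => ?_
    have hcont : Continuous fun t : ℝ => ‖Complex.exp (Complex.I * (t : ℂ)) - Phi S l n‖ := by
      fun_prop
    have := (hcont.tendsto (omega S l n)).comp (hfreq l n)
    rw [Phi, sub_self, norm_zero] at this
    exact this.eventually_lt_const hη
  -- Estimates in a fixed `V` are not known beforehand to converge to the true parameters. Building
  -- this bound into `V` derives their convergence from that of the frequencies.
  have hV3 : ∀ᶠ y in 𝓝 S.x, ∀ l,
      ‖y l - S.x l‖ ≤ K l * ‖angFreq S.Δf (y l) - angFreq S.Δf (S.x l)‖ :=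
    eventually_all.2 fun l => (hev l).eventually (hK l)
  have hV := hV1.and (hV2.and hV3)
  refine ⟨_, hV, eventually_exists_isParamEstimate S hΔf.ne' hshift hQ hγ hG hJ hJ5 hβ hφ hθ hV,
    ?_⟩
  set V := {y : Fin L → Fin 5 → ℝ | (∀ l n, |angFreq S.Δf (y l) n - omega S l n| < 1) ∧
    (∀ l n, ‖Complex.exp (Complex.I * (angFreq S.Δf (y l) n : ℂ)) - Phi S l n‖ < η) ∧
    ∀ l, ‖y l - S.x l‖ ≤ K l * ‖angFreq S.Δf (y l) - angFreq S.Δf (S.x l)‖}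
  -- All estimates in `V` for all errors at once, filtered by the error; a little-o along this
  -- filter is the required uniform bound.
  let α := {p : (Idx S → ℂ) × (Fin L → Fin 5 → ℝ) //
    p.2 ∈ V ∧ IsParamEstimate S (channel S + p.1) p.2}
  let 𝓛 : Filter α := comap (fun a => a.1.1) (𝓝 0)
  have hΔ : Tendsto (fun a : α => a.1.1) 𝓛 (𝓝 0) := tendsto_comap
  have hg : Tendsto (fun a : α => ‖a.1.1‖) 𝓛 (𝓝 0) := by simpa using hΔ.norm
  have hω := isParamEstimate_expansion S hshift hQ hγ hG hJ hJ5 hβ hη hsep hΔ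
    (y := fun a : α => a.1.2) (fun a => a.2.2) (fun a => a.2.1.1) (fun a => a.2.1.2.1)
  have hωO : ∀ l, (fun a : α => angFreq S.Δf (a.1.2 l) - angFreq S.Δf (S.x l)) =O[𝓛]
      fun a => ‖a.1.1‖ := by
    intro l
    refine isBigO_pi.2 fun n => ?_
    have h1 : (fun a : α => (star (upsilon S l n) ⬝ᵥ a.1.1).im) =O[𝓛] fun a => ‖a.1.1‖ :=
      (IsBigO.of_norm_le fun a => by
        rw [Real.norm_eq_abs]; exact Complex.abs_im_le_norm _).trans
        (dotProduct_isBigO (star (upsilon S l n)) fun a : α => a.1.1).norm_left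
    exact ((hω l n).isBigO.add h1).congr_left fun a => by
      rw [Pi.sub_apply, omega]; ring
  have hyO : ∀ l, (fun a : α => a.1.2 l - S.x l) =O[𝓛] fun a => ‖a.1.1‖ := fun l =>
    (IsBigO.of_bound (K l) (Eventually.of_forall fun a => a.2.1.2.2 l)).trans (hωO l)
  have hyt : ∀ l, Tendsto (fun a : α => a.1.2 l) 𝓛 (𝓝 (S.x l)) := fun l => by
    simpa using ((hyO l).trans_tendsto hg).add_const (S.x l)
  have hδ : (fun a : α => a.1.2 - S.x - fun l i => (star (kappa S l i) ⬝ᵥ a.1.1).im) =o[𝓛]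
      fun a => ‖a.1.1‖ := by
    refine isLittleO_pi.2 fun l => ?_
    have h1 := ((hloc l).2.comp_tendsto (hyt l)).trans_isBigO (hyO l)
    let J := (angFreqJacEquiv hΔf.ne' (hφ l) (hθ l)).symm
    have hJ' : ∀ v, J v = angFreqJacInv S.Δf (S.x l) v := fun v => rfl
    have h2 : (fun a : α => angFreq S.Δf (a.1.2 l) - angFreq S.Δf (S.x l) -
        fun n => (star (upsilon S l n) ⬝ᵥ a.1.1).im) =o[𝓛] fun a => ‖a.1.1‖ :=
      isLittleO_pi.2 fun n => hω l n
    have h3 := ((J : (Fin 5 → ℝ) →L[ℝ] (Fin 5 → ℝ)).isBigO_comp _ 𝓛).trans_isLittleO h2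
    refine (h1.add h3).congr_left fun a => ?_
    rw [ContinuousLinearEquiv.coe_coe, map_sub, hJ', hJ', ← im_star_kappa_dotProduct]
    simp only [Function.comp_apply, Pi.sub_apply]
    abel
  have hfinal := posEst_expansion hμ hC hgeo (y := fun a : α => a.1.2) (g := fun a => ‖a.1.1‖)
    (tendsto_pi_nhds.2 hyt) (isBigO_pi.2 hyO) hδ
  intro ε hε
  filter_upwards [eventually_comap.1 (hfinal.def hε)] with Δh h1 y hy hye
  have h2 := h1 ⟨(Δh, y), hy, hye⟩ rfl
  rw [norm_norm] at h2
  rw [im_Psi_mulVec]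
  exact h2
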